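/- Let $n\ge 1$ and let $(M,\varphi,\xi,\eta,g)$ be a $(2n+1)$-dimensional almost contact complex Riemannian (almost contact B-metric) manifold, that is, a smooth manifold with an endomorphism field $\varphi$, a vector field $\xi$, a 1-form $\eta$ and a pseudo-Riemannian metric $g$ of signature $(n+1,n)$, all smooth, such that $$\varphi\xi=0,\quad \varphi^2=-\mathrm{id}+\eta\otimes\xi,\quad \eta\circ\varphi=0,\quad \eta(\xi)=1,\quad g(\varphi x,\varphi y)=-g(x,y)+\eta(x)\eta(y).$$ Suppose that it is cosymplectic (an $\mathcal F_0$-manifold): $\nabla\varphi=0$ for the Levi-Civita connection $\nabla$ of $g$. Let $\tilde g(x,y)=g(x,\varphi y)+\eta(x)\eta(y)$, let $u,v,w$ be smooth functions on $M$, and let $(\varphi,\bar\xi,\bar\eta,\bar g)$ be the contact conformal transform $$\bar\xi=e^{-w}\xi,\quad \bar\eta=e^{w}\eta,\quad \bar g=e^{2u}\cos 2v\,g+e^{2u}\sin 2v\,\tilde g+\left(e^{2w}-e^{2u}\cos 2v-e^{2u}\sin 2v\right)\eta\otimes\eta .$$ Such a manifold $(M,\varphi,\bar\xi,\bar\eta,\bar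 g)$ is called a $G(\mathcal F_0)$-manifold. Let $\bar R$ and $\bar\rho$ be the curvature tensor and the Ricci tensor of $\bar g$, and let $\tilde{\bar g}(x,y)=\bar g(x,\varphi y)+\bar\eta(x)\bar\eta(y)$. Suppose that $(\bar g,\bar\vartheta,\bar\sigma)$ is an almost Riemann soliton with vertical potential, that is, $\bar\vartheta=\bar k\,\bar\xi$ for a smooth function $\bar k$ without zeros, $\bar\sigma$ is a smooth function, and $$2\bar R+\bar\sigma\,\bar g\owedge\bar g+\bar g\owedge\mathcal L_{\bar\vartheta}\bar g=0,$$ where $(g\owedge h)(x,y,z,w)=g(y,z)h(x,w)-g(x,z)h(y,w)+h(y,z)g(x,w)-h(x,z)g(y,w)$ is the Kulkarni--Nomizu product. If $n=1$, suppose in addition that $(M,\varphi,\bar\xi,\bar\eta,\bar g)$ is almost Einstein-like, that is, $\bar\rho=a\,\bar g+b\,\tilde{\bar g}+c\,\bar\eta\otimes\bar\eta$ for some smooth functions $a,b,c$ on $M$. Then: (i) $(M,\varphi,\bar\xi,\bar\eta,\bar g)$ is almost $\eta$-Einstein, i.e. $\bar\rho=a\,\bar g+c\,\bar\eta\otimes\bar\eta$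 for some smooth functions $a,c$, if and only if $v$ is a vertical constant, i.e. $dv(\bar\xi)=0$ on $M$; (ii) $(M,\varphi,\bar\xi,\bar\eta,\bar g)$ is almost Einstein, i.e. $\bar\rho=a\,\bar g$ for some smooth function $a$, if and only if $dv(\bar\xi)=0$ on $M$ and $\bar k=\mu e^{u}$ with constant $\mu$ on the vertical distribution $\mathcal V=\operatorname{span}\bar\xi$, i.e. along every integral curve of $\bar\xi$ there is a constant $\mu$ with $\bar k=\mu e^{u}$. -/

import Mathlib

open scoped Manifold ContDiff

namespace AccR

noncomputable section

/-! ### Pseudo-Riemannian geometry of a metric given by its components on a vector space -/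

section Coordinates

variable {E : Type*} [NormedAddCommGroup E] [NormedSpace ℝ E]

/-- Christoffel symbols of the first kind: the covector
`c ↦ ½ (∂_a G(b, c) + ∂_b G(a, c) - ∂_c G(a, b))` at `y`. -/
def christoffelFirst (G : E → E →L[ℝ] E →L[ℝ] ℝ) (y a b : E) : E →L[ℝ] ℝ :=
  (1 / 2 : ℝ) • (fderiv ℝ G y a b + fderiv ℝ G y b a - ((fderiv ℝ G y).flip a).flip b)

/-- Christoffel symbols of the second kind: the vector `Γ(a, b)` at `y`, obtained by raising the
index of `christoffelFirst` with the metric. -/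
def christoffel (G : E → E →L[ℝ] E →L[ℝ] ℝ) (y a b : E) : E :=
  (G y).inverse (christoffelFirst G y a b)

/-- `(∇_a Φ) b` for the Levi-Civita connection of `G` and a field `Φ` of endomorphisms. -/
def covDerivEnd (G : E → E →L[ℝ] E →L[ℝ] ℝ) (Φ : E → E →L[ℝ] E) (y a b : E) : E :=
  fderiv ℝ Φ y a b + christoffel G y a (Φ y b) - Φ y (christoffel G y a b)

/-- The curvature operator `R(a, b) c = ∇_a ∇_b c - ∇_b ∇_a c - ∇_[a, b] c`, computed on the
constant (hence commuting) vector fields `a`, `b`, `c`. -/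
def curvOp (G : E → E →L[ℝ] E →L[ℝ] ℝ) (y a b c : E) : E :=
  fderiv ℝ (fun z => christoffel G z b c) y a + christoffel G y a (christoffel G y b c)
    - (fderiv ℝ (fun z => christoffel G z a c) y b + christoffel G y b (christoffel G y a c))

/-- The curvature tensor of type `(0, 4)`: `R(a, b, c, d) = G(R(a, b) c, d)`. -/
def curv (G : E → E →L[ℝ] E →L[ℝ] ℝ) (y a b c d : E) : ℝ :=
  G y (curvOp G y a b c) d

/-- The Lie derivative of `G` along the vector field `V`, on the constant vector fields
`a`, `b`. -/
def lieDeriv (V : E → E) (G : E → E →L[ℝ] E →L[ℝ] ℝ) (y a b : E) : ℝ :=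
  fderiv ℝ G y (V y) a b + G y (fderiv ℝ V y a) b + G y a (fderiv ℝ V y b)

end Coordinates

/-- The Ricci tensor `ρ(b, c) = tr (a ↦ R(a, b) c)`, as the sum over an orthonormal basis of the
model space of the corresponding components of `R(e_i, b) c`. -/
def ricci {m : ℕ}
    (G : EuclideanSpace ℝ (Fin m) →
      EuclideanSpace ℝ (Fin m) →L[ℝ] EuclideanSpace ℝ (Fin m) →L[ℝ] ℝ)
    (y b c : EuclideanSpace ℝ (Fin m)) : ℝ :=
  ∑ i : Fin m, curvOp G y (EuclideanSpace.single i 1) b c i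

/-- The Kulkarni-Nomizu product of two `(0, 2)`-tensors on a vector space. -/
def kulkarniNomizu {T : Type*} (g h : T → T → ℝ) (x y z w : T) : ℝ :=
  g y z * h x w - g x z * h y w + h y z * g x w - h x z * g y w

/-! ### Tensor fields on a manifold of dimension `2n + 1` and their representations in charts -/

/-- The model space of dimension `2n + 1`. -/
abbrev Model (n : ℕ) : Type := EuclideanSpace ℝ (Fin (2 * n + 1))

/-- The tangent space at `p` of a manifold of dimension `2n + 1`. -/
abbrev Tan (n : ℕ) {M : Type*} [TopologicalSpace M] [ChartedSpace (Model n) M] (p : M) : Type :=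
  TangentSpace 𝓘(ℝ, Model n) p

section Manifold

variable {n : ℕ} {M : Type*} [TopologicalSpace M] [ChartedSpace (Model n) M]

/-- The differential of the inverse of the chart `e` at `y`. -/
def dChartSymm (e : OpenPartialHomeomorph M (Model n)) (y : Model n) :
    Model n →L[ℝ] Tan n (e.symm y) :=
  mfderiv 𝓘(ℝ, Model n) 𝓘(ℝ, Model n) e.symm y

/-- The differential of the chart `e` at `p`. -/
def dChart (e : OpenPartialHomeomorph M (Model n)) (p : M) : Tan n p →L[ℝ] Model n :=
  mfderiv 𝓘(ℝ, Model n) 𝓘(ℝ, Model n) e p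

/-- A `(0, 2)`-tensor field in the chart `e`. -/
def bilinInChart (e : OpenPartialHomeomorph M (Model n))
    (g : ∀ p : M, Tan n p →L[ℝ] Tan n p →L[ℝ] ℝ) (y : Model n) :
    Model n →L[ℝ] Model n →L[ℝ] ℝ :=
  (ContinuousLinearMap.precomp ℝ (dChartSymm e y)) ∘L (g (e.symm y)) ∘L (dChartSymm e y)

/-- A `1`-form in the chart `e`. -/
def formInChart (e : OpenPartialHomeomorph M (Model n))
    (η : ∀ p : M, Tan n p →L[ℝ] ℝ) (y : Model n) : Model n →L[ℝ] ℝ :=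
  (η (e.symm y)) ∘L (dChartSymm e y)

/-- A field of endomorphisms of the tangent spaces in the chart `e`. -/
def endInChart (e : OpenPartialHomeomorph M (Model n))
    (φ : ∀ p : M, Tan n p →L[ℝ] Tan n p) (y : Model n) : Model n →L[ℝ] Model n :=
  (dChartSymm e y).inverse ∘L (φ (e.symm y)) ∘L (dChartSymm e y)

/-- A vector field in the chart `e`. -/
def vecInChart (e : OpenPartialHomeomorph M (Model n))
    (X : ∀ p : M, Tan n p) (y : Model n) : Model n :=
  VectorField.mpullback 𝓘(ℝ, Model n) 𝓘(ℝ, Model n) e.symm X y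

/-- Curvature tensor of the metric `g` at `p`, computed in the chart `e`. -/
def curvIn (e : OpenPartialHomeomorph M (Model n))
    (g : ∀ p : M, Tan n p →L[ℝ] Tan n p →L[ℝ] ℝ) (p : M) (x y z w : Tan n p) : ℝ :=
  curv (bilinInChart e g) (e p) (dChart e p x) (dChart e p y) (dChart e p z) (dChart e p w)

/-- Ricci tensor of the metric `g` at `p`, computed in the chart `e`. -/
def ricciIn (e : OpenPartialHomeomorph M (Model n))
    (g : ∀ p : M, Tan n p →L[ℝ] Tan n p →L[ℝ] ℝ) (p : M) (x y : Tan n p) : ℝ :=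
  ricci (bilinInChart e g) (e p) (dChart e p x) (dChart e p y)

/-- Lie derivative of `g` along the vector field `X` at `p`, computed in the chart `e`. -/
def lieDerivIn (e : OpenPartialHomeomorph M (Model n)) (X : ∀ p : M, Tan n p)
    (g : ∀ p : M, Tan n p →L[ℝ] Tan n p →L[ℝ] ℝ) (p : M) (x y : Tan n p) : ℝ :=
  lieDeriv (vecInChart e X) (bilinInChart e g) (e p) (dChart e p x) (dChart e p y)

end Manifold

/-! ### Almost contact complex Riemannian structures -/

/-- The tensor fields `(φ, ξ, η, g)` that make up an almost contact structure together with a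
metric; the laws are in `AccRData.IsAccR`. -/
structure AccRData (n : ℕ) (M : Type*) [TopologicalSpace M] [ChartedSpace (Model n) M] where
  φ : ∀ p : M, Tan n p →L[ℝ] Tan n p
  ξ : ∀ p : M, Tan n p
  η : ∀ p : M, Tan n p →L[ℝ] ℝ
  g : ∀ p : M, Tan n p →L[ℝ] Tan n p →L[ℝ] ℝ

namespace AccRData

variable {n : ℕ} {M : Type*} [TopologicalSpace M] [ChartedSpace (Model n) M]

/-- `(φ, ξ, η, g)` is an almost contact complex Riemannian (almost contact B-metric) structure:
smooth tensor fields, `g` a pseudo-Riemannian metric, with the algebraic relations between them.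
The signature `(n + 1, n)` of `g` is a consequence: `g(ξ, ξ) = 1`, `ξ` is orthogonal to `ker η`,
and `φ` is an anti-isometry of `g` on `ker η`. -/
structure IsAccR [IsManifold 𝓘(ℝ, Model n) ∞ M] (S : AccRData n M) : Prop where
  smooth_φ : ∀ e ∈ atlas (Model n) M, ContDiffOn ℝ ∞ (endInChart e S.φ) e.target
  smooth_ξ : ContMDiff 𝓘(ℝ, Model n) 𝓘(ℝ, Model n).tangent ∞
    (fun p => (⟨p, S.ξ p⟩ : TangentBundle 𝓘(ℝ, Model n) M))
  smooth_η : ∀ e ∈ atlas (Model n) M, ContDiffOn ℝ ∞ (formInChart e S.η) e.target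
  smooth_g : ∀ e ∈ atlas (Model n) M, ContDiffOn ℝ ∞ (bilinInChart e S.g) e.target
  symm_g : ∀ (p : M) (x y : Tan n p), S.g p x y = S.g p y x
  nondeg_g : ∀ (p : M) (x : Tan n p), (∀ y : Tan n p, S.g p x y = 0) → x = 0
  φ_ξ : ∀ p : M, S.φ p (S.ξ p) = 0
  φ_φ : ∀ (p : M) (x : Tan n p), S.φ p (S.φ p x) = -x + S.η p x • S.ξ p
  η_φ : ∀ (p : M) (x : Tan n p), S.η p (S.φ p x) = 0
  η_ξ : ∀ p : M, S.η p (S.ξ p) = 1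
  g_φ_φ : ∀ (p : M) (x y : Tan n p),
    S.g p (S.φ p x) (S.φ p y) = -S.g p x y + S.η p x * S.η p y

/-- The associated B-metric `g̃(x, y) = g(x, φ y) + η(x) η(y)`. -/
def gTilde (S : AccRData n M) (p : M) (x y : Tan n p) : ℝ :=
  S.g p x (S.φ p y) + S.η p x * S.η p y

/-- The fundamental tensor `F(x, y, z) = g((∇_x φ) y, z)` at `p`, computed in the chart `e`. -/
def fundamentalIn (S : AccRData n M) (e : OpenPartialHomeomorph M (Model n))
    (p : M) (x y z : Tan n p) : ℝ :=
  bilinInChart e S.g (e p)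
    (covDerivEnd (bilinInChart e S.g) (endInChart e S.φ) (e p) (dChart e p x) (dChart e p y))
    (dChart e p z)

/-- The structure is cosymplectic (of class `F₀`): the fundamental tensor vanishes. -/
def IsF0 (S : AccRData n M) : Prop :=
  ∀ e ∈ atlas (Model n) M, ∀ p ∈ e.source, ∀ x y z : Tan n p, S.fundamentalIn e p x y z = 0

/-- The contact conformal transformation (`G`-transformation) of `(φ, ξ, η, g)` determined by the
functions `u`, `v`, `w`:
`ξ̄ = e^{-w} ξ`, `η̄ = e^w η`,
`ḡ = e^{2u} cos 2v g + e^{2u} sin 2v g̃ + (e^{2w} - e^{2u} cos 2v - e^{2u} sin 2v) η ⊗ η`.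
In the definition of `ḡ` the tensor `g̃` is written out as `g(·, φ ·) + η ⊗ η`. -/
def gTransform (S : AccRData n M) (u v w : M → ℝ) : AccRData n M where
  φ := S.φ
  ξ p := Real.exp (-w p) • S.ξ p
  η p := Real.exp (w p) • S.η p
  g p :=
    (Real.exp (2 * u p) * Real.cos (2 * v p)) • S.g p
      + (Real.exp (2 * u p) * Real.sin (2 * v p)) •
        ((ContinuousLinearMap.precomp ℝ (S.φ p)) ∘L (S.g p) + (S.η p).smulRight (S.η p))
      + (Real.exp (2 * w p) - Real.exp (2 * u p) * Real.cos (2 * v p)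
          - Real.exp (2 * u p) * Real.sin (2 * v p)) • (S.η p).smulRight (S.η p)

theorem gTransform_g_apply (S : AccRData n M) (u v w : M → ℝ) (p : M) (x y : Tan n p) :
    (S.gTransform u v w).g p x y =
      Real.exp (2 * u p) * Real.cos (2 * v p) * S.g p x y
        + Real.exp (2 * u p) * Real.sin (2 * v p) * S.gTilde p x y
        + (Real.exp (2 * w p) - Real.exp (2 * u p) * Real.cos (2 * v p)
            - Real.exp (2 * u p) * Real.sin (2 * v p)) * (S.η p x * S.η p y) := rfl

/-- `(g, ϑ, σ)` is an almost Riemann soliton: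
`2 R + σ g ∧ g + g ∧ L_ϑ g = 0`, with the Kulkarni-Nomizu product `∧` and a smooth function `σ`. -/
def IsAlmostRiemannSoliton (S : AccRData n M) (ϑ : ∀ p : M, Tan n p) (σ : M → ℝ) : Prop :=
  ContMDiff 𝓘(ℝ, Model n) 𝓘(ℝ, ℝ) ∞ σ ∧
  ∀ e ∈ atlas (Model n) M, ∀ p ∈ e.source, ∀ x y z w : Tan n p,
    2 * curvIn e S.g p x y z w
      + σ p * kulkarniNomizu (fun a b => S.g p a b) (fun a b => S.g p a b) x y z w
      + kulkarniNomizu (fun a b => S.g p a b) (fun a b => lieDerivIn e ϑ S.g p a b) x y z w = 0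

/-- The Ricci tensor is `ρ = a g + b g̃ + c η ⊗ η`. -/
def RicciEq (S : AccRData n M) (a b c : M → ℝ) : Prop :=
  ∀ e ∈ atlas (Model n) M, ∀ p ∈ e.source, ∀ x y : Tan n p,
    ricciIn e S.g p x y = a p * S.g p x y + b p * S.gTilde p x y + c p * (S.η p x * S.η p y)

/-- Almost Einstein-like: `ρ = a g + b g̃ + c η ⊗ η` for smooth functions `a`, `b`, `c`. -/
def IsAlmostEinsteinLike (S : AccRData n M) : Prop :=
  ∃ a b c : M → ℝ, ContMDiff 𝓘(ℝ, Model n) 𝓘(ℝ, ℝ) ∞ a ∧ ContMDiff 𝓘(ℝ, Model n) 𝓘(ℝ, ℝ) ∞ b ∧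
    ContMDiff 𝓘(ℝ, Model n) 𝓘(ℝ, ℝ) ∞ c ∧ S.RicciEq a b c

/-- Almost `η`-Einstein: `ρ = a g + c η ⊗ η` for smooth functions `a`, `c`. -/
def IsAlmostEtaEinstein (S : AccRData n M) : Prop :=
  ∃ a c : M → ℝ, ContMDiff 𝓘(ℝ, Model n) 𝓘(ℝ, ℝ) ∞ a ∧ ContMDiff 𝓘(ℝ, Model n) 𝓘(ℝ, ℝ) ∞ c ∧
    S.RicciEq a (fun _ => 0) c

/-- Almost Einstein: `ρ = a g` for a smooth function `a`. -/
def IsAlmostEinstein (S : AccRData n M) : Prop :=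
  ∃ a : M → ℝ, ContMDiff 𝓘(ℝ, Model n) 𝓘(ℝ, ℝ) ∞ a ∧ S.RicciEq a (fun _ => 0) (fun _ => 0)

/-- `v` is a vertical constant: `dv(ξ) = 0`. -/
def IsVerticalConstant (S : AccRData n M) (v : M → ℝ) : Prop :=
  ∀ p : M, (mfderiv 𝓘(ℝ, Model n) 𝓘(ℝ, ℝ) v p : Tan n p → ℝ) (S.ξ p) = 0

/-- `k = μ e^u` holds on the vertical distribution `span ξ` for a constant `μ`: along each integral
curve of `ξ` the function `k` is a constant multiple of `e^u`. -/
def EqConstMulExpOnVertical (S : AccRData n M) (k u : M → ℝ) : Prop :=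
  ∀ (γ : ℝ → M) (a b : ℝ), IsMIntegralCurveOn (I := 𝓘(ℝ, Model n)) γ S.ξ (Set.Ioo a b) →
    ∃ μ : ℝ, ∀ t ∈ Set.Ioo a b, k (γ t) = μ * Real.exp (u (γ t))

end AccRData

end

end AccR

open scoped Manifold ContDiff

set_option maxSynthPendingDepth 3

/-! Write H = ker η and f = k e^{-w}, so that the potential is fξ, and let G be the transformed
metric. In a cosymplectic structure ∇ξ = 0; hence dη = 0, and the flow of ξ preserves g, η and φ.
The Lie derivative of G along fξ is therefore a combination of G, G(·, φ·), η ⊗ η and the symmetric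
product of df and η (`lieDeriv_transform_smul`). The soliton equation says that the curvature is a
Kulkarni-Nomizu product of G with a tensor B of the same shape, and its trace is ρ = sG + (2n - 1)B
(`ricci_of_kulkarniNomizu`). The G(·, φ·) part of ρ is a nonzero constant times f dv(ξ), and its
mixed part is a nonvanishing factor times df on H.

An η-Einstein metric has no G(·, φ·) part and f has no zeros, so dv(ξ) = 0 (`dir_v_eq_zero`).
Conversely, if dv(ξ) = 0 and df = 0 on H, then ρ = aG + cη̄ ⊗ η̄ with c = -(2n - 1)(ξf + f(ξw - ξu))
= -(2n - 1)e^{-w}(ξk - kξu) (`ricci_eq`, `dir_potential_eq_speed`). The metric is Einstein exactly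
when c vanishes, that is, when k e^{-u} is constant along the integral curves of ξ̄
(`eqConstMulExpOnVertical_iff`).

It remains to see that dv(ξ) = 0 forces df = 0 on H. For n = 1 this is read off from the mixed part
of the Einstein-like Ricci tensor. For n ≥ 2 it is `VerticalSoliton.fderiv_f_eq_zero`, the core of
the proof. Put p = ξu, ω = e^{-w}, χ = -pe^{-w}, l = ξw - p. The Ricci identity for η gives df = -2ω
dχ on H, and the second Bianchi identity makes B a Codazzi tensor (`IsMetricOn.codazzi`). From
these, each of the functions s = ω, χ, l satisfies Hess s + dw ⊗ ds + ds ⊗ dw = κG on H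
(equivalently, its Hessian for e^{-2w}G is pure trace there), and dω, dχ are proportional on H. A
relation between horizontal differentials of functions with such Hessians can be differentiated;
what is left is a product of two covectors proportional to G on H, and a form of rank at most one
can be so only if it vanishes (`hess_of_smul_eq`). On an open set where dχ ≠ 0 on H, this first
yields dω = 0 on H (`ratio_eq_zero`) and then a contradiction (`false_of_expNeg_const`). -/

namespace AccR

/-! ### Connections on a vector space: the Ricci identity and the second Bianchi identity. -/

section Connection

variable {E : Type*} [NormedAddCommGroup E] [NormedSpace ℝ E]

/-- Transposition of bilinear forms. -/
noncomputable def flipL (E : Type*) [NormedAddCommGroup E] [NormedSpace ℝ E] :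
    (E →L[ℝ] E →L[ℝ] ℝ) →L[ℝ] E →L[ℝ] E →L[ℝ] ℝ :=
  ((ContinuousLinearMap.flipₗᵢ ℝ E E ℝ).toContinuousLinearEquiv).toContinuousLinearMap

@[simp]
theorem flipL_apply (A : E →L[ℝ] E →L[ℝ] ℝ) : flipL E A = A.flip := rfl

/-- `christoffelFirst` as a bilinear map. -/
noncomputable def christoffelFirstL (G : E → E →L[ℝ] E →L[ℝ] ℝ) (y : E) :
    E →L[ℝ] E →L[ℝ] E →L[ℝ] ℝ :=
  (1 / 2 : ℝ) • (fderiv ℝ G y + (fderiv ℝ G y).flip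
    - ((flipL E).comp (fderiv ℝ G y).flip : E →L[ℝ] E →L[ℝ] E →L[ℝ] ℝ))

/-- `christoffel` as a bilinear map. -/
noncomputable def christoffelL (G : E → E →L[ℝ] E →L[ℝ] ℝ) (y : E) : E →L[ℝ] E →L[ℝ] E :=
  (ContinuousLinearMap.compL ℝ E (E →L[ℝ] ℝ) E (G y).inverse) ∘L christoffelFirstL G y

theorem christoffelFirstL_apply (G : E → E →L[ℝ] E →L[ℝ] ℝ) (y a b : E) :
    christoffelFirstL G y a b = christoffelFirst G y a b := by
  simp [christoffelFirstL, christoffelFirst]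

theorem christoffelL_apply (G : E → E →L[ℝ] E →L[ℝ] ℝ) (y a b : E) :
    christoffelL G y a b = christoffel G y a b := by
  simp [christoffelL, christoffel, christoffelFirstL_apply]

/-- The covariant derivative `(∇_a ν) b` of a `1`-form. -/
noncomputable def covForm (Γ : E → E →L[ℝ] E →L[ℝ] E) (ν : E → E →L[ℝ] ℝ) (y : E) :
    E →L[ℝ] E →L[ℝ] ℝ :=
  fderiv ℝ ν y - (ContinuousLinearMap.compL ℝ E E ℝ (ν y)) ∘L Γ y

theorem covForm_apply (Γ : E → E →L[ℝ] E →L[ℝ] E) (ν : E → E →L[ℝ] ℝ) (y a b : E) :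
    covForm Γ ν y a b = fderiv ℝ ν y a b - ν y (Γ y a b) := by
  simp [covForm]

/-- The covariant derivative `(∇_a T)(b, c)` of a `(0, 2)`-tensor. -/
noncomputable def covBilin (Γ : E → E →L[ℝ] E →L[ℝ] E) (T : E → E →L[ℝ] E →L[ℝ] ℝ)
    (y a b c : E) : ℝ :=
  fderiv ℝ T y a b c - T y (Γ y a b) c - T y b (Γ y a c)

/-- The curvature operator of a connection given by its Christoffel symbols. -/
noncomputable def connCurv (Γ : E → E →L[ℝ] E →L[ℝ] E) (y a b c : E) : E :=
  fderiv ℝ Γ y a b c + Γ y a (Γ y b c) - (fderiv ℝ Γ y b a c + Γ y b (Γ y a c))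

theorem fderiv_apply₁ {F : Type*} [NormedAddCommGroup F] [NormedSpace ℝ F]
    {ν : E → E →L[ℝ] F} {y : E} (h : DifferentiableAt ℝ ν y) (a b : E) :
    fderiv ℝ (fun z => ν z b) y a = fderiv ℝ ν y a b := by
  rw [fderiv_clm_apply h (differentiableAt_const b)]
  simp

theorem fderiv_apply₂ {F : Type*} [NormedAddCommGroup F] [NormedSpace ℝ F]
    {T : E → E →L[ℝ] E →L[ℝ] F} {y : E} (h : DifferentiableAt ℝ T y)
    (a b c : E) : fderiv ℝ (fun z => T z b c) y a = fderiv ℝ T y a b c := by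
  rw [fderiv_apply₁ (ν := fun z => T z b) (h.clm_apply (differentiableAt_const b)),
    fderiv_apply₁ h]

theorem contDiffOn_fderiv {F : Type*} [NormedAddCommGroup F] [NormedSpace ℝ F] {U : Set E}
    (hU : IsOpen U) {ν : E → F} (h : ContDiffOn ℝ ∞ ν U) : ContDiffOn ℝ ∞ (fderiv ℝ ν) U :=
  h.fderiv_of_isOpen hU (by simp)

theorem differentiableAt_of_contDiffOn {F : Type*} [NormedAddCommGroup F] [NormedSpace ℝ F]
    {U : Set E} (hU : IsOpen U) {ν : E → F} (h : ContDiffOn ℝ ∞ ν U) {y : E} (hy : y ∈ U) :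
    DifferentiableAt ℝ ν y :=
  (h.contDiffAt (hU.mem_nhds hy)).differentiableAt (by simp)

theorem fderiv_fderiv_comm {F : Type*} [NormedAddCommGroup F] [NormedSpace ℝ F] {U : Set E}
    (hU : IsOpen U) {ν : E → F} (h : ContDiffOn ℝ ∞ ν U) {y : E} (hy : y ∈ U) (a b : E) :
    fderiv ℝ (fderiv ℝ ν) y a b = fderiv ℝ (fderiv ℝ ν) y b a :=
  ((h.contDiffAt (hU.mem_nhds hy)).isSymmSndFDerivAt
    (by simp only [minSmoothness_of_isRCLikeNormedField]; exact WithTop.coe_le_coe.2 le_top)) a b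

theorem fderiv_eq_of_eqOn {F : Type*} [NormedAddCommGroup F] [NormedSpace ℝ F] {U : Set E}
    (hU : IsOpen U) {f g : E → F} (h : ∀ y ∈ U, f y = g y) {y : E} (hy : y ∈ U) :
    fderiv ℝ f y = fderiv ℝ g y :=
  Filter.EventuallyEq.fderiv_eq (Filter.eventually_of_mem (hU.mem_nhds hy) h)

theorem contDiffOn_covForm {U : Set E} (hU : IsOpen U) {Γ : E → E →L[ℝ] E →L[ℝ] E}
    (hΓ : ContDiffOn ℝ ∞ Γ U) {ν : E → E →L[ℝ] ℝ} (hν : ContDiffOn ℝ ∞ ν U) :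
    ContDiffOn ℝ ∞ (covForm Γ ν) U :=
  (contDiffOn_fderiv hU hν).sub
    (ContDiffOn.clm_comp (g := fun y => ContinuousLinearMap.compL ℝ E E ℝ (ν y))
      ((contDiff_const (c := ContinuousLinearMap.compL ℝ E E ℝ)).contDiffOn.clm_apply hν) hΓ)

/-- The Ricci identity for a `1`-form. -/
theorem ricci_identity {U : Set E} (hU : IsOpen U) {Γ : E → E →L[ℝ] E →L[ℝ] E}
    (hΓ : ContDiffOn ℝ ∞ Γ U) {y : E} (hy : y ∈ U) (hs : ∀ a b, Γ y a b = Γ y b a)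
    {ν : E → E →L[ℝ] ℝ} (hν : ContDiffOn ℝ ∞ ν U) (a b c : E) :
    covBilin Γ (covForm Γ ν) y a b c - covBilin Γ (covForm Γ ν) y b a c
      = -ν y (connCurv Γ y a b c) := by
  have key : ∀ a b c : E, fderiv ℝ (covForm Γ ν) y a b c
      = fderiv ℝ (fderiv ℝ ν) y a b c - (fderiv ℝ ν y a (Γ y b c)
        + ν y (fderiv ℝ Γ y a b c)) := by
    intro a b c
    have dν := differentiableAt_of_contDiffOn hU hν hy
    have dν' := differentiableAt_of_contDiffOn hU (contDiffOn_fderiv hU hν) hy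
    have dΓ := differentiableAt_of_contDiffOn hU hΓ hy
    have dΓ' : DifferentiableAt ℝ (fun z => Γ z b c) y :=
      (dΓ.clm_apply (differentiableAt_const b)).clm_apply (differentiableAt_const c)
    rw [← fderiv_apply₂ (differentiableAt_of_contDiffOn hU (contDiffOn_covForm hU hΓ hν) hy)]
    simp only [covForm_apply]
    rw [fderiv_fun_sub ((dν'.clm_apply (differentiableAt_const b)).clm_apply
      (differentiableAt_const c)) (dν.clm_apply dΓ'), fderiv_clm_apply dν dΓ']
    simp [fderiv_apply₂ dν', fderiv_apply₂ dΓ]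
    ring
  simp only [covBilin, key, connCurv, covForm_apply, hs b a, map_sub, map_add]
  rw [fderiv_fderiv_comm hU hν hy a b]
  ring

/-- The second Bianchi identity for a torsion free connection. -/
theorem bianchi_identity {U : Set E} (hU : IsOpen U) {Γ : E → E →L[ℝ] E →L[ℝ] E}
    (hΓ : ContDiffOn ℝ ∞ Γ U) {y : E} (hy : y ∈ U) (a b e c : E) :
    (fderiv ℝ (fun z => connCurv Γ z a b c) y e + Γ y e (connCurv Γ y a b c)
        - connCurv Γ y a b (Γ y e c))
      + (fderiv ℝ (fun z => connCurv Γ z b e c) y a + Γ y a (connCurv Γ y b e c)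
        - connCurv Γ y b e (Γ y a c))
      + (fderiv ℝ (fun z => connCurv Γ z e a c) y b + Γ y b (connCurv Γ y e a c)
        - connCurv Γ y e a (Γ y b c)) = 0 := by
  have dΓ := differentiableAt_of_contDiffOn hU hΓ hy
  have dΓ' := differentiableAt_of_contDiffOn hU (contDiffOn_fderiv hU hΓ) hy
  have d2 : ∀ b c : E, DifferentiableAt ℝ (fun z => Γ z b c) y := fun b c =>
      (dΓ.clm_apply (differentiableAt_const b)).clm_apply (differentiableAt_const c)
  have dd : ∀ a b c : E, DifferentiableAt ℝ (fun z => fderiv ℝ Γ z a b c) y := fun a b c =>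
      ((dΓ'.clm_apply (differentiableAt_const a)).clm_apply (differentiableAt_const b)).clm_apply
        (differentiableAt_const c)
  have dG : ∀ a b c : E, DifferentiableAt ℝ (fun z => Γ z a (Γ z b c)) y := fun a b c =>
      (dΓ.clm_apply (differentiableAt_const a)).clm_apply (d2 b c)
  have fG : ∀ e a b c : E, fderiv ℝ (fun z => Γ z a (Γ z b c)) y e
      = Γ y a (fderiv ℝ Γ y e b c) + fderiv ℝ Γ y e a (Γ y b c) := by
    intro e a b c
    rw [fderiv_clm_apply (dΓ.clm_apply (differentiableAt_const a)) (d2 b c)]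
    simp [fderiv_apply₂ dΓ, fderiv_apply₁ dΓ]
  have fd : ∀ e a b c : E, fderiv ℝ (fun z => fderiv ℝ Γ z a b c) y e
      = fderiv ℝ (fderiv ℝ Γ) y e a b c := by
    intro e a b c
    rw [fderiv_apply₂ (T := fun z => fderiv ℝ Γ z a) (dΓ'.clm_apply (differentiableAt_const a)),
      fderiv_apply₁ dΓ']
  have key : ∀ a b c e : E, fderiv ℝ (fun z => connCurv Γ z a b c) y e
      = fderiv ℝ (fderiv ℝ Γ) y e a b c
        + (Γ y a (fderiv ℝ Γ y e b c) + fderiv ℝ Γ y e a (Γ y b c))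
        - (fderiv ℝ (fderiv ℝ Γ) y e b a c
        + (Γ y b (fderiv ℝ Γ y e a c) + fderiv ℝ Γ y e b (Γ y a c))) := by
    intro a b c e
    simp only [connCurv]
    rw [fderiv_fun_sub ((dd _ _ _).fun_add (dG _ _ _)) ((dd _ _ _).fun_add (dG _ _ _)),
      fderiv_fun_add (dd _ _ _) (dG _ _ _), fderiv_fun_add (dd _ _ _) (dG _ _ _)]
    simp [fG, fd]
  rw [key, key, key]
  simp only [connCurv, map_add, map_sub]
  rw [fderiv_fderiv_comm hU hΓ hy e a, fderiv_fderiv_comm hU hΓ hy e b,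
    fderiv_fderiv_comm hU hΓ hy a b]
  abel

end Connection

end AccR

namespace AccR

/-! ### Leibniz rules for covariant derivatives of forms and bilinear tensors. -/

section Rules

variable {E : Type*} [NormedAddCommGroup E] [NormedSpace ℝ E]
  {Γ : E → E →L[ℝ] E →L[ℝ] E} {y : E}

/-- The tensor product of two linear forms. -/
noncomputable def tmul (ν μ : E →L[ℝ] ℝ) : E →L[ℝ] E →L[ℝ] ℝ := ν.smulRight μ

@[simp]
theorem tmul_apply (ν μ : E →L[ℝ] ℝ) (a b : E) : tmul ν μ a b = ν a * μ b := by
  simp [tmul]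

theorem contDiffOn_tmul {U : Set E} {ν μ : E → E →L[ℝ] ℝ} (hν : ContDiffOn ℝ ∞ ν U)
    (hμ : ContDiffOn ℝ ∞ μ U) : ContDiffOn ℝ ∞ (fun y => tmul (ν y) (μ y)) U :=
  ContDiffOn.clm_apply (f := fun y => ContinuousLinearMap.smulRightL ℝ E (E →L[ℝ] ℝ) (ν y))
    ((contDiff_const (c := ContinuousLinearMap.smulRightL ℝ E (E →L[ℝ] ℝ))).contDiffOn.clm_apply hν)
    hμ

theorem covForm_add {ν μ : E → E →L[ℝ] ℝ} (hν : DifferentiableAt ℝ ν y)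
    (hμ : DifferentiableAt ℝ μ y) (a b : E) :
    covForm Γ (fun z => ν z + μ z) y a b = covForm Γ ν y a b + covForm Γ μ y a b := by
  simp only [covForm_apply, fderiv_fun_add hν hμ, add_apply]
  ring

theorem covForm_smul {s : E → ℝ} {ν : E → E →L[ℝ] ℝ} (hs : DifferentiableAt ℝ s y)
    (hν : DifferentiableAt ℝ ν y) (a b : E) :
    covForm Γ (fun z => s z • ν z) y a b = fderiv ℝ s y a * ν y b + s y * covForm Γ ν y a b := by
  simp only [covForm_apply, fderiv_fun_smul hs hν]
  simp
  ring

theorem covForm_congr {U : Set E} (hU : IsOpen U) {ν μ : E → E →L[ℝ] ℝ}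
    (h : ∀ z ∈ U, ν z = μ z) (hy : y ∈ U) : covForm Γ ν y = covForm Γ μ y := by
  simp only [covForm, fderiv_eq_of_eqOn hU h hy, h y hy]

theorem covBilin_add {S T : E → E →L[ℝ] E →L[ℝ] ℝ} (hS : DifferentiableAt ℝ S y)
    (hT : DifferentiableAt ℝ T y) (a b c : E) :
    covBilin Γ (fun z => S z + T z) y a b c = covBilin Γ S y a b c + covBilin Γ T y a b c := by
  simp only [covBilin, fderiv_fun_add hS hT, add_apply]
  ring

theorem covBilin_sub {S T : E → E →L[ℝ] E →L[ℝ] ℝ} (hS : DifferentiableAt ℝ S y)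
    (hT : DifferentiableAt ℝ T y) (a b c : E) :
    covBilin Γ (fun z => S z - T z) y a b c = covBilin Γ S y a b c - covBilin Γ T y a b c := by
  simp only [covBilin, fderiv_fun_sub hS hT, sub_apply]
  ring

theorem covBilin_smul {s : E → ℝ} {T : E → E →L[ℝ] E →L[ℝ] ℝ} (hs : DifferentiableAt ℝ s y)
    (hT : DifferentiableAt ℝ T y) (a b c : E) :
    covBilin Γ (fun z => s z • T z) y a b c
      = fderiv ℝ s y a * T y b c + s y * covBilin Γ T y a b c := by
  simp only [covBilin, fderiv_fun_smul hs hT]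
  simp
  ring

theorem covBilin_tmul {ν μ : E → E →L[ℝ] ℝ} (hν : DifferentiableAt ℝ ν y)
    (hμ : DifferentiableAt ℝ μ y) (a b c : E) :
    covBilin Γ (fun z => tmul (ν z) (μ z)) y a b c
      = covForm Γ ν y a b * μ y c + ν y b * covForm Γ μ y a c := by
  have h : fderiv ℝ (fun z => tmul (ν z) (μ z)) y a b c
      = fderiv ℝ ν y a b * μ y c + ν y b * fderiv ℝ μ y a c := by
    have hd : DifferentiableAt ℝ (fun z => tmul (ν z) (μ z)) y :=
      DifferentiableAt.clm_apply
        (c := fun y => ContinuousLinearMap.smulRightL ℝ E (E →L[ℝ] ℝ) (ν y))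
        ((differentiableAt_const
          (ContinuousLinearMap.smulRightL ℝ E (E →L[ℝ] ℝ))).clm_apply hν) hμ
    rw [← fderiv_apply₂ hd]
    simp only [tmul_apply]
    rw [fderiv_fun_mul (hν.clm_apply (differentiableAt_const b))
      (hμ.clm_apply (differentiableAt_const c))]
    simp [fderiv_apply₁ hν, fderiv_apply₁ hμ]
    ring
  simp only [covBilin, h, covForm_apply, tmul_apply]
  ring

theorem covBilin_congr {U : Set E} (hU : IsOpen U) {S T : E → E →L[ℝ] E →L[ℝ] ℝ}
    (h : ∀ z ∈ U, S z = T z) (hy : y ∈ U) (a b c : E) :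
    covBilin Γ S y a b c = covBilin Γ T y a b c := by
  simp only [covBilin, fderiv_eq_of_eqOn hU h hy, h y hy]

end Rules

/-! ### The Levi-Civita connection, and the Codazzi property from the Bianchi identity. -/

section Metric

variable {E : Type*} [NormedAddCommGroup E] [NormedSpace ℝ E]

/-- `G` is a smooth pseudo-Riemannian metric on the open set `U`. -/
structure IsMetricOn (G : E → E →L[ℝ] E →L[ℝ] ℝ) (U : Set E) : Prop where
  isOpen : IsOpen U
  smooth : ContDiffOn ℝ ∞ G U
  symm : ∀ y ∈ U, ∀ a b, G y a b = G y b a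
  inv : ∀ y ∈ U, (G y).IsInvertible

variable {G : E → E →L[ℝ] E →L[ℝ] ℝ} {U : Set E}

theorem isInvertible_of_nondeg [FiniteDimensional ℝ E] (g : E →L[ℝ] E →L[ℝ] ℝ)
    (h : ∀ a, (∀ b, g a b = 0) → a = 0) : g.IsInvertible := by
  have hinj : Function.Injective g.toLinearMap := by
    rw [← LinearMap.ker_eq_bot, LinearMap.ker_eq_bot']
    intro a ha
    exact h a fun b => by
      have : g a = 0 := ha
      simp [this]
  have hfin : Module.finrank ℝ E = Module.finrank ℝ (E →L[ℝ] ℝ) := by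
    rw [← (LinearMap.toContinuousLinearMap (𝕜 := ℝ) (E := E) (F' := ℝ)).finrank_eq,
      Subspace.dual_finrank_eq]
  refine ⟨(LinearEquiv.ofInjectiveOfFinrankEq g.toLinearMap hinj hfin).toContinuousLinearEquiv, ?_⟩
  ext a b
  rfl

namespace IsMetricOn

theorem mono (h : IsMetricOn G U) {V : Set E} (hV : IsOpen V) (hVU : V ⊆ U) : IsMetricOn G V :=
  ⟨hV, h.smooth.mono hVU, fun y hy => h.symm y (hVU hy), fun y hy => h.inv y (hVU hy)⟩

theorem apply_inverse (h : IsMetricOn G U) {y : E} (hy : y ∈ U) (ν : E →L[ℝ] ℝ) :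
    G y ((G y).inverse ν) = ν := by
  obtain ⟨e, he⟩ := h.inv y hy
  rw [← he, ContinuousLinearMap.inverse_equiv]
  simp

theorem eq_of_forall (h : IsMetricOn G U) {y : E} (hy : y ∈ U) {a b : E}
    (hab : ∀ c, G y a c = G y b c) : a = b := by
  obtain ⟨e, he⟩ := h.inv y hy
  apply e.injective
  ext c
  have := hab c
  rw [← he] at this
  exact this

theorem fderiv_symm (h : IsMetricOn G U) {y : E} (hy : y ∈ U) (a b c : E) :
    fderiv ℝ G y a b c = fderiv ℝ G y a c b := by
  have hd := differentiableAt_of_contDiffOn h.isOpen h.smooth hy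
  rw [← fderiv_apply₂ hd, ← fderiv_apply₂ hd,
    fderiv_eq_of_eqOn h.isOpen (fun z hz => h.symm z hz b c) hy]

theorem two_mul_christoffelL (h : IsMetricOn G U) {y : E} (hy : y ∈ U) (a b c : E) :
    2 * G y (christoffelL G y a b) c
      = fderiv ℝ G y a b c + fderiv ℝ G y b a c - fderiv ℝ G y c a b := by
  rw [christoffelL_apply, christoffel, h.apply_inverse hy]
  simp [christoffelFirst]

theorem christoffelL_comm (h : IsMetricOn G U) {y : E} (hy : y ∈ U) (a b : E) :
    christoffelL G y a b = christoffelL G y b a := by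
  apply h.eq_of_forall hy
  intro c
  have h1 := h.two_mul_christoffelL hy a b c
  have h2 := h.two_mul_christoffelL hy b a c
  have h3 := h.fderiv_symm hy c a b
  linarith

theorem fderiv_metric (h : IsMetricOn G U) {y : E} (hy : y ∈ U) (a b c : E) :
    fderiv ℝ G y a b c = G y (christoffelL G y a b) c + G y b (christoffelL G y a c) := by
  have h1 := h.two_mul_christoffelL hy a b c
  have h2 := h.two_mul_christoffelL hy a c b
  rw [h.symm y hy b]
  have h3 := h.fderiv_symm hy a b c
  have h4 := h.fderiv_symm hy b a c
  have h5 := h.fderiv_symm hy c a b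
  linarith

theorem covBilin_metric (h : IsMetricOn G U) {y : E} (hy : y ∈ U) (a b c : E) :
    covBilin (christoffelL G) G y a b c = 0 := by
  rw [covBilin, h.fderiv_metric hy]
  ring

theorem contDiffOn_inverse [FiniteDimensional ℝ E] (h : IsMetricOn G U) :
    ContDiffOn ℝ ∞ (fun y => (G y).inverse) U := by
  intro y hy
  obtain ⟨e, he⟩ := h.inv y hy
  have : ContDiffAt ℝ ∞ ContinuousLinearMap.inverse (G y) := by
    rw [← he]
    exact contDiffAt_map_inverse e
  exact this.comp_contDiffWithinAt y (h.smooth y hy)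

theorem contDiffOn_christoffelL [FiniteDimensional ℝ E] (h : IsMetricOn G U) :
    ContDiffOn ℝ ∞ (christoffelL G) U := by
  have hd := contDiffOn_fderiv h.isOpen h.smooth
  have hflip : ContDiffOn ℝ ∞ (fun y => (fderiv ℝ G y).flip) U :=
    (ContinuousLinearMap.flipₗᵢ ℝ E E (E →L[ℝ] ℝ)).contDiff.comp_contDiffOn hd
  have hfirst : ContDiffOn ℝ ∞ (christoffelFirstL G) U :=
    ContDiffOn.smul (f := fun _ => (1 / 2 : ℝ)) contDiffOn_const ((hd.add hflip).sub
      (ContDiffOn.clm_comp (g := fun _ => flipL E) contDiffOn_const hflip))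
  exact (ContDiffOn.clm_comp
    (g := fun y => ContinuousLinearMap.compL ℝ E (E →L[ℝ] ℝ) E (G y).inverse)
    ((contDiff_const (c := ContinuousLinearMap.compL ℝ E (E →L[ℝ] ℝ) E)).contDiffOn.clm_apply
      h.contDiffOn_inverse) hfirst)

theorem connCurv_christoffelL [FiniteDimensional ℝ E] (h : IsMetricOn G U) {y : E} (hy : y ∈ U)
    (a b c : E) : connCurv (christoffelL G) y a b c = curvOp G y a b c := by
  have hd := differentiableAt_of_contDiffOn h.isOpen h.contDiffOn_christoffelL hy
  simp only [connCurv, curvOp, ← christoffelL_apply, fderiv_apply₂ hd]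

end IsMetricOn

/-- A `(0, 3)`-tensor that is skew in its first two arguments vanishes if it has the algebraic
property of the Cotton tensor of a metric whose curvature is a Kulkarni-Nomizu product with the
metric. -/
theorem cotton_eq_zero [FiniteDimensional ℝ E] (hdim : 4 ≤ Module.finrank ℝ E)
    (g : E →L[ℝ] E →L[ℝ] ℝ) (hg : ∀ a, (∀ b, g a b = 0) → a = 0) (hsymm : ∀ a b, g a b = g b a)
    (C : E →ₗ[ℝ] E →ₗ[ℝ] E →ₗ[ℝ] ℝ) (hC : ∀ a b c, C a b c = -C b a c)
    (h : ∀ e a b c d, (g b c * C e a d - g b d * C e a c) + (g e c * C a b d - g e d * C a b c)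
      + (g a c * C b e d - g a d * C b e c) = 0) (e a c : E) : C e a c = 0 := by
  classical
  let β := Module.finBasis ℝ E
  let gB : LinearMap.BilinForm ℝ E := LinearMap.mk₂ ℝ (fun a b => g a b) (by simp) (by simp)
    (by simp) (by simp)
  have hnd : gB.Nondegenerate := by
    refine ⟨fun a ha => hg a ha, fun a ha => hg a fun b => ?_⟩
    rw [hsymm]
    exact ha b
  let β' := gB.dualBasis hnd β
  have hdual : ∀ i j, g (β' i) (β j) = if j = i then 1 else 0 := fun i j =>
    LinearMap.BilinForm.apply_dualBasis_left hnd β i j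
  have hrepr : ∀ c i, β.repr c i = g (β' i) c := by
    intro c i
    conv_rhs => rw [← β.sum_repr c]
    simp only [map_sum, map_smul]
    simp [hdual]
  have hrepr' : ∀ c i, β'.repr c i = g (β i) c := by
    intro c i
    conv_rhs => rw [← β'.sum_repr c]
    simp only [map_sum, map_smul]
    simp [hsymm (β i), hdual]
  have hsum : ∀ (F : E →ₗ[ℝ] ℝ) c, ∑ i, g (β i) c * F (β' i) = F c := by
    intro F c
    conv_rhs => rw [← β'.sum_repr c]
    simp [hrepr']
  have hsum' : ∀ (F : E →ₗ[ℝ] ℝ) c, ∑ i, g (β' i) c * F (β i) = F c := by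
    intro F c
    conv_rhs => rw [← β.sum_repr c]
    simp [hrepr]
  have htr : ∑ i, g (β i) (β' i) = (Module.finrank ℝ E : ℝ) := by
    simp [hsymm (β _) (β' _), hdual]
  set m : ℝ := (Module.finrank ℝ E : ℝ) with hm
  have hm4 : (4 : ℝ) ≤ m := by rw [hm]; exact_mod_cast hdim
  let t : E → ℝ := fun a => ∑ i, C a (β i) (β' i)
  -- Contraction of b with d over a pair of dual bases, so that no orthonormal basis of the
  -- indefinite form is needed.
  have h1 : ∀ e a c, (3 - m) * C e a c + g e c * t a - g a c * t e = 0 := by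
    intro e a c
    have hh : ∑ i, ((g (β i) c * C e a (β' i) - g (β i) (β' i) * C e a c)
      + (g e c * C a (β i) (β' i) - g (β' i) e * C a (β i) c)
      + (-(g a c * C e (β i) (β' i)) + g (β' i) a * C e (β i) c)) = 0 := by
      refine Finset.sum_eq_zero fun i _ => ?_
      rw [← h e a (β i) c (β' i), hsymm (β' i) e, hsymm (β' i) a, hC (β i) e, hC (β i) e]
      ring
    rw [Finset.sum_add_distrib, Finset.sum_add_distrib, Finset.sum_sub_distrib,
      Finset.sum_sub_distrib, Finset.sum_add_distrib, Finset.sum_neg_distrib, ← Finset.mul_sum,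
      ← Finset.mul_sum, ← Finset.sum_mul, htr, hsum (C e a) c] at hh
    have e1 := hsum' ((C a).flip c) e
    have e2 := hsum' ((C e).flip c) a
    simp only [LinearMap.flip_apply] at e1 e2
    rw [e1, e2, hC a e c] at hh
    change _ - _ + (_ * t a - _) + (-(_ * t e) + _) = 0 at hh
    linarith
  -- A second contraction, of a with c, leaves (4 - 2m) t = 0. The factors 4 - 2m here and 3 - m
  -- below are where m ≥ 4 enters.
  have ht : ∀ e, t e = 0 := by
    intro e
    have hh : ∑ i, ((3 - m) * C e (β i) (β' i) + g (β' i) e * t (β i)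
        - g (β i) (β' i) * t e) = 0 := by
      refine Finset.sum_eq_zero fun i _ => ?_
      rw [← h1 e (β i) (β' i), hsymm (β' i) e]
    have e1 : ∑ i, g (β' i) e * t (β i) = t e := by
      have := hsum' (∑ i, (C.flip (β i)).flip (β' i)) e
      simpa [t] using this
    rw [Finset.sum_sub_distrib, Finset.sum_add_distrib, ← Finset.mul_sum, e1, ← Finset.sum_mul,
      htr] at hh
    change (3 - m) * t e + t e - m * t e = 0 at hh
    have : (4 - 2 * m) * t e = 0 := by linarith
    rcases mul_eq_zero.1 this with h' | h'
    · linarith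
    · exact h'
  have := h1 e a c
  rw [ht, ht] at this
  have h' : (3 - m) * C e a c = 0 := by linarith
  rcases mul_eq_zero.1 h' with h'' | h''
  · linarith
  · exact h''

/-- If the curvature tensor is the Kulkarni-Nomizu product of the metric with `B` and the dimension
is at least four, then `B` is a Codazzi tensor. -/
theorem IsMetricOn.codazzi [FiniteDimensional ℝ E] (h : IsMetricOn G U)
    (hdim : 4 ≤ Module.finrank ℝ E) {B : E → E →L[ℝ] E →L[ℝ] ℝ} (hB : ContDiffOn ℝ ∞ B U)
    (hR : ∀ y ∈ U, ∀ a b c d, curv G y a b c d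
      = kulkarniNomizu (fun a b => G y a b) (fun a b => B y a b) a b c d)
    {y : E} (hy : y ∈ U) (a b c : E) :
    covBilin (christoffelL G) B y a b c = covBilin (christoffelL G) B y b a c := by
  have hU := h.isOpen
  have hΓ := h.contDiffOn_christoffelL
  have dG := differentiableAt_of_contDiffOn hU h.smooth hy
  have dB := differentiableAt_of_contDiffOn hU hB hy
  have dΓ := differentiableAt_of_contDiffOn hU hΓ hy
  have dΓ' := differentiableAt_of_contDiffOn hU (contDiffOn_fderiv hU hΓ) hy
  set Γ := christoffelL G with hΓdef
  have dR : ∀ a b c, DifferentiableAt ℝ (fun z => connCurv Γ z a b c) y := by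
    intro a b c
    have d1 : ∀ a b c : E, DifferentiableAt ℝ (fun z => fderiv ℝ Γ z a b c) y := fun a b c =>
      ((dΓ'.clm_apply (differentiableAt_const a)).clm_apply (differentiableAt_const b)).clm_apply
        (differentiableAt_const c)
    have d2 : ∀ a b c : E, DifferentiableAt ℝ (fun z => Γ z a (Γ z b c)) y := fun a b c =>
      (dΓ.clm_apply (differentiableAt_const a)).clm_apply
        ((dΓ.clm_apply (differentiableAt_const b)).clm_apply (differentiableAt_const c))
    exact ((d1 _ _ _).fun_add (d2 _ _ _)).fun_sub ((d1 _ _ _).fun_add (d2 _ _ _))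
  have hRz : ∀ z ∈ U, ∀ a b c d, G z (connCurv Γ z a b c) d
      = G z b c * B z a d - G z a c * B z b d + B z b c * G z a d - B z a c * G z b d := by
    intro z hz a b c d
    rw [h.connCurv_christoffelL hz]
    exact hR z hz a b c d
  have hder : ∀ e a b c d, fderiv ℝ G y e (connCurv Γ y a b c) d
      + G y (fderiv ℝ (fun z => connCurv Γ z a b c) y e) d
      = (fderiv ℝ G y e b c * B y a d + G y b c * fderiv ℝ B y e a d)
        - (fderiv ℝ G y e a c * B y b d + G y a c * fderiv ℝ B y e b d)
        + (fderiv ℝ B y e b c * G y a d + B y b c * fderiv ℝ G y e a d)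
        - (fderiv ℝ B y e a c * G y b d + B y a c * fderiv ℝ G y e b d) := by
    intro e a b c d
    have hG2 : ∀ b c, DifferentiableAt ℝ (fun z => G z b c) y := fun b c =>
      (dG.clm_apply (differentiableAt_const b)).clm_apply (differentiableAt_const c)
    have hB2 : ∀ b c, DifferentiableAt ℝ (fun z => B z b c) y := fun b c =>
      (dB.clm_apply (differentiableAt_const b)).clm_apply (differentiableAt_const c)
    have hl : fderiv ℝ (fun z => G z (connCurv Γ z a b c) d) y e
        = fderiv ℝ G y e (connCurv Γ y a b c) d
          + G y (fderiv ℝ (fun z => connCurv Γ z a b c) y e) d := by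
      rw [fderiv_clm_apply (dG.clm_apply (dR a b c)) (differentiableAt_const d),
        fderiv_clm_apply dG (dR a b c)]
      simp [add_comm]
    rw [← hl, fderiv_eq_of_eqOn hU (fun z hz => hRz z hz a b c d) hy,
      fderiv_fun_sub ((((hG2 _ _).fun_mul (hB2 _ _)).fun_sub ((hG2 _ _).fun_mul (hB2 _ _))).fun_add
        ((hB2 _ _).fun_mul (hG2 _ _))) ((hB2 _ _).fun_mul (hG2 _ _)),
      fderiv_fun_add (((hG2 _ _).fun_mul (hB2 _ _)).fun_sub ((hG2 _ _).fun_mul (hB2 _ _)))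
        ((hB2 _ _).fun_mul (hG2 _ _)),
      fderiv_fun_sub ((hG2 _ _).fun_mul (hB2 _ _)) ((hG2 _ _).fun_mul (hB2 _ _)),
      fderiv_fun_mul (hG2 _ _) (hB2 _ _), fderiv_fun_mul (hG2 _ _) (hB2 _ _),
      fderiv_fun_mul (hB2 _ _) (hG2 _ _), fderiv_fun_mul (hB2 _ _) (hG2 _ _)]
    simp [fderiv_apply₂ dG, fderiv_apply₂ dB]
    ring
  -- As in `bianchi_identity`, the derivative is corrected only in the value and in the slot c. The
  -- corrections in the slots a and b stay on the right and cancel in the cyclic sum.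
  have hcov : ∀ e a b c d, G y (fderiv ℝ (fun z => connCurv Γ z a b c) y e
        + Γ y e (connCurv Γ y a b c) - connCurv Γ y a b (Γ y e c)) d
      = (G y b c * covBilin Γ B y e a d - G y a c * covBilin Γ B y e b d
        + covBilin Γ B y e b c * G y a d - covBilin Γ B y e a c * G y b d)
        + G y (connCurv Γ y (Γ y e a) b c) d + G y (connCurv Γ y a (Γ y e b) c) d := by
    intro e a b c d
    have h1 := hder e a b c d
    simp only [h.fderiv_metric hy, ← hΓdef] at h1
    simp only [map_sub, map_add, sub_apply, add_apply]
    rw [hRz y hy a b c] at h1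
    rw [hRz y hy a b (Γ y e c), hRz y hy (Γ y e a), hRz y hy a (Γ y e b)]
    simp only [covBilin]
    linear_combination h1
  let CB : E →ₗ[ℝ] E →ₗ[ℝ] E →ₗ[ℝ] ℝ :=
    LinearMap.mk₂ ℝ (fun e a => (LinearMap.mk₂ ℝ
      (fun a c => covBilin Γ B y e a c - covBilin Γ B y a e c)
      (fun a a' c => by simp [covBilin]; ring) (fun s a c => by simp [covBilin]; ring)
      (fun a c c' => by simp [covBilin]; ring) (fun s a c => by simp [covBilin]; ring)) a)
      (fun e e' a => by ext c; simp [covBilin]; ring) (fun s e a => by ext c; simp [covBilin]; ring)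
      (fun e a a' => by simp) (fun s e a => by simp)
  have hCB : ∀ e a c, CB e a c = covBilin Γ B y e a c - covBilin Γ B y a e c := fun _ _ _ => rfl
  -- The Bianchi identity is the algebraic hypothesis of `cotton_eq_zero` for the skew part of ∇B;
  -- the leftover Γ terms pair off because R is skew in its first two slots and Γ is symmetric.
  have hz := cotton_eq_zero hdim (G y)
    (fun a ha => h.eq_of_forall hy (fun c => by simpa using ha c)) (h.symm y hy) CB
    (fun a b c => by rw [hCB, hCB]; ring)
    (fun e a b c d => by
      have hb := congrArg (fun v => G y v d) (bianchi_identity hU hΓ hy a b e c)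
      simp only [map_add, add_apply, map_zero, zero_apply] at hb
      rw [hcov e a b c d, hcov a b e c d, hcov b e a c d] at hb
      have hskew : ∀ a b c, connCurv Γ y a b c = -connCurv Γ y b a c := by
        intro a b c
        simp only [connCurv]
        abel
      rw [hskew a (Γ y e b), hskew b (Γ y a e), hskew e (Γ y b a), h.christoffelL_comm hy b e,
        h.christoffelL_comm hy a e, h.christoffelL_comm hy b a] at hb
      simp only [hCB]
      simp only [map_neg, neg_apply] at hb
      linear_combination hb) a b c
  rw [hCB] at hz
  linarith

end Metric

end AccR

namespace AccR

/-! ### First-order geometry of a vertical soliton: ∇η, and the Ricci identity for η. -/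

section Soliton

variable {E : Type*} [NormedAddCommGroup E] [NormedSpace ℝ E]

/-- The derivative of the function `u` along the vector field `ξ`. -/
noncomputable def dir (ξ : E → E) (u : E → ℝ) (y : E) : ℝ := fderiv ℝ u y (ξ y)

theorem contDiffOn_dir {U : Set E} (hU : IsOpen U) {ξ : E → E} (hξ : ContDiffOn ℝ ∞ ξ U)
    {u : E → ℝ} (hu : ContDiffOn ℝ ∞ u U) : ContDiffOn ℝ ∞ (dir ξ u) U :=
  (contDiffOn_fderiv hU hu).clm_apply hξ

/-- A metric `G` with a vector field `ξ` and a closed `1`-form `η = e^{-2w} G(ξ, ·)` such that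
`L_ξ G` is a combination of `G` and `η ⊗ η`, for which `f ξ` is the potential of an almost Riemann
soliton. -/
structure VerticalSoliton (G : E → E →L[ℝ] E →L[ℝ] ℝ) (ξ : E → E) (η : E → E →L[ℝ] ℝ)
    (w p f σ : E → ℝ) (U : Set E) : Prop extends IsMetricOn G U where
  smooth_ξ : ContDiffOn ℝ ∞ ξ U
  smooth_η : ContDiffOn ℝ ∞ η U
  smooth_w : ContDiffOn ℝ ∞ w U
  smooth_p : ContDiffOn ℝ ∞ p U
  smooth_f : ContDiffOn ℝ ∞ f U
  smooth_σ : ContDiffOn ℝ ∞ σ U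
  metric_ξ : ∀ y ∈ U, ∀ a, G y (ξ y) a = Real.exp (2 * w y) * η y a
  η_ξ : ∀ y ∈ U, η y (ξ y) = 1
  closed_η : ∀ y ∈ U, ∀ a b, fderiv ℝ η y a b = fderiv ℝ η y b a
  lie_ξ : ∀ y ∈ U, ∀ a b, lieDeriv ξ G y a b = 2 * p y * G y a b
    + 2 * (dir ξ w y - p y) * Real.exp (2 * w y) * (η y a * η y b)
  curv_eq : ∀ y ∈ U, ∀ a b c d, curv G y a b c d = kulkarniNomizu (fun a b => G y a b)
    (fun a b => -(1 / 2) * (σ y + 2 * p y * f y) * G y a b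
      - (1 / 2) * Real.exp (2 * w y) * (fderiv ℝ f y a * η y b + η y a * fderiv ℝ f y b
        + 2 * f y * (dir ξ w y - p y) * (η y a * η y b))) a b c d

namespace VerticalSoliton

variable {G : E → E →L[ℝ] E →L[ℝ] ℝ} {ξ : E → E} {η : E → E →L[ℝ] ℝ}
  {w p f σ : E → ℝ} {U : Set E}

theorem restrict (h : VerticalSoliton G ξ η w p f σ U) {V : Set E} (hV : IsOpen V) (hVU : V ⊆ U) :
    VerticalSoliton G ξ η w p f σ V where
  toIsMetricOn := h.toIsMetricOn.mono hV hVU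
  smooth_ξ := h.smooth_ξ.mono hVU
  smooth_η := h.smooth_η.mono hVU
  smooth_w := h.smooth_w.mono hVU
  smooth_p := h.smooth_p.mono hVU
  smooth_f := h.smooth_f.mono hVU
  smooth_σ := h.smooth_σ.mono hVU
  metric_ξ := fun y hy => h.metric_ξ y (hVU hy)
  η_ξ := fun y hy => h.η_ξ y (hVU hy)
  closed_η := fun y hy => h.closed_η y (hVU hy)
  lie_ξ := fun y hy => h.lie_ξ y (hVU hy)
  curv_eq := fun y hy => h.curv_eq y (hVU hy)

variable (h : VerticalSoliton G ξ η w p f σ U) {y : E} (hy : y ∈ U)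
include h

theorem diffAt {F : Type*} [NormedAddCommGroup F] [NormedSpace ℝ F] {s : E → F}
    (hs : ContDiffOn ℝ ∞ s U) {y : E} (hy : y ∈ U) : DifferentiableAt ℝ s y :=
  differentiableAt_of_contDiffOn h.isOpen hs hy

theorem smooth_fderiv {F : Type*} [NormedAddCommGroup F] [NormedSpace ℝ F] {s : E → F}
    (hs : ContDiffOn ℝ ∞ s U) : ContDiffOn ℝ ∞ (fderiv ℝ s) U := contDiffOn_fderiv h.isOpen hs

theorem smooth_dir {s : E → ℝ} (hs : ContDiffOn ℝ ∞ s U) : ContDiffOn ℝ ∞ (dir ξ s) U :=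
  contDiffOn_dir h.isOpen h.smooth_ξ hs

theorem smooth_l : ContDiffOn ℝ ∞ (fun y => dir ξ w y - p y) U :=
  (h.smooth_dir h.smooth_w).sub h.smooth_p

theorem smooth_P : ContDiffOn ℝ ∞ (fun y => Real.exp (-(2 * w y)) * p y) U :=
  ((contDiffOn_const.mul h.smooth_w).neg.exp).mul h.smooth_p

include hy

theorem metric_of_horizontal {x : E} (hx : η y x = 0) : G y (ξ y) x = 0 := by
  rw [h.metric_ξ y hy, hx, mul_zero]

theorem metric_of_horizontal' {x : E} (hx : η y x = 0) : G y x (ξ y) = 0 := by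
  rw [h.symm y hy, h.metric_of_horizontal hy hx]

theorem hess_comm {u : E → ℝ} (hu : ContDiffOn ℝ ∞ u U) (a b : E) :
    covForm (christoffelL G) (fderiv ℝ u) y a b = covForm (christoffelL G) (fderiv ℝ u) y b a := by
  rw [covForm_apply, covForm_apply, fderiv_fderiv_comm h.isOpen hu hy, h.christoffelL_comm hy]

theorem fderiv_metric_ξ (a b : E) :
    fderiv ℝ G y a (ξ y) b + G y (fderiv ℝ ξ y a) b
      = Real.exp (2 * w y) * (2 * fderiv ℝ w y a * η y b + fderiv ℝ η y a b) := by
  have dG := h.diffAt h.smooth hy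
  have dξ := h.diffAt h.smooth_ξ hy
  have dη := h.diffAt h.smooth_η hy
  have dw := h.diffAt h.smooth_w hy
  have hl : fderiv ℝ (fun z => G z (ξ z) b) y a
      = fderiv ℝ G y a (ξ y) b + G y (fderiv ℝ ξ y a) b := by
    rw [fderiv_clm_apply (dG.clm_apply dξ) (differentiableAt_const b), fderiv_clm_apply dG dξ]
    simp [add_comm]
  rw [← hl, fderiv_eq_of_eqOn h.isOpen (fun z hz => h.metric_ξ z hz b) hy,
    fderiv_fun_mul ((dw.const_mul 2).exp) (dη.clm_apply (differentiableAt_const b)),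
    fderiv_exp (dw.const_mul 2), fderiv_const_mul dw]
  simp [fderiv_apply₁ dη]
  ring

/-- Since η is closed, ∇η is symmetric, hence half the Lie derivative of G along ξ up to the terms
from the factor e^{2w} in G(ξ, ·) = e^{2w}η. On H it is a multiple of G: the leaves of H are totally
umbilic. -/
theorem covForm_η_apply (a b : E) :
    covForm (christoffelL G) η y a b = Real.exp (-(2 * w y)) * p y * G y a b
      + (dir ξ w y - p y) * (η y a * η y b)
      - (fderiv ℝ w y a * η y b + η y a * fderiv ℝ w y b) := by
  have h1 := h.two_mul_christoffelL hy a b (ξ y)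
  have h2 := h.fderiv_metric_ξ hy a b
  have h3 := h.fderiv_metric_ξ hy b a
  have h4 := h.lie_ξ y hy a b
  have h5 := h.fderiv_symm hy a (ξ y) b
  have h6 := h.fderiv_symm hy b (ξ y) a
  have h7 := h.metric_ξ y hy (christoffelL G y a b)
  have h8 := h.closed_η y hy a b
  have h9 := h.symm y hy (fderiv ℝ ξ y b) a
  rw [lieDeriv] at h4
  rw [h.symm y hy, h7] at h1
  have he : Real.exp (-(2 * w y)) * Real.exp (2 * w y) = 1 := by
    rw [← Real.exp_add]; simp
  rw [covForm_apply]
  linear_combination (-(1 / 2) * Real.exp (-(2 * w y))) * (h1 - h5 - h6 + h2 + h3 - h4 - h9)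
    + (η y (christoffelL G y a b) - (fderiv ℝ w y a * η y b + fderiv ℝ w y b * η y a
      + 1 / 2 * (fderiv ℝ η y a b + fderiv ℝ η y b a)
      - (dir ξ w y - p y) * (η y a * η y b))) * he + 1 / 2 * h8

theorem covForm_η :
    covForm (christoffelL G) η y = (Real.exp (-(2 * w y)) * p y) • G y
      + (dir ξ w y - p y) • tmul (η y) (η y)
      - (tmul (fderiv ℝ w y) (η y) + tmul (η y) (fderiv ℝ w y)) := by
  ext a b
  rw [h.covForm_η_apply hy]
  simp

theorem covBilin_covForm_η (a b c : E) :
    covBilin (christoffelL G) (covForm (christoffelL G) η) y a b c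
      = fderiv ℝ (fun y => Real.exp (-(2 * w y)) * p y) y a * G y b c
        + fderiv ℝ (fun y => dir ξ w y - p y) y a * (η y b * η y c)
        + (dir ξ w y - p y) * (covForm (christoffelL G) η y a b * η y c
          + η y b * covForm (christoffelL G) η y a c)
        - (covForm (christoffelL G) (fderiv ℝ w) y a b * η y c
          + fderiv ℝ w y b * covForm (christoffelL G) η y a c
          + covForm (christoffelL G) η y a b * fderiv ℝ w y c
          + η y b * covForm (christoffelL G) (fderiv ℝ w) y a c) := by
  have dη := h.diffAt h.smooth_η hy
  have dw := h.diffAt (h.smooth_fderiv h.smooth_w) hy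
  have dηη := h.diffAt (contDiffOn_tmul h.smooth_η h.smooth_η) hy
  have dwη := h.diffAt (contDiffOn_tmul (h.smooth_fderiv h.smooth_w) h.smooth_η) hy
  have dηw := h.diffAt (contDiffOn_tmul h.smooth_η (h.smooth_fderiv h.smooth_w)) hy
  have dP := h.diffAt h.smooth_P hy
  have dl := h.diffAt h.smooth_l hy
  have dG := h.diffAt h.smooth hy
  rw [covBilin_congr h.isOpen (fun z hz => h.covForm_η hz) hy,
    covBilin_sub ((dP.fun_smul dG).fun_add (dl.fun_smul dηη)) (dwη.fun_add dηw),
    covBilin_add (dP.fun_smul dG) (dl.fun_smul dηη), covBilin_add dwη dηw, covBilin_smul dP dG,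
    covBilin_smul dl dηη, covBilin_tmul dη dη, covBilin_tmul dw dη, covBilin_tmul dη dw,
    h.covBilin_metric hy, tmul_apply]
  ring

/-- Raising the index in `covForm_η_apply`: p is the umbilicity factor of the leaves. -/
theorem covDeriv_ξ {x : E} (hx : η y x = 0) :
    fderiv ℝ ξ y x + christoffelL G y x (ξ y) = p y • x + fderiv ℝ w y x • ξ y := by
  apply h.eq_of_forall hy
  intro c
  have h1 := h.fderiv_metric_ξ hy x c
  have h2 := h.covForm_η_apply hy x c
  have h3 := h.fderiv_metric hy x (ξ y) c
  have h4 := h.metric_ξ y hy c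
  have h5 := h.metric_ξ y hy (christoffelL G y x c)
  have he : Real.exp (-(2 * w y)) * Real.exp (2 * w y) = 1 := by
    rw [← Real.exp_add]; simp
  rw [covForm_apply, hx] at h2
  simp only [map_add, map_smul, add_apply, smul_apply, smul_eq_mul]
  linear_combination h1 - h3 - h5 + Real.exp (2 * w y) * h2 + p y * G y x c * he
    - fderiv ℝ w y x * h4

theorem fderiv_dir {u : E → ℝ} (hu : ContDiffOn ℝ ∞ u U) {x : E} (hx : η y x = 0) :
    fderiv ℝ (dir ξ u) y x = covForm (christoffelL G) (fderiv ℝ u) y x (ξ y)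
      + p y * fderiv ℝ u y x + fderiv ℝ w y x * dir ξ u y := by
  have h1 := congrArg (fderiv ℝ u y) (h.covDeriv_ξ hy hx)
  have hd : fderiv ℝ (dir ξ u) y x
      = fderiv ℝ (fderiv ℝ u) y x (ξ y) + fderiv ℝ u y (fderiv ℝ ξ y x) := by
    unfold dir
    rw [fderiv_clm_apply (h.diffAt (h.smooth_fderiv hu) hy) (h.diffAt h.smooth_ξ hy)]
    simp [add_comm]
  simp only [map_add, map_smul, smul_eq_mul] at h1
  rw [hd, covForm_apply, dir]
  linear_combination h1

/-- A form that kills H is ν(ξ)η, so its derivative is governed by ∇η, which is a multiple of G on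
H. This is how relations between horizontal differentials get differentiated later. -/
theorem covForm_of_horizontal {ν : E → E →L[ℝ] ℝ} (hν : ContDiffOn ℝ ∞ ν U)
    (h0 : ∀ y ∈ U, ∀ x, η y x = 0 → ν y x = 0) (a b : E) :
    covForm (christoffelL G) ν y a b = fderiv ℝ (fun z => ν z (ξ z)) y a * η y b
      + ν y (ξ y) * covForm (christoffelL G) η y a b := by
  have hc : ContDiffOn ℝ ∞ (fun z => ν z (ξ z)) U := hν.clm_apply h.smooth_ξ
  have heq : ∀ z ∈ U, ν z = ν z (ξ z) • η z := by
    intro z hz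
    ext a
    have := h0 z hz (a - η z a • ξ z) (by simp [h.η_ξ z hz])
    rw [map_sub, map_smul, sub_eq_zero] at this
    rw [this]
    simp [mul_comm]
  rw [covForm_congr h.isOpen heq hy, covForm_smul (h.diffAt hc hy) (h.diffAt h.smooth_η hy)]

theorem covForm_of_horizontal_apply {ν : E → E →L[ℝ] ℝ} (hν : ContDiffOn ℝ ∞ ν U)
    (h0 : ∀ y ∈ U, ∀ x, η y x = 0 → ν y x = 0) {x z : E} (hx : η y x = 0) (hz : η y z = 0) :
    covForm (christoffelL G) ν y x z
      = ν y (ξ y) * (Real.exp (-(2 * w y)) * p y) * G y x z := by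
  rw [h.covForm_of_horizontal hy hν h0, h.covForm_η_apply hy, hx, hz]
  ring

/-- As ∇η is symmetric, only d(ν(ξ)) ⊗ η contributes to the skew part. -/
theorem covForm_of_horizontal_skew {ν : E → E →L[ℝ] ℝ} (hν : ContDiffOn ℝ ∞ ν U)
    (h0 : ∀ y ∈ U, ∀ x, η y x = 0 → ν y x = 0) {x : E} (hx : η y x = 0) :
    covForm (christoffelL G) ν y (ξ y) x - covForm (christoffelL G) ν y x (ξ y)
      = -fderiv ℝ (fun z => ν z (ξ z)) y x := by
  rw [h.covForm_of_horizontal hy hν h0, h.covForm_of_horizontal hy hν h0, h.covForm_η_apply hy,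
    h.covForm_η_apply hy, hx, h.η_ξ y hy, h.symm y hy x]
  ring

/-- Here du = (ξu)η, and d(du) = 0 with dη = 0 gives d(ξu) ∧ η = 0. -/
theorem fderiv_dir_eq_zero {u : E → ℝ} (hu : ContDiffOn ℝ ∞ u U)
    (h0 : ∀ y ∈ U, ∀ x, η y x = 0 → fderiv ℝ u y x = 0) {x : E} (hx : η y x = 0) :
    fderiv ℝ (dir ξ u) y x = 0 := by
  have := h.covForm_of_horizontal_skew hy (h.smooth_fderiv hu) h0 hx
  rw [h.hess_comm hy hu, sub_self] at this
  change 0 = -fderiv ℝ (dir ξ u) y x at this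
  linarith

section Dimension

variable [FiniteDimensional ℝ E] (hdim : 5 ≤ Module.finrank ℝ E)

omit h hy in
theorem exists_ne_zero_of_ker (hdim : 3 ≤ Module.finrank ℝ E) (ν μ : E →L[ℝ] ℝ) :
    ∃ z : E, z ≠ 0 ∧ ν z = 0 ∧ μ z = 0 := by
  have hk : LinearMap.ker (ν.toLinearMap.prod μ.toLinearMap) ≠ ⊥ := by
    apply LinearMap.ker_ne_bot_of_finrank_lt
    simp
    omega
  obtain ⟨z, hz, hz0⟩ := Submodule.exists_mem_ne_zero_of_ne_bot hk
  rw [LinearMap.mem_ker, LinearMap.prod_apply, Prod.mk_eq_zero] at hz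
  exact ⟨z, hz0, hz.1, hz.2⟩

omit [FiniteDimensional ℝ E] in
theorem exists_horizontal_ne_zero {z : E} (hz0 : z ≠ 0) (hz : η y z = 0) :
    ∃ x, η y x = 0 ∧ G y x z = 1 := by
  by_contra! hcon
  apply hz0
  apply h.eq_of_forall hy
  intro c
  by_contra hc
  simp only [map_zero, zero_apply] at hc
  have hG : G y (c - η y c • ξ y) z = G y z c := by
    simp [h.metric_of_horizontal hy hz, h.symm y hy c z]
  apply hcon ((G y z c)⁻¹ • (c - η y c • ξ y)) (by simp [h.η_ξ y hy])
  rw [map_smul, smul_apply, hG, smul_eq_mul, inv_mul_cancel₀ hc]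

include hdim

/-- A product of two covectors has rank at most one, while G is nondegenerate on H of dimension at
least two; testing on a nonzero horizontal vector in ker B gives κ = 0. -/
theorem mul_eq_zero_of_horizontal {A B : E →L[ℝ] ℝ} {κ : ℝ}
    (hAB : ∀ x z, η y x = 0 → η y z = 0 → A x * B z = κ * G y x z) {x z : E} (hx : η y x = 0)
    (hz : η y z = 0) : A x * B z = 0 := by
  obtain ⟨z', hz0, hz', hB⟩ := exists_ne_zero_of_ker (by omega) (η y) B
  obtain ⟨x', hx', hG⟩ := h.exists_horizontal_ne_zero hy hz0 hz'
  have := hAB x' z' hx' hz'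
  rw [hB, hG] at this
  rw [hAB x z hx hz, show κ = 0 by linarith, zero_mul]

/-- Polarization: if all horizontal vectors were null, G would vanish on H. -/
theorem exists_horizontal_nonnull : ∃ x, η y x = 0 ∧ G y x x ≠ 0 := by
  obtain ⟨z, hz0, hz, -⟩ := exists_ne_zero_of_ker (by omega) (η y) (η y)
  obtain ⟨x, hx, hG⟩ := h.exists_horizontal_ne_zero hy hz0 hz
  by_contra! hcon
  have h1 := hcon (x + z) (by simp [hx, hz])
  simp only [map_add, add_apply, hcon x hx, hcon z hz, hG, h.symm y hy z x] at h1
  norm_num at h1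

omit hdim in
theorem metric_connCurv (a b c d : E) :
    G y (connCurv (christoffelL G) y a b c) d = kulkarniNomizu (fun a b => G y a b)
    (fun a b => -(1 / 2) * (σ y + 2 * p y * f y) * G y a b
      - (1 / 2) * Real.exp (2 * w y) * (fderiv ℝ f y a * η y b + η y a * fderiv ℝ f y b
        + 2 * f y * (dir ξ w y - p y) * (η y a * η y b))) a b c d := by
  rw [h.connCurv_christoffelL hy]
  exact h.curv_eq y hy a b c d

omit hdim in
theorem η_connCurv (a b c : E) :
    η y (connCurv (christoffelL G) y a b c) = Real.exp (-(2 * w y)) *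
      kulkarniNomizu (fun a b => G y a b)
    (fun a b => -(1 / 2) * (σ y + 2 * p y * f y) * G y a b
      - (1 / 2) * Real.exp (2 * w y) * (fderiv ℝ f y a * η y b + η y a * fderiv ℝ f y b
        + 2 * f y * (dir ξ w y - p y) * (η y a * η y b))) a b c (ξ y) := by
  rw [← h.metric_connCurv hy, h.symm y hy, h.metric_ξ y hy, ← mul_assoc, ← Real.exp_add]
  simp

/-- The horizontal differential of `p`. -/
theorem fderiv_p {x : E} (hx : η y x = 0) : fderiv ℝ p y x
    = p y * fderiv ℝ w y x + 1 / 2 * Real.exp (2 * w y) * fderiv ℝ f y x := by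
  -- With z horizontal, orthogonal to x, and G(b, z) = 1, the horizontal Ricci identity for η on (x,
  -- b, z) isolates dp(x) on one side and the mixed part B(x, ξ) on the other.
  obtain ⟨z, hz0, hz, hxz⟩ := exists_ne_zero_of_ker (by omega) (η y) (G y x)
  obtain ⟨b, hb, hbz⟩ := h.exists_horizontal_ne_zero hy hz0 hz
  have h1 := ricci_identity h.isOpen h.contDiffOn_christoffelL hy (h.christoffelL_comm hy)
    h.smooth_η x b z
  have dw := h.diffAt h.smooth_w hy
  have he : Real.exp (-(2 * w y)) * Real.exp (2 * w y) = 1 := by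
    rw [← Real.exp_add]; simp
  have hP : fderiv ℝ (fun y => Real.exp (-(2 * w y)) * p y) y x
      = Real.exp (-(2 * w y)) * (fderiv ℝ p y x - 2 * p y * fderiv ℝ w y x) := by
    rw [fderiv_fun_mul ((dw.const_mul 2).fun_neg.exp) (h.diffAt h.smooth_p hy),
      fderiv_exp (dw.const_mul 2).fun_neg, fderiv_fun_neg, fderiv_const_mul dw]
    simp
    ring
  rw [h.covBilin_covForm_η hy, h.covBilin_covForm_η hy, h.η_connCurv hy, hP] at h1
  simp only [h.covForm_η_apply hy, kulkarniNomizu, hx, hb, hz, hxz, hbz, h.η_ξ y hy,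
    h.metric_of_horizontal' hy hx, h.metric_of_horizontal' hy hb] at h1
  have h2 : Real.exp (-(2 * w y)) * (fderiv ℝ p y x
    - (p y * fderiv ℝ w y x + 1 / 2 * Real.exp (2 * w y) * fderiv ℝ f y x)) = 0 := by
    linear_combination h1
      - Real.exp (-(2 * w y)) * p y * fderiv ℝ w y z * h.symm y hy b x
  rcases mul_eq_zero.1 h2 with h3 | h3
  · exact absurd h3 (Real.exp_ne_zero _)
  · linarith

-- The Ricci identity for η on (x, ξ, z): the curvature side is a multiple of G(x, z) because B is a
-- multiple of G on H, and Hess w enters through the dw ⊗ η terms of ∇η.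
omit hdim in
theorem hess_w : ∃ κ : ℝ, ∀ x z, η y x = 0 → η y z = 0 →
    covForm (christoffelL G) (fderiv ℝ w) y x z + fderiv ℝ w y x * fderiv ℝ w y z
      = κ * G y x z := by
  refine ⟨(dir ξ w y - p y) * (Real.exp (-(2 * w y)) * p y)
    - dir ξ w y * (Real.exp (-(2 * w y)) * p y)
    - fderiv ℝ (fun y => Real.exp (-(2 * w y)) * p y) y (ξ y)
    - Real.exp (-(2 * w y)) * (-(1 / 2) * (σ y + 2 * p y * f y) * G y (ξ y) (ξ y)
      - (1 / 2) * Real.exp (2 * w y) * (dir ξ f y * η y (ξ y) + η y (ξ y) * dir ξ f y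
        + 2 * f y * (dir ξ w y - p y) * (η y (ξ y) * η y (ξ y)))
      + -(1 / 2) * (σ y + 2 * p y * f y) * Real.exp (2 * w y)), ?_⟩
  intro x z hx hz
  have h1 := ricci_identity h.isOpen h.contDiffOn_christoffelL hy (h.christoffelL_comm hy)
    h.smooth_η x (ξ y) z
  rw [h.covBilin_covForm_η hy, h.covBilin_covForm_η hy, h.η_connCurv hy] at h1
  simp only [h.covForm_η_apply hy, kulkarniNomizu, hx, hz, h.η_ξ y hy,
    h.metric_of_horizontal' hy hx, h.metric_of_horizontal hy hz, h.metric_of_horizontal hy hx] at h1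
  have hξ : G y (ξ y) (ξ y) = Real.exp (2 * w y) := by
    rw [h.metric_ξ y hy, h.η_ξ y hy, mul_one]
  simp only [hξ, h.η_ξ y hy, dir] at h1 ⊢
  linear_combination -h1

end Dimension

end VerticalSoliton

end Soliton

end AccR

namespace AccR

/-! ### The Codazzi equation of a vertical soliton. -/

section Soliton

variable {E : Type*} [NormedAddCommGroup E] [NormedSpace ℝ E]

namespace VerticalSoliton

variable {G : E → E →L[ℝ] E →L[ℝ] ℝ} {ξ : E → E} {η : E → E →L[ℝ] ℝ}
  {w p f σ : E → ℝ} {U : Set E}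

variable (h : VerticalSoliton G ξ η w p f σ U) {y : E} (hy : y ∈ U)
include h

theorem smooth_θ : ContDiffOn ℝ ∞ (fun y => (-(1 / 2) * Real.exp (2 * w y)) •
    (fderiv ℝ f y + (f y * (dir ξ w y - p y)) • η y)) U :=
  (contDiffOn_const.mul (contDiffOn_const.mul h.smooth_w).exp).smul
    ((h.smooth_fderiv h.smooth_f).add ((h.smooth_f.mul h.smooth_l).smul h.smooth_η))

include hy

theorem covForm_θ (a b : E) :
    covForm (christoffelL G) (fun y => (-(1 / 2) * Real.exp (2 * w y)) •
      (fderiv ℝ f y + (f y * (dir ξ w y - p y)) • η y)) y a b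
      = -Real.exp (2 * w y) * fderiv ℝ w y a
          * (fderiv ℝ f y b + f y * (dir ξ w y - p y) * η y b)
        - 1 / 2 * Real.exp (2 * w y) * (covForm (christoffelL G) (fderiv ℝ f) y a b
          + (fderiv ℝ f y a * (dir ξ w y - p y)
            + f y * fderiv ℝ (fun y => dir ξ w y - p y) y a) * η y b
          + f y * (dir ξ w y - p y) * covForm (christoffelL G) η y a b) := by
  have dη := h.diffAt h.smooth_η hy
  have dw := h.diffAt h.smooth_w hy
  have df := h.diffAt h.smooth_f hy
  have df' := h.diffAt (h.smooth_fderiv h.smooth_f) hy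
  have dl := h.diffAt h.smooth_l hy
  have he : fderiv ℝ (fun y => -(1 / 2) * Real.exp (2 * w y)) y a
      = -Real.exp (2 * w y) * fderiv ℝ w y a := by
    rw [fderiv_const_mul (dw.const_mul 2).exp, fderiv_exp (dw.const_mul 2), fderiv_const_mul dw]
    simp
    ring
  rw [covForm_smul ((dw.const_mul 2).exp.const_mul _) (df'.fun_add ((df.fun_mul dl).fun_smul dη)),
    covForm_add df' ((df.fun_mul dl).fun_smul dη), covForm_smul (df.fun_mul dl) dη, he,
    fderiv_fun_mul df dl]
  simp
  ring

variable [FiniteDimensional ℝ E] (hdim : 5 ≤ Module.finrank ℝ E)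

include hdim

/-- B = λG + θ ⊗ η + η ⊗ θ. The scalar λ contains σ, whose derivative is unknown, so it is kept
opaque and eliminated between components afterwards. -/
theorem codazzi_eq :
    ∃ (lam : E → ℝ) (θ : E → E →L[ℝ] ℝ),
      (∀ b, θ y b = -(1 / 2) * Real.exp (2 * w y) *
        (fderiv ℝ f y b + f y * (dir ξ w y - p y) * η y b)) ∧
      (∀ a b, covForm (christoffelL G) θ y a b = -Real.exp (2 * w y) * fderiv ℝ w y a
          * (fderiv ℝ f y b + f y * (dir ξ w y - p y) * η y b)
        - 1 / 2 * Real.exp (2 * w y) * (covForm (christoffelL G) (fderiv ℝ f) y a b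
          + (fderiv ℝ f y a * (dir ξ w y - p y)
            + f y * fderiv ℝ (fun y => dir ξ w y - p y) y a) * η y b
          + f y * (dir ξ w y - p y) * covForm (christoffelL G) η y a b)) ∧
      ∀ a b c, fderiv ℝ lam y a * G y b c
        + (covForm (christoffelL G) θ y a b * η y c + θ y b * covForm (christoffelL G) η y a c
          + covForm (christoffelL G) η y a b * θ y c + η y b * covForm (christoffelL G) θ y a c)
        = fderiv ℝ lam y b * G y a c
        + (covForm (christoffelL G) θ y b a * η y c + θ y a * covForm (christoffelL G) η y b c
          + covForm (christoffelL G) η y b a * θ y c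
          + η y a * covForm (christoffelL G) θ y b c) := by
  set lam : E → ℝ := fun y => -(1 / 2) * (σ y + 2 * p y * f y) with hlam
  set θ : E → E →L[ℝ] ℝ := fun y => (-(1 / 2) * Real.exp (2 * w y)) •
      (fderiv ℝ f y + (f y * (dir ξ w y - p y)) • η y) with hθ
  have sθ : ContDiffOn ℝ ∞ θ U := h.smooth_θ
  have slam : ContDiffOn ℝ ∞ lam U := contDiffOn_const.mul
    (h.smooth_σ.add ((contDiffOn_const.mul h.smooth_p).mul h.smooth_f))
  refine ⟨lam, θ, fun b => by simp [hθ]; ring, fun a b => h.covForm_θ hy a b, ?_⟩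
  have sθη := contDiffOn_tmul sθ h.smooth_η
  have sηθ := contDiffOn_tmul h.smooth_η sθ
  have hcod := h.toIsMetricOn.codazzi (by omega) (B := fun y => lam y • G y
    + (tmul (θ y) (η y) + tmul (η y) (θ y))) ((slam.smul h.smooth).add (sθη.add sηθ))
    (fun z hz a b c d => by
      rw [h.curv_eq z hz]
      congr 1
      ext a b
      simp [hlam, hθ]
      ring) hy
  have hexp : ∀ a b c, covBilin (christoffelL G) (fun y => lam y • G y
      + (tmul (θ y) (η y) + tmul (η y) (θ y))) y a b c = fderiv ℝ lam y a * G y b c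
        + (covForm (christoffelL G) θ y a b * η y c + θ y b * covForm (christoffelL G) η y a c
          + covForm (christoffelL G) η y a b * θ y c + η y b * covForm (christoffelL G) θ y a c) := by
    intro a b c
    have dθ := h.diffAt sθ hy
    have dη := h.diffAt h.smooth_η hy
    have dlam := h.diffAt slam hy
    have dG := h.diffAt h.smooth hy
    rw [covBilin_add (dlam.fun_smul dG) ((h.diffAt sθη hy).fun_add (h.diffAt sηθ hy)),
      covBilin_add (h.diffAt sθη hy) (h.diffAt sηθ hy), covBilin_smul dlam dG,
      covBilin_tmul dθ dη, covBilin_tmul dη dθ, h.covBilin_metric hy]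
    ring
  intro a b c
  rw [← hexp, ← hexp]
  exact hcod a b c

/-- The Codazzi equation on (x, ξ, z), where Hess f appears through ∇θ and all λ terms are multiples
of G(x, z). -/
theorem hess_f : ∃ κ : ℝ, ∀ x z, η y x = 0 → η y z = 0 →
    covForm (christoffelL G) (fderiv ℝ f) y x z + 2 * fderiv ℝ w y x * fderiv ℝ f y z
      + fderiv ℝ f y x * fderiv ℝ w y z = κ * G y x z := by
  obtain ⟨lam, θ, hθ, hθ', hC⟩ := h.codazzi_eq hy hdim
  refine ⟨2 * Real.exp (-(2 * w y)) * (-fderiv ℝ lam y (ξ y) + Real.exp (-(2 * w y)) * p y *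
    θ y (ξ y)) - f y * (dir ξ w y - p y) * (Real.exp (-(2 * w y)) * p y), fun x z hx hz => ?_⟩
  have h1 := hC x (ξ y) z
  have he : Real.exp (-(2 * w y)) * Real.exp (2 * w y) = 1 := by
    rw [← Real.exp_add]; simp
  simp only [hθ', h.covForm_η_apply hy, hθ x, hθ z, hx, hz, h.η_ξ y hy,
    h.metric_of_horizontal' hy hx, h.metric_of_horizontal hy hz,
    h.metric_of_horizontal hy hx] at h1 ⊢
  linear_combination (-2 * Real.exp (-(2 * w y))) * h1
   - (covForm (christoffelL G) (fderiv ℝ f) y x z + 2 * fderiv ℝ w y x * fderiv ℝ f y z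
      + fderiv ℝ f y x * fderiv ℝ w y z + 
      f y * (dir ξ w y - p y) * (Real.exp (-(2 * w y)) * p y) * G y x z) * he

/-- The Codazzi equation on (x, ξ, ξ), with dλ(x) eliminated by a purely horizontal component. -/
theorem fderiv_dir_f {x : E} (hx : η y x = 0) :
    fderiv ℝ (dir ξ f) y x + 2 * (fderiv ℝ f y x * (dir ξ w y - p y)
        + f y * fderiv ℝ (fun y => dir ξ w y - p y) y x)
      + 2 * fderiv ℝ w y x * (dir ξ f y + f y * (dir ξ w y - p y))
      - dir ξ w y * fderiv ℝ f y x = 0 := by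
  obtain ⟨lam, θ, hθ, hθ', hC⟩ := h.codazzi_eq hy hdim
  obtain ⟨z, hz0, hz, hxz⟩ := exists_ne_zero_of_ker (by omega) (η y) (G y x)
  obtain ⟨b, hb, hbz⟩ := h.exists_horizontal_ne_zero hy hz0 hz
  have he : Real.exp (-(2 * w y)) * Real.exp (2 * w y) = 1 := by
    rw [← Real.exp_add]; simp
  -- On horizontal (x, b, z) with G(x, z) = 0 and G(b, z) = 1, only dλ(x) and θ(x)∇η(b, z) survive.
  have hlam : fderiv ℝ lam y x = Real.exp (-(2 * w y)) * p y * θ y x := by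
    have h1 := hC x b z
    simp only [h.covForm_η_apply hy, hx, hb, hz, hxz, hbz] at h1
    linear_combination h1 - Real.exp (-(2 * w y)) * p y * θ y z * h.symm y hy x b
  have h1 := hC x (ξ y) (ξ y)
  have hξ : G y (ξ y) (ξ y) = Real.exp (2 * w y) := by
    rw [h.metric_ξ y hy, h.η_ξ y hy, mul_one]
  have hf := h.fderiv_dir hy h.smooth_f hx
  have hP : Real.exp (-(2 * w y)) * p y * Real.exp (2 * w y) = p y := by
    linear_combination p y * he
  have hlam' : fderiv ℝ lam y x * Real.exp (2 * w y) = p y * θ y x := by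
    rw [hlam]
    linear_combination p y * θ y x * he
  simp only [hθ', h.covForm_η_apply hy, hx, h.η_ξ y hy, hξ, hP, hlam',
    h.hess_comm hy h.smooth_f (ξ y) x,
    h.metric_of_horizontal' hy hx, h.metric_of_horizontal hy hx] at h1
  rw [hθ x, hθ (ξ y), hx, h.η_ξ y hy] at h1
  simp only [dir] at h1 hf ⊢
  have hE := Real.exp_ne_zero (2 * w y)
  apply mul_left_cancel₀ hE
  linear_combination Real.exp (2 * w y) * hf - 2 * h1

end VerticalSoliton

end Soliton

end AccR

namespace AccR

/-! ### Propagation of the horizontal Hessian condition along ξ. -/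

section Soliton

variable {E : Type*} [NormedAddCommGroup E] [NormedSpace ℝ E]

namespace VerticalSoliton

variable {G : E → E →L[ℝ] E →L[ℝ] ℝ} {ξ : E → E} {η : E → E →L[ℝ] ℝ}
  {w p f σ : E → ℝ} {U : Set E}

variable (h : VerticalSoliton G ξ η w p f σ U) {y : E} (hy : y ∈ U)
include h

theorem smooth_hess {u : E → ℝ} [FiniteDimensional ℝ E] (hu : ContDiffOn ℝ ∞ u U) :
    ContDiffOn ℝ ∞ (covForm (christoffelL G) (fderiv ℝ u)) U :=
  contDiffOn_covForm h.isOpen h.contDiffOn_christoffelL (h.smooth_fderiv hu)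

include hy

theorem exists_decomp (a : E) : ∃ (x : E) (s : ℝ), η y x = 0 ∧ a = x + s • ξ y :=
  ⟨a - η y a • ξ y, η y a, by simp [h.η_ξ y hy], by simp⟩

theorem metric_ξ_ξ : G y (ξ y) (ξ y) = Real.exp (2 * w y) := by
  rw [h.metric_ξ y hy, h.η_ξ y hy, mul_one]

/-- Completes the horizontal condition to a formula on the whole space: `fderiv_dir` determines ζ on
H from the mixed components, and j is the value that matches the (ξ, ξ) component. -/
theorem hess_decomp {u κ : E → ℝ} (hu : ContDiffOn ℝ ∞ u U)
    (hT : ∀ x z, η y x = 0 → η y z = 0 →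
      covForm (christoffelL G) (fderiv ℝ u) y x z + fderiv ℝ w y x * fderiv ℝ u y z
        + fderiv ℝ w y z * fderiv ℝ u y x = κ y * G y x z)
    {ζ : E → E →L[ℝ] ℝ} {j : ℝ}
    (hj : j = 1 / 2 * (covForm (christoffelL G) (fderiv ℝ u) y (ξ y) (ξ y)
        + 2 * dir ξ w y * dir ξ u y - κ y * Real.exp (2 * w y))
        - dir ξ (dir ξ u) y - (dir ξ w y - p y) * dir ξ u y)
    (hζ : ζ y = fderiv ℝ (dir ξ u) y + (dir ξ w y - p y) • fderiv ℝ u y + j • η y) :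
    covForm (christoffelL G) (fderiv ℝ u) y = κ y • G y + (tmul (ζ y) (η y) + tmul (η y) (ζ y))
      - (tmul (fderiv ℝ w y) (fderiv ℝ u y) + tmul (fderiv ℝ u y) (fderiv ℝ w y)) := by
  ext a b
  obtain ⟨x, s, hx, rfl⟩ := h.exists_decomp hy a
  obtain ⟨z, t, hz, rfl⟩ := h.exists_decomp hy b
  have h1 := hT x z hx hz
  have h2 := h.fderiv_dir hy hu hx
  have h3 := h.fderiv_dir hy hu hz
  have h4 := h.hess_comm hy hu (ξ y) z
  have h5 := h.metric_ξ_ξ hy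
  simp only [dir] at *
  simp only [map_add, map_smul, add_apply, smul_apply, sub_apply, smul_eq_mul, tmul_apply, hζ, hx,
    hz, h.η_ξ y hy, h.metric_of_horizontal' hy hx, h.metric_of_horizontal hy hz, h5, hj]
  linear_combination h1 - t * h2 - s * h3 + s * h4

variable [FiniteDimensional ℝ E] (hdim : 5 ≤ Module.finrank ℝ E)

/-- Contracted with du, the curvature is a multiple of G(x, z) plus a df(z)du(x) term; the latter is
what turns dp into d(ξw - p) in `hess_dir_of_smooth`. -/
theorem connCurv_ξ : ∃ Y : E, ∀ x z, η y x = 0 → η y z = 0 →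
    connCurv (christoffelL G) y (ξ y) x z
      = G y x z • Y + (1 / 2 * Real.exp (2 * w y) * fderiv ℝ f y z) • x := by
  refine ⟨(G y).inverse ((-(σ y + 2 * p y * f y)) • G y (ξ y)
    - (1 / 2 * Real.exp (2 * w y)) • (fderiv ℝ f y
      + (dir ξ f y + 2 * f y * (dir ξ w y - p y)) • η y)), fun x z hx hz => ?_⟩
  apply h.eq_of_forall hy
  intro c
  rw [h.metric_connCurv hy]
  simp only [kulkarniNomizu, map_add, map_smul, add_apply, smul_apply, smul_eq_mul,
    h.apply_inverse hy, sub_apply, h.η_ξ y hy, hx, hz, h.metric_of_horizontal hy hz, dir]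
  ring

include hdim

/-- In effect the Lie derivative along ξ of the statement that the Hessian of u for e^{-2w}G is pure
trace on H. The flow of ξ rescales that metric on H at rate -2l, and the resulting change of
connection produces the dl ⊗ du + du ⊗ dl terms. The computation is the Ricci identity for du on (ξ,
x, z), with `hess_decomp` inserted. -/
theorem hess_dir_of_smooth {u κ : E → ℝ} (hu : ContDiffOn ℝ ∞ u U) (hκ : ContDiffOn ℝ ∞ κ U)
    (hT : ∀ y ∈ U, ∀ x z, η y x = 0 → η y z = 0 →
      covForm (christoffelL G) (fderiv ℝ u) y x z + fderiv ℝ w y x * fderiv ℝ u y z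
        + fderiv ℝ w y z * fderiv ℝ u y x = κ y * G y x z) :
    ∃ κ' : ℝ, ∀ x z, η y x = 0 → η y z = 0 →
      covForm (christoffelL G) (fderiv ℝ (dir ξ u)) y x z
        + fderiv ℝ w y x * fderiv ℝ (dir ξ u) y z + fderiv ℝ w y z * fderiv ℝ (dir ξ u) y x
        + fderiv ℝ (fun y => dir ξ w y - p y) y x * fderiv ℝ u y z
        + fderiv ℝ (fun y => dir ξ w y - p y) y z * fderiv ℝ u y x = κ' * G y x z := by
  set l : E → ℝ := fun y => dir ξ w y - p y with hl
  have sl : ContDiffOn ℝ ∞ l U := h.smooth_l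
  set j : E → ℝ := fun y => 1 / 2 * (covForm (christoffelL G) (fderiv ℝ u) y (ξ y) (ξ y)
        + 2 * dir ξ w y * dir ξ u y - κ y * Real.exp (2 * w y))
        - dir ξ (dir ξ u) y - (dir ξ w y - p y) * dir ξ u y with hj
  have su' := h.smooth_fderiv hu
  have sw' := h.smooth_fderiv h.smooth_w
  have sd := h.smooth_dir hu
  have sd' := h.smooth_fderiv sd
  have sη := h.smooth_η
  have sj : ContDiffOn ℝ ∞ j U :=
    ((contDiffOn_const.mul (((((h.smooth_hess hu).clm_apply h.smooth_ξ).clm_apply h.smooth_ξ).add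
      ((contDiffOn_const.mul (h.smooth_dir h.smooth_w)).mul sd)).sub
      (hκ.mul (contDiffOn_const.mul h.smooth_w).exp))).sub (h.smooth_dir sd)).sub (sl.mul sd)
  set ζ : E → E →L[ℝ] ℝ := fun y => fderiv ℝ (dir ξ u) y + l y • fderiv ℝ u y + j y • η y with hζ
  have sζ : ContDiffOn ℝ ∞ ζ U := (sd'.add (sl.smul su')).add (sj.smul sη)
  have heq : ∀ z ∈ U, covForm (christoffelL G) (fderiv ℝ u) z
      = κ z • G z + (tmul (ζ z) (η z) + tmul (η z) (ζ z))
      - (tmul (fderiv ℝ w z) (fderiv ℝ u z) + tmul (fderiv ℝ u z) (fderiv ℝ w z)) :=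
    fun z hz => h.hess_decomp hz hu (hT z hz) (j := j z) rfl rfl
  have hcov : ∀ a b c, covBilin (christoffelL G) (covForm (christoffelL G) (fderiv ℝ u)) y a b c
      = fderiv ℝ κ y a * G y b c
        + (covForm (christoffelL G) ζ y a b * η y c + ζ y b * covForm (christoffelL G) η y a c
          + covForm (christoffelL G) η y a b * ζ y c + η y b * covForm (christoffelL G) ζ y a c)
        - (covForm (christoffelL G) (fderiv ℝ w) y a b * fderiv ℝ u y c
          + fderiv ℝ w y b * covForm (christoffelL G) (fderiv ℝ u) y a c
          + covForm (christoffelL G) (fderiv ℝ u) y a b * fderiv ℝ w y c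
          + fderiv ℝ u y b * covForm (christoffelL G) (fderiv ℝ w) y a c) := by
    intro a b c
    have d1 := h.diffAt (contDiffOn_tmul sζ sη) hy
    have d2 := h.diffAt (contDiffOn_tmul sη sζ) hy
    have d3 := h.diffAt (contDiffOn_tmul sw' su') hy
    have d4 := h.diffAt (contDiffOn_tmul su' sw') hy
    have dκ := h.diffAt hκ hy
    have dG := h.diffAt h.smooth hy
    rw [covBilin_congr h.isOpen heq hy, covBilin_sub ((dκ.fun_smul dG).fun_add (d1.fun_add d2))
      (d3.fun_add d4), covBilin_add (dκ.fun_smul dG) (d1.fun_add d2), covBilin_add d1 d2,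
      covBilin_add d3 d4, covBilin_smul dκ dG, covBilin_tmul (h.diffAt sζ hy) (h.diffAt sη hy),
      covBilin_tmul (h.diffAt sη hy) (h.diffAt sζ hy),
      covBilin_tmul (h.diffAt sw' hy) (h.diffAt su' hy),
      covBilin_tmul (h.diffAt su' hy) (h.diffAt sw' hy), h.covBilin_metric hy]
    ring
  have hζ' : ∀ a b, covForm (christoffelL G) ζ y a b
      = covForm (christoffelL G) (fderiv ℝ (dir ξ u)) y a b
        + (fderiv ℝ l y a * fderiv ℝ u y b + l y * covForm (christoffelL G) (fderiv ℝ u) y a b)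
        + (fderiv ℝ j y a * η y b + j y * covForm (christoffelL G) η y a b) := by
    intro a b
    have d1 := h.diffAt sd' hy
    have d2 := (h.diffAt sl hy).fun_smul (h.diffAt su' hy)
    have d3 := (h.diffAt sj hy).fun_smul (h.diffAt sη hy)
    rw [covForm_add (d1.fun_add d2) d3, covForm_add d1 d2,
      covForm_smul (h.diffAt sl hy) (h.diffAt su' hy),
      covForm_smul (h.diffAt sj hy) (h.diffAt sη hy)]
  obtain ⟨Y, hY⟩ := h.connCurv_ξ hy
  obtain ⟨κw, hκw⟩ := h.hess_w hy
  set P : ℝ := Real.exp (-(2 * w y)) * p y with hP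
  refine ⟨fderiv ℝ κ y (ξ y) - ζ y (ξ y) * P - l y * κ y - j y * P + dir ξ w y * κ y
    + dir ξ u y * κw + fderiv ℝ u y Y, fun x z hx hz => ?_⟩
  have h1 := ricci_identity h.isOpen h.contDiffOn_christoffelL hy (h.christoffelL_comm hy)
    su' (ξ y) x z
  have hux := h.fderiv_dir hy hu hx
  have huz := h.fderiv_dir hy hu hz
  have hwx := h.fderiv_dir hy h.smooth_w hx
  have hwz := h.fderiv_dir hy h.smooth_w hz
  have hpz := h.fderiv_p hy hdim hz
  have hTxz := hT y hy x z hx hz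
  have hwxz := hκw x z hx hz
  have hlz : ∀ a, fderiv ℝ l y a = fderiv ℝ (dir ξ w) y a - fderiv ℝ p y a := by
    intro a
    rw [hl, fderiv_fun_sub (h.diffAt (h.smooth_dir h.smooth_w) hy) (h.diffAt h.smooth_p hy)]
    rfl
  have hζx : ∀ x, η y x = 0 → ζ y x = fderiv ℝ (dir ξ u) y x + l y * fderiv ℝ u y x := by
    intro x hx
    simp [hζ, hx]
  rw [hcov, hcov, hY x z hx hz, hζ' x z] at h1
  simp only [map_add, map_smul, smul_eq_mul, h.covForm_η_apply hy, hx, hz, h.η_ξ y hy,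
    h.metric_of_horizontal' hy hx, h.metric_of_horizontal hy hz, h.metric_of_horizontal hy hx,
    hζx x hx, hζx z hz, h.hess_comm hy hu (ξ y), h.hess_comm hy h.smooth_w (ξ y), ← hP] at h1
  have hly : l y = dir ξ w y - p y := rfl
  rw [← hly] at h1
  simp only [hlz] at h1 ⊢
  have hux' : covForm (christoffelL G) (fderiv ℝ u) y x (ξ y) = fderiv ℝ (dir ξ u) y x
    - p y * fderiv ℝ u y x - fderiv ℝ w y x * dir ξ u y := by linear_combination -hux
  have huz' : covForm (christoffelL G) (fderiv ℝ u) y z (ξ y) = fderiv ℝ (dir ξ u) y z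
    - p y * fderiv ℝ u y z - fderiv ℝ w y z * dir ξ u y := by linear_combination -huz
  have hwx' : covForm (christoffelL G) (fderiv ℝ w) y x (ξ y) = fderiv ℝ (dir ξ w) y x
    - p y * fderiv ℝ w y x - fderiv ℝ w y x * dir ξ w y := by linear_combination -hwx
  have hwz' : covForm (christoffelL G) (fderiv ℝ w) y z (ξ y) = fderiv ℝ (dir ξ w) y z
    - p y * fderiv ℝ w y z - fderiv ℝ w y z * dir ξ w y := by linear_combination -hwz
  have hTxz' : covForm (christoffelL G) (fderiv ℝ u) y x z = κ y * G y x z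
    - fderiv ℝ w y x * fderiv ℝ u y z - fderiv ℝ w y z * fderiv ℝ u y x := by
    linear_combination hTxz
  have hwxz' : covForm (christoffelL G) (fderiv ℝ w) y x z = κw * G y x z
    - fderiv ℝ w y x * fderiv ℝ w y z := by linear_combination hwxz
  rw [hux', huz', hwx', hwz', hTxz', hwxz'] at h1
  simp only [hly, dir] at h1 ⊢
  linear_combination -h1 - fderiv ℝ u y x * hpz

/-- If the horizontal part of `Hess u + dw ⊗ du + du ⊗ dw` is a multiple of the metric, then so is
that of `Hess ξu + dw ⊗ dξu + dξu ⊗ dw + dl ⊗ du + du ⊗ dl`, where `l = ξw - p`. -/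
theorem hess_dir {u : E → ℝ} (hu : ContDiffOn ℝ ∞ u U)
    (hT : ∀ y ∈ U, ∃ κ : ℝ, ∀ x z, η y x = 0 → η y z = 0 →
      covForm (christoffelL G) (fderiv ℝ u) y x z + fderiv ℝ w y x * fderiv ℝ u y z
        + fderiv ℝ w y z * fderiv ℝ u y x = κ * G y x z) :
    ∃ κ' : ℝ, ∀ x z, η y x = 0 → η y z = 0 →
      covForm (christoffelL G) (fderiv ℝ (dir ξ u)) y x z
        + fderiv ℝ w y x * fderiv ℝ (dir ξ u) y z + fderiv ℝ w y z * fderiv ℝ (dir ξ u) y x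
        + fderiv ℝ (fun y => dir ξ w y - p y) y x * fderiv ℝ u y z
        + fderiv ℝ (fun y => dir ξ w y - p y) y z * fderiv ℝ u y x = κ' * G y x z := by
  -- The factor κ is only given pointwise. Evaluating on the horizontal projection of a fixed vector
  -- that is non-null at y writes it near y as a quotient of smooth functions.
  obtain ⟨x₀, hx₀, hG₀⟩ := h.exists_horizontal_nonnull hy hdim
  let X : E → E := fun z => x₀ - η z x₀ • ξ z
  have sX : ContDiffOn ℝ ∞ X U := contDiffOn_const.sub
    ((h.smooth_η.clm_apply contDiffOn_const).smul h.smooth_ξ)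
  have hX : ∀ z ∈ U, η z (X z) = 0 := fun z hz => by simp [X, h.η_ξ z hz]
  let q : E → ℝ := fun z => G z (X z) (X z)
  have sq : ContDiffOn ℝ ∞ q U := (h.smooth.clm_apply sX).clm_apply sX
  let V : Set E := U ∩ q ⁻¹' {0}ᶜ
  have hV : IsOpen V := sq.continuousOn.isOpen_inter_preimage h.isOpen isOpen_compl_singleton
  have hyV : y ∈ V := ⟨hy, by simp [q, X, hx₀, hG₀]⟩
  have hVU : V ⊆ U := Set.inter_subset_left
  let T : E → ℝ := fun z => covForm (christoffelL G) (fderiv ℝ u) z (X z) (X z)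
    + fderiv ℝ w z (X z) * fderiv ℝ u z (X z) + fderiv ℝ w z (X z) * fderiv ℝ u z (X z)
  have sT : ContDiffOn ℝ ∞ T U :=
    ((((h.smooth_hess hu).clm_apply sX).clm_apply sX).add
      (((h.smooth_fderiv h.smooth_w).clm_apply sX).mul ((h.smooth_fderiv hu).clm_apply sX))).add
      (((h.smooth_fderiv h.smooth_w).clm_apply sX).mul ((h.smooth_fderiv hu).clm_apply sX))
  refine (h.restrict hV hVU).hess_dir_of_smooth hyV hdim (κ := fun z => T z / q z)
    (hu.mono hVU) ((sT.mono hVU).div (sq.mono hVU) fun z hz => hz.2) fun z hz x x' hx hx' => ?_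
  obtain ⟨κ, hκ⟩ := hT z hz.1
  have hq : q z ≠ 0 := hz.2
  have h1 : T z = κ * q z := hκ _ _ (hX z hz.1) (hX z hz.1)
  rw [hκ x x' hx hx', h1, mul_div_cancel_right₀ _ hq]

end VerticalSoliton

end Soliton

end AccR

namespace AccR

section Soliton

/-! ### The functions ω = e^{-w}, χ = -pe^{-w} and l = ξw - p, and their horizontal Hessians. -/

variable {E : Type*} [NormedAddCommGroup E] [NormedSpace ℝ E]

/-- The function `e^{-w}`. -/
noncomputable def expNeg (w : E → ℝ) (y : E) : ℝ := Real.exp (-w y)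

/-- The function `-p e^{-w}`. -/
noncomputable def expNegSpeed (w p : E → ℝ) (y : E) : ℝ := -(p y * Real.exp (-w y))

/-- The function `ξ w - p`. -/
noncomputable def rate (ξ : E → E) (w p : E → ℝ) (y : E) : ℝ := dir ξ w y - p y

omit [NormedAddCommGroup E] [NormedSpace ℝ E] in
theorem expNeg_pos (w : E → ℝ) (y : E) : 0 < expNeg w y := Real.exp_pos _

namespace VerticalSoliton

variable {G : E → E →L[ℝ] E →L[ℝ] ℝ} {ξ : E → E} {η : E → E →L[ℝ] ℝ}
  {w p f σ : E → ℝ} {U : Set E}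

variable (h : VerticalSoliton G ξ η w p f σ U) {y : E} (hy : y ∈ U)
include h

theorem smooth_expNeg : ContDiffOn ℝ ∞ (expNeg w) U := h.smooth_w.neg.exp

theorem smooth_expNegSpeed : ContDiffOn ℝ ∞ (expNegSpeed w p) U :=
  (h.smooth_p.mul h.smooth_w.neg.exp).neg

theorem smooth_rate : ContDiffOn ℝ ∞ (rate ξ w p) U := h.smooth_l

include hy

theorem fderiv_expNeg : fderiv ℝ (expNeg w) y = (-expNeg w y) • fderiv ℝ w y := by
  unfold expNeg
  rw [fderiv_exp (h.diffAt h.smooth_w hy).fun_neg, fderiv_fun_neg]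
  ext
  simp

/-- This identity ties the three functions together: it lets l be treated as (χ - ξω)/ω. -/
theorem dir_expNeg : dir ξ (expNeg w) y = expNegSpeed w p y - expNeg w y * rate ξ w p y := by
  rw [dir, h.fderiv_expNeg hy, rate, expNegSpeed, expNeg, dir]
  simp
  ring

theorem fderiv_dir_expNeg (a : E) : fderiv ℝ (dir ξ (expNeg w)) y a
    = fderiv ℝ (expNegSpeed w p) y a - (fderiv ℝ (expNeg w) y a * rate ξ w p y
      + expNeg w y * fderiv ℝ (rate ξ w p) y a) := by
  have d1 := h.diffAt h.smooth_expNeg hy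
  have d2 := h.diffAt h.smooth_expNegSpeed hy
  have d3 := h.diffAt h.smooth_rate hy
  rw [fderiv_eq_of_eqOn h.isOpen (fun z hz => h.dir_expNeg hz) hy,
    fderiv_fun_sub d2 (d1.fun_mul d3), fderiv_fun_mul d1 d3]
  simp
  ring

variable [FiniteDimensional ℝ E] (hdim : 5 ≤ Module.finrank ℝ E)

theorem hess_expNeg : ∃ κ : ℝ, ∀ x z, η y x = 0 → η y z = 0 →
    covForm (christoffelL G) (fderiv ℝ (expNeg w)) y x z
      + fderiv ℝ w y x * fderiv ℝ (expNeg w) y z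
      + fderiv ℝ w y z * fderiv ℝ (expNeg w) y x = κ * G y x z := by
  obtain ⟨κ, hκ⟩ := h.hess_w hy
  refine ⟨-expNeg w y * κ, fun x z hx hz => ?_⟩
  have d1 := h.diffAt h.smooth_expNeg hy
  have d2 := h.diffAt (h.smooth_fderiv h.smooth_w) hy
  rw [covForm_congr h.isOpen (fun z hz => h.fderiv_expNeg hz) hy, covForm_smul d1.fun_neg d2,
    fderiv_fun_neg]
  simp only [h.fderiv_expNeg hy, neg_apply, smul_apply, smul_eq_mul]
  linear_combination (-expNeg w y) * hκ x z hx hz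

include hdim

/-- `fderiv_p` rewritten: the combination dp - p dw is -e^w dχ. -/
theorem fderiv_f {x : E} (hx : η y x = 0) :
    fderiv ℝ f y x = -2 * expNeg w y * fderiv ℝ (expNegSpeed w p) y x := by
  have d1 := h.diffAt h.smooth_expNeg hy
  have hc : fderiv ℝ (expNegSpeed w p) y x
      = -(fderiv ℝ p y x * expNeg w y + p y * fderiv ℝ (expNeg w) y x) := by
    change fderiv ℝ (fun y => -(p y * expNeg w y)) y x = _
    rw [fderiv_fun_neg, fderiv_fun_mul (h.diffAt h.smooth_p hy) d1]
    simp
    ring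
  have he : Real.exp (2 * w y) * expNeg w y * expNeg w y = 1 := by
    rw [expNeg, ← Real.exp_add, ← Real.exp_add]
    ring_nf
    simp
  rw [hc, h.fderiv_p hy hdim hx, h.fderiv_expNeg hy, smul_apply, smul_eq_mul]
  linear_combination -fderiv ℝ f y x * he

-- The form df + 2ω dχ kills H, so its covariant derivative is a multiple of G on H. Its symmetric,
-- skew horizontal and skew mixed parts each yield one of the relations below.
omit hy in
theorem horizontal_f : ∀ y ∈ U, ∀ x, η y x = 0 →
    (fderiv ℝ f y + (2 * expNeg w y) • fderiv ℝ (expNegSpeed w p) y) x = 0 := by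
  intro y hy x hx
  simp [h.fderiv_f hy hdim hx]

omit hy hdim [FiniteDimensional ℝ E] in
theorem smooth_horizontal_f : ContDiffOn ℝ ∞
    (fun y => fderiv ℝ f y + (2 * expNeg w y) • fderiv ℝ (expNegSpeed w p) y) U :=
  (h.smooth_fderiv h.smooth_f).add
    ((contDiffOn_const.mul h.smooth_expNeg).smul (h.smooth_fderiv h.smooth_expNegSpeed))

omit hdim [FiniteDimensional ℝ E] in
theorem covForm_horizontal_f (a b : E) :
    covForm (christoffelL G)
      (fun y => fderiv ℝ f y + (2 * expNeg w y) • fderiv ℝ (expNegSpeed w p) y) y a b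
      = covForm (christoffelL G) (fderiv ℝ f) y a b
        + (2 * fderiv ℝ (expNeg w) y a * fderiv ℝ (expNegSpeed w p) y b
        + 2 * expNeg w y * covForm (christoffelL G) (fderiv ℝ (expNegSpeed w p)) y a b) := by
  have d1 := h.diffAt h.smooth_expNeg hy
  have d2 := h.diffAt (h.smooth_fderiv h.smooth_expNegSpeed) hy
  rw [covForm_add (h.diffAt (h.smooth_fderiv h.smooth_f) hy) ((d1.const_mul 2).fun_smul d2),
    covForm_smul (d1.const_mul 2) d2, fderiv_const_mul d1]
  simp

/-- Substituting df = -2ω dχ and the derived expression for Hess f into `hess_f` turns its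
asymmetric dw terms into symmetric ones, with common factor -2ω. -/
theorem hess_expNegSpeed : ∃ κ : ℝ, ∀ x z, η y x = 0 → η y z = 0 →
    covForm (christoffelL G) (fderiv ℝ (expNegSpeed w p)) y x z
      + fderiv ℝ w y x * fderiv ℝ (expNegSpeed w p) y z
      + fderiv ℝ w y z * fderiv ℝ (expNegSpeed w p) y x = κ * G y x z := by
  obtain ⟨κ, hκ⟩ := h.hess_f hy hdim
  have hpos := (expNeg_pos w y).ne'
  refine ⟨((fun y => fderiv ℝ f y + (2 * expNeg w y) • fderiv ℝ (expNegSpeed w p) y) y (ξ y)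
    * (Real.exp (-(2 * w y)) * p y) - κ) / (2 * expNeg w y), fun x z hx hz => ?_⟩
  have h1 := h.covForm_of_horizontal_apply hy h.smooth_horizontal_f
    (h.horizontal_f hdim) hx hz
  rw [h.covForm_horizontal_f hy] at h1
  have h2 := hκ x z hx hz
  rw [h.fderiv_f hy hdim hx, h.fderiv_f hy hdim hz] at h2
  rw [h.fderiv_expNeg hy, smul_apply, smul_eq_mul] at h1
  field_simp
  linear_combination h1 - h2

/-- Exterior derivative of df = -2ω dχ restricted to H: Hessians are symmetric, so only dω ∧ dχ is
left. -/
theorem fderiv_expNeg_wedge {x z : E} (hx : η y x = 0) (hz : η y z = 0) :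
    fderiv ℝ (expNeg w) y x * fderiv ℝ (expNegSpeed w p) y z
      = fderiv ℝ (expNeg w) y z * fderiv ℝ (expNegSpeed w p) y x := by
  have h1 := h.covForm_of_horizontal_apply hy h.smooth_horizontal_f
    (h.horizontal_f hdim) hx hz
  have h2 := h.covForm_of_horizontal_apply hy h.smooth_horizontal_f
    (h.horizontal_f hdim) hz hx
  rw [h.covForm_horizontal_f hy] at h1 h2
  rw [h.hess_comm hy h.smooth_f, h.hess_comm hy h.smooth_expNegSpeed, h.symm y hy z x] at h2
  linear_combination 1 / 2 * (h1 - h2)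

theorem fderiv_dir_f' {x : E} (hx : η y x = 0) :
    fderiv ℝ (dir ξ f) y x = -2 * dir ξ (expNeg w) y * fderiv ℝ (expNegSpeed w p) y x
      - 2 * expNeg w y * fderiv ℝ (dir ξ (expNegSpeed w p)) y x := by
  have h1 := h.covForm_of_horizontal_skew hy h.smooth_horizontal_f (h.horizontal_f hdim) hx
  have d1 := h.diffAt h.smooth_expNeg hy
  have d2 := h.diffAt (h.smooth_dir h.smooth_expNegSpeed) hy
  have h3 : fderiv ℝ (fun z => (fderiv ℝ f z + (2 * expNeg w z) •
      fderiv ℝ (expNegSpeed w p) z) (ξ z)) y x = fderiv ℝ (dir ξ f) y x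
        + (2 * fderiv ℝ (expNeg w) y x * dir ξ (expNegSpeed w p) y
          + 2 * expNeg w y * fderiv ℝ (dir ξ (expNegSpeed w p)) y x) := by
    change fderiv ℝ (fun z => dir ξ f z + (2 * expNeg w z) * dir ξ (expNegSpeed w p) z) y x = _
    rw [fderiv_fun_add (h.diffAt (h.smooth_dir h.smooth_f) hy) ((d1.const_mul 2).fun_mul d2),
      fderiv_fun_mul (d1.const_mul 2) d2, fderiv_const_mul d1]
    simp
    ring
  rw [h3, h.covForm_horizontal_f hy, h.covForm_horizontal_f hy, h.hess_comm hy h.smooth_f (ξ y),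
    h.hess_comm hy h.smooth_expNegSpeed (ξ y)] at h1
  simp only [dir] at h1 ⊢
  linear_combination h1

/-- Compares the two expressions for d(ξf) on H: `fderiv_dir_f`, from Codazzi, and `fderiv_dir_f'`,
from df = -2ω dχ. -/
theorem fderiv_dir_expNegSpeed {x : E} (hx : η y x = 0) :
    expNeg w y * fderiv ℝ (dir ξ (expNegSpeed w p)) y x
      = f y * fderiv ℝ (rate ξ w p) y x
        - 2 * expNegSpeed w p y * fderiv ℝ (expNegSpeed w p) y x
        - (dir ξ f y + f y * rate ξ w p y) / expNeg w y * fderiv ℝ (expNeg w) y x := by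
  have h1 : fderiv ℝ (dir ξ f) y x + 2 * (fderiv ℝ f y x * rate ξ w p y
        + f y * fderiv ℝ (rate ξ w p) y x)
      + 2 * fderiv ℝ w y x * (dir ξ f y + f y * rate ξ w p y)
      - dir ξ w y * fderiv ℝ f y x = 0 := h.fderiv_dir_f hy hdim hx
  have hpos := (expNeg_pos w y).ne'
  have h4 : dir ξ (expNeg w) y = -expNeg w y * dir ξ w y := by
    rw [dir, h.fderiv_expNeg hy, smul_apply, smul_eq_mul, dir]
  have h5 := h.dir_expNeg hy
  rw [h.fderiv_dir_f' hy hdim hx, h.fderiv_f hy hdim hx] at h1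
  rw [h.fderiv_expNeg hy, smul_apply, smul_eq_mul]
  field_simp
  rw [h4] at h1 h5
  linear_combination -(1 / 2) * h1 - 2 * fderiv ℝ (expNegSpeed w p) y x * h5

/-- Apply `hess_dir` to ω and substitute ξω = χ - ωl. The extra dl ⊗ dω + dω ⊗ dl there cancels the
cross terms of Hess(ωl). -/
theorem hess_rate : ∃ κ : ℝ, ∀ x z, η y x = 0 → η y z = 0 →
    covForm (christoffelL G) (fderiv ℝ (rate ξ w p)) y x z
      + fderiv ℝ w y x * fderiv ℝ (rate ξ w p) y z
      + fderiv ℝ w y z * fderiv ℝ (rate ξ w p) y x = κ * G y x z := by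
  obtain ⟨κ₁, hκ₁⟩ := h.hess_expNeg hy
  obtain ⟨κ₂, hκ₂⟩ := h.hess_expNegSpeed hy hdim
  obtain ⟨κ₃, hκ₃⟩ := h.hess_dir hy hdim h.smooth_expNeg (fun z hz => h.hess_expNeg hz)
  have hpos := (expNeg_pos w y).ne'
  refine ⟨(κ₂ - rate ξ w p y * κ₁ - κ₃) / expNeg w y, fun x z hx hz => ?_⟩
  have h1 := hκ₁ x z hx hz
  have h2 := hκ₂ x z hx hz
  have h3 : covForm (christoffelL G) (fderiv ℝ (dir ξ (expNeg w))) y x z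
        + fderiv ℝ w y x * fderiv ℝ (dir ξ (expNeg w)) y z
        + fderiv ℝ w y z * fderiv ℝ (dir ξ (expNeg w)) y x
        + fderiv ℝ (rate ξ w p) y x * fderiv ℝ (expNeg w) y z
        + fderiv ℝ (rate ξ w p) y z * fderiv ℝ (expNeg w) y x = κ₃ * G y x z := hκ₃ x z hx hz
  have d1 := h.diffAt h.smooth_expNeg hy
  have d2 := h.diffAt h.smooth_expNegSpeed hy
  have d3 := h.diffAt h.smooth_rate hy
  have d1' := h.diffAt (h.smooth_fderiv h.smooth_expNeg) hy
  have d2' := h.diffAt (h.smooth_fderiv h.smooth_expNegSpeed) hy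
  have d3' := h.diffAt (h.smooth_fderiv h.smooth_rate) hy
  have h4 : covForm (christoffelL G) (fderiv ℝ (dir ξ (expNeg w))) y x z
      = covForm (christoffelL G) (fderiv ℝ (expNegSpeed w p)) y x z
        - (fderiv ℝ (rate ξ w p) y x * fderiv ℝ (expNeg w) y z
          + rate ξ w p y * covForm (christoffelL G) (fderiv ℝ (expNeg w)) y x z
          + fderiv ℝ (expNeg w) y x * fderiv ℝ (rate ξ w p) y z
          + expNeg w y * covForm (christoffelL G) (fderiv ℝ (rate ξ w p)) y x z) := by
    have heq : ∀ z ∈ U, fderiv ℝ (dir ξ (expNeg w)) z = fderiv ℝ (expNegSpeed w p) z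
        + ((-rate ξ w p z) • fderiv ℝ (expNeg w) z
          + (-expNeg w z) • fderiv ℝ (rate ξ w p) z) := by
      intro z hz
      ext a
      rw [h.fderiv_dir_expNeg hz]
      simp
      ring
    rw [covForm_congr h.isOpen heq hy,
      covForm_add d2' ((d3.fun_neg.fun_smul d1').fun_add (d1.fun_neg.fun_smul d3')),
      covForm_add (d3.fun_neg.fun_smul d1') (d1.fun_neg.fun_smul d3'),
      covForm_smul d3.fun_neg d1', covForm_smul d1.fun_neg d3', fderiv_fun_neg, fderiv_fun_neg]
    simp
    ring
  rw [h4, h.fderiv_dir_expNeg hy, h.fderiv_dir_expNeg hy] at h3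
  field_simp
  linear_combination h2 - rate ξ w p y * h1 - h3

end VerticalSoliton

end Soliton

end AccR

namespace AccR

/-! ### Differentiating relations on H: the potential function is horizontally constant. -/

section Soliton

variable {E : Type*} [NormedAddCommGroup E] [NormedSpace ℝ E]

namespace VerticalSoliton

variable {G : E → E →L[ℝ] E →L[ℝ] ℝ} {ξ : E → E} {η : E → E →L[ℝ] ℝ}
  {w p f σ : E → ℝ} {U : Set E}

variable (h : VerticalSoliton G ξ η w p f σ U) [FiniteDimensional ℝ E]
  (hdim : 5 ≤ Module.finrank ℝ E)
include h

omit [FiniteDimensional ℝ E] in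
theorem covForm_sub_smul {A B s t : E → ℝ} (hA : ContDiffOn ℝ ∞ A U) (hB : ContDiffOn ℝ ∞ B U)
    (hs : ContDiffOn ℝ ∞ s U) (ht : ContDiffOn ℝ ∞ t U) {y : E} (hy : y ∈ U) (a b : E) :
    covForm (christoffelL G) (fun z => s z • fderiv ℝ A z + (-t z) • fderiv ℝ B z) y a b
      = fderiv ℝ s y a * fderiv ℝ A y b + s y * covForm (christoffelL G) (fderiv ℝ A) y a b
        - (fderiv ℝ t y a * fderiv ℝ B y b
          + t y * covForm (christoffelL G) (fderiv ℝ B) y a b) := by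
  have d1 := h.diffAt (h.smooth_fderiv hA) hy
  have d2 := h.diffAt (h.smooth_fderiv hB) hy
  have d3 := h.diffAt hs hy
  have d4 := h.diffAt ht hy
  rw [covForm_add (d3.fun_smul d1) (d4.fun_neg.fun_smul d2), covForm_smul d3 d1,
    covForm_smul d4.fun_neg d2, fderiv_fun_neg]
  simp
  ring

include hdim

/-- A relation `s dA = t dB` between horizontal differentials on an open set can be
differentiated. -/
theorem hess_of_smul_eq {A B s t : E → ℝ} (hA : ContDiffOn ℝ ∞ A U) (hB : ContDiffOn ℝ ∞ B U)
    (hs : ContDiffOn ℝ ∞ s U) (ht : ContDiffOn ℝ ∞ t U)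
    (hAB : ∀ y ∈ U, ∀ x, η y x = 0 → s y * fderiv ℝ A y x = t y * fderiv ℝ B y x)
    {y : E} (hy : y ∈ U) {κ₁ κ₂ : ℝ} {S T : E → E → ℝ}
    (hS : ∀ x z, η y x = 0 → η y z = 0 →
      covForm (christoffelL G) (fderiv ℝ A) y x z + S x z = κ₁ * G y x z)
    (hT : ∀ x z, η y x = 0 → η y z = 0 →
      covForm (christoffelL G) (fderiv ℝ B) y x z + T x z = κ₂ * G y x z)
    (c : E →L[ℝ] ℝ)
    (hc : ∀ x z, η y x = 0 → η y z = 0 → fderiv ℝ s y x * fderiv ℝ A y z - s y * S x z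
      - fderiv ℝ t y x * fderiv ℝ B y z + t y * T x z = c x * fderiv ℝ B y z)
    {x z : E} (hx : η y x = 0) (hz : η y z = 0) : c x * fderiv ℝ B y z = 0 := by
  have sν : ContDiffOn ℝ ∞ (fun z => s z • fderiv ℝ A z + (-t z) • fderiv ℝ B z) U :=
    (hs.smul (h.smooth_fderiv hA)).add (ht.neg.smul (h.smooth_fderiv hB))
  have h0 : ∀ y ∈ U, ∀ x, η y x = 0 →
      (fun z => s z • fderiv ℝ A z + (-t z) • fderiv ℝ B z) y x = 0 := by
    intro y hy x hx
    simp [hAB y hy x hx]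
  refine h.mul_eq_zero_of_horizontal hy hdim (A := c)
    (κ := (fun z => s z • fderiv ℝ A z + (-t z) • fderiv ℝ B z) y (ξ y)
      * (Real.exp (-(2 * w y)) * p y) - s y * κ₁ + t y * κ₂) (fun x z hx hz => ?_) hx hz
  have h1 := h.covForm_of_horizontal_apply hy sν h0 hx hz
  rw [h.covForm_sub_smul hA hB hs ht hy] at h1
  linear_combination h1 - s y * hS x z hx hz + t y * hT x z hx hz - hc x z hx hz

/-- There is no open set on which `ω = e^{-w}` is horizontally constant but `χ = -p e^{-w}` is
nowhere so. -/
theorem false_of_expNeg_const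
    (hw : ∀ y ∈ U, ∀ x, η y x = 0 → fderiv ℝ (expNeg w) y x = 0) {y : E} (hy : y ∈ U) {x : E}
    (hx : η y x = 0) (hne : fderiv ℝ (expNegSpeed w p) y x ≠ 0) : False := by
  have sω := h.smooth_expNeg
  have sχ := h.smooth_expNegSpeed
  have hl : ∀ y ∈ U, ∀ x, η y x = 0 →
      expNeg w y * fderiv ℝ (rate ξ w p) y x = fderiv ℝ (expNegSpeed w p) y x := by
    intro y hy x hx
    have h1 := h.fderiv_dir_eq_zero hy sω hw hx
    rw [h.fderiv_dir_expNeg hy, hw y hy x hx] at h1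
    linear_combination -h1
  have hχξ : ∀ y ∈ U, ∀ x, η y x = 0 →
      expNeg w y ^ 2 * fderiv ℝ (dir ξ (expNegSpeed w p)) y x
        = (f y - 2 * expNeg w y * expNegSpeed w p y) * fderiv ℝ (expNegSpeed w p) y x := by
    intro y hy x hx
    have h1 := h.fderiv_dir_expNegSpeed hy hdim hx
    rw [hw y hy x hx] at h1
    linear_combination expNeg w y * h1 + f y * hl y hy x hx
  have hw0 : ∀ x, η y x = 0 → fderiv ℝ w y x = 0 := by
    intro x hx
    have h1 := hw y hy x hx
    rw [h.fderiv_expNeg hy, smul_apply, smul_eq_mul] at h1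
    rcases mul_eq_zero.1 h1 with h2 | h2
    · exact absurd h2 (neg_ne_zero.2 (expNeg_pos w y).ne')
    · exact h2
  -- Differentiate ω² d(ξχ) = (f - 2ωχ) dχ. With dω = 0 and dl = dχ/ω on H, the dl terms of Hess(ξχ)
  -- give -2ω dχ ⊗ dχ and the derivative of f - 2ωχ gives 4ω dχ ⊗ dχ; the sum 2ω dχ ⊗ dχ must
  -- vanish.
  obtain ⟨κ₁, hκ₁⟩ := h.hess_dir hy hdim sχ (fun z hz => h.hess_expNegSpeed hz hdim)
  obtain ⟨κ₂, hκ₂⟩ := h.hess_expNegSpeed hy hdim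
  have hpos := (expNeg_pos w y).ne'
  have d1 := h.diffAt sω hy
  have d2 := h.diffAt sχ hy
  have key := h.hess_of_smul_eq hdim (A := dir ξ (expNegSpeed w p)) (B := expNegSpeed w p)
    (s := fun y => expNeg w y ^ 2) (t := fun y => f y - 2 * expNeg w y * expNegSpeed w p y)
    (h.smooth_dir sχ) sχ (sω.pow 2) (h.smooth_f.sub ((contDiffOn_const.mul sω).mul sχ)) hχξ hy
    (κ₁ := κ₁) (κ₂ := κ₂)
    (S := fun x z => fderiv ℝ (rate ξ w p) y x * fderiv ℝ (expNegSpeed w p) y z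
      + fderiv ℝ (rate ξ w p) y z * fderiv ℝ (expNegSpeed w p) y x) (T := fun _ _ => 0)
    (fun x z hx hz => by
      have := hκ₁ x z hx hz
      rw [hw0 x hx, hw0 z hz] at this
      change _ + _ + _ + fderiv ℝ (rate ξ w p) y x * _ + fderiv ℝ (rate ξ w p) y z * _ = _ at this
      linear_combination this)
    (fun x z hx hz => by
      have := hκ₂ x z hx hz
      rw [hw0 x hx, hw0 z hz] at this
      linear_combination this)
    ((2 * expNeg w y) • fderiv ℝ (expNegSpeed w p) y)
    (fun x z hx hz => by
      have e1 : fderiv ℝ (fun y => expNeg w y ^ 2) y x = 0 := by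
        rw [fderiv_fun_pow 2 d1]
        simp [hw y hy x hx]
      have e2 : fderiv ℝ (fun y => f y - 2 * expNeg w y * expNegSpeed w p y) y x
          = -4 * expNeg w y * fderiv ℝ (expNegSpeed w p) y x := by
        rw [fderiv_fun_sub (h.diffAt h.smooth_f hy) ((d1.const_mul 2).fun_mul d2),
          fderiv_fun_mul (d1.const_mul 2) d2, fderiv_const_mul d1]
        simp [hw y hy x hx, h.fderiv_f hy hdim hx]
        ring
      rw [e1, e2]
      simp only [smul_apply, smul_eq_mul]
      linear_combination (-expNeg w y * fderiv ℝ (expNegSpeed w p) y z) * hl y hy x hx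
        - expNeg w y * fderiv ℝ (expNegSpeed w p) y x * hl y hy z hz) hx hx
  simp only [smul_apply, smul_eq_mul] at key
  have : expNeg w y * (fderiv ℝ (expNegSpeed w p) y x * fderiv ℝ (expNegSpeed w p) y x) ≠ 0 :=
    mul_ne_zero hpos (mul_ne_zero hne hne)
  apply this
  linear_combination 1 / 2 * key

/-- If `dω = β dχ` horizontally on an open set where `dχ` is horizontally nonzero, then `β = 0`. -/
theorem ratio_eq_zero {β : E → ℝ} (hβ : ContDiffOn ℝ ∞ β U)
    (hne : ∀ y ∈ U, ∃ x, η y x = 0 ∧ fderiv ℝ (expNegSpeed w p) y x ≠ 0)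
    (hωβ : ∀ y ∈ U, ∀ x, η y x = 0 →
      fderiv ℝ (expNeg w) y x = β y * fderiv ℝ (expNegSpeed w p) y x) :
    ∀ y ∈ U, β y = 0 := by
  have sω := h.smooth_expNeg
  have sχ := h.smooth_expNegSpeed
  have sl := h.smooth_rate
  have sβ' := h.smooth_dir hβ
  have hβx : ∀ y ∈ U, ∀ x, η y x = 0 → fderiv ℝ β y x = 0 := by
    intro y hy x hx
    obtain ⟨z, hz, hz0⟩ := hne y hy
    obtain ⟨κ₁, hκ₁⟩ := h.hess_expNeg hy
    obtain ⟨κ₂, hκ₂⟩ := h.hess_expNegSpeed hy hdim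
    -- Since ω and χ satisfy the same Hessian condition, differentiating dω = β dχ leaves only dβ ⊗
    -- dχ.
    have key := h.hess_of_smul_eq hdim (s := fun _ => 1) (t := β) sω sχ contDiffOn_const hβ
      (fun y hy x hx => by rw [one_mul, hωβ y hy x hx]) hy
      (S := fun x z => fderiv ℝ w y x * fderiv ℝ (expNeg w) y z
        + fderiv ℝ w y z * fderiv ℝ (expNeg w) y x)
      (T := fun x z => fderiv ℝ w y x * fderiv ℝ (expNegSpeed w p) y z
        + fderiv ℝ w y z * fderiv ℝ (expNegSpeed w p) y x)
      (fun x z hx hz => by linear_combination hκ₁ x z hx hz)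
      (fun x z hx hz => by linear_combination hκ₂ x z hx hz) (-fderiv ℝ β y)
      (fun x z hx hz => by
        simp only [hωβ y hy x hx, hωβ y hy z hz, neg_apply]
        simp
        ring) hx hz
    rcases mul_eq_zero.1 key with h1 | h1
    · simpa using h1
    · exact absurd h1 hz0
  have hβξ : ∀ y ∈ U, ∀ x, η y x = 0 → fderiv ℝ (dir ξ β) y x = 0 := fun y hy x hx =>
    h.fderiv_dir_eq_zero hy hβ hβx hx
  -- Two expressions for d(ξω) on H: one by differentiating dω = β dχ along ξ, the other from ξω = χ
  -- - ωl.
  have hB : ∀ y ∈ U, ∀ x, η y x = 0 →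
      dir ξ β y * fderiv ℝ (expNegSpeed w p) y x
        + β y * fderiv ℝ (dir ξ (expNegSpeed w p)) y x
      = fderiv ℝ (expNegSpeed w p) y x - rate ξ w p y * fderiv ℝ (expNeg w) y x
        - expNeg w y * fderiv ℝ (rate ξ w p) y x := by
    intro y hy x hx
    have sν : ContDiffOn ℝ ∞ (fun z => (1 : ℝ) • fderiv ℝ (expNeg w) z
        + (-β z) • fderiv ℝ (expNegSpeed w p) z) U :=
      (ContDiffOn.smul (f := fun _ => (1 : ℝ)) contDiffOn_const (h.smooth_fderiv sω)).add
        (hβ.neg.smul (h.smooth_fderiv sχ))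
    have h0 : ∀ y ∈ U, ∀ x, η y x = 0 → (fun z => (1 : ℝ) • fderiv ℝ (expNeg w) z
        + (-β z) • fderiv ℝ (expNegSpeed w p) z) y x = 0 := by
      intro y hy x hx
      simp [hωβ y hy x hx]
    have h1 := h.covForm_of_horizontal_skew hy sν h0 hx
    have h3 : fderiv ℝ (fun z => ((1 : ℝ) • fderiv ℝ (expNeg w) z
        + (-β z) • fderiv ℝ (expNegSpeed w p) z) (ξ z)) y x
        = fderiv ℝ (dir ξ (expNeg w)) y x
          - β y * fderiv ℝ (dir ξ (expNegSpeed w p)) y x := by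
      change fderiv ℝ (fun z => (1 : ℝ) * dir ξ (expNeg w) z
        + (-β z) * dir ξ (expNegSpeed w p) z) y x = _
      have d1 := h.diffAt (h.smooth_dir sω) hy
      have d2 := h.diffAt hβ hy
      have d3 := h.diffAt (h.smooth_dir sχ) hy
      rw [fderiv_fun_add (d1.const_mul 1) (d2.fun_neg.fun_mul d3), fderiv_const_mul d1,
        fderiv_fun_mul d2.fun_neg d3, fderiv_fun_neg]
      simp [hβx y hy x hx]
      ring
    rw [h3, h.covForm_sub_smul sω sχ contDiffOn_const hβ hy,
      h.covForm_sub_smul sω sχ contDiffOn_const hβ hy, h.hess_comm hy sω (ξ y),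
      h.hess_comm hy sχ (ξ y), h.fderiv_dir_expNeg hy, hβx y hy x hx] at h1
    simp only [dir, fderiv_fun_const, Pi.zero_apply, zero_apply] at h1 ⊢
    linear_combination -h1
  set D : E → ℝ := fun y => (dir ξ f y + f y * rate ξ w p y) / expNeg w y with hD
  have sD : ContDiffOn ℝ ∞ D U :=
    ((h.smooth_dir h.smooth_f).add (h.smooth_f.mul sl)).div sω fun y _ => (expNeg_pos w y).ne'
  have hDx : ∀ y ∈ U, ∀ x, η y x = 0 →
      fderiv ℝ D y x = -fderiv ℝ (dir ξ (expNegSpeed w p)) y x := by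
    intro y hy x hx
    have d1 := h.diffAt sω hy
    have d2 := h.diffAt sD hy
    have d3 := h.diffAt (h.smooth_dir h.smooth_f) hy
    have d4 := h.diffAt h.smooth_f hy
    have d5 := h.diffAt sl hy
    have heq : ∀ z ∈ U, expNeg w z * D z = dir ξ f z + f z * rate ξ w p z := fun z _ => by
      rw [hD]
      field_simp [(expNeg_pos w z).ne']
    have h1 := congrArg (fun A => A x) (fderiv_eq_of_eqOn h.isOpen heq hy)
    rw [fderiv_fun_mul d1 d2, fderiv_fun_add d3 (d4.fun_mul d5), fderiv_fun_mul d4 d5] at h1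
    simp only [add_apply, smul_apply, smul_eq_mul] at h1
    have h2 := h.fderiv_dir_expNegSpeed hy hdim hx
    have h3 := h.dir_expNeg hy
    change _ = _ - _ - D y * _ at h2
    rw [h.fderiv_dir_f' hy hdim hx, h.fderiv_f hy hdim hx] at h1
    apply mul_left_cancel₀ (expNeg_pos w y).ne'
    linear_combination h1 - h2 - 2 * fderiv ℝ (expNegSpeed w p) y x * h3
  -- Y is the factor obtained on eliminating d(ξχ) between `hB` and `fderiv_dir_expNegSpeed`, so
  -- that dl is proportional to dχ on H.
  set Y : E → ℝ := fun y => expNeg w y * (1 - rate ξ w p y * β y - dir ξ β y)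
    + β y * (β y * D y + 2 * expNegSpeed w p y) with hY
  have sY : ContDiffOn ℝ ∞ Y U :=
    (sω.mul ((contDiffOn_const.sub (sl.mul hβ)).sub sβ')).add
      (hβ.mul ((hβ.mul sD).add (contDiffOn_const.mul sχ)))
  have hlY : ∀ y ∈ U, ∀ x, η y x = 0 →
      (expNeg w y ^ 2 + β y * f y) * fderiv ℝ (rate ξ w p) y x
        = Y y * fderiv ℝ (expNegSpeed w p) y x := by
    intro y hy x hx
    have h1 := hB y hy x hx
    have h2 := h.fderiv_dir_expNegSpeed hy hdim hx
    change _ = _ - _ - D y * _ at h2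
    rw [hωβ y hy x hx] at h1 h2
    rw [hY]
    linear_combination expNeg w y * h1 - β y * h2
  intro y hy
  obtain ⟨z, hz, hz0⟩ := hne y hy
  have hYx : ∀ x, η y x = 0 →
      fderiv ℝ Y y x = 2 * β y * fderiv ℝ (expNegSpeed w p) y x := by
    intro x hx
    have d1 := h.diffAt sω hy
    have d2 := h.diffAt sχ hy
    have d3 := h.diffAt sl hy
    have d4 := h.diffAt hβ hy
    have d5 := h.diffAt sβ' hy
    have d6 := h.diffAt sD hy
    have d7 : DifferentiableAt ℝ (fun y => 1 - rate ξ w p y * β y - dir ξ β y) y :=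
      ((differentiableAt_const 1).fun_sub (d3.fun_mul d4)).fun_sub d5
    have d8 : DifferentiableAt ℝ (fun y => β y * D y + 2 * expNegSpeed w p y) y :=
      (d4.fun_mul d6).fun_add (d2.const_mul 2)
    rw [hY, fderiv_fun_add (d1.fun_mul d7) (d4.fun_mul d8), fderiv_fun_mul d1 d7,
      fderiv_fun_mul d4 d8, fderiv_fun_sub ((differentiableAt_const 1).fun_sub (d3.fun_mul d4)) d5,
      fderiv_fun_sub (differentiableAt_const 1) (d3.fun_mul d4), fderiv_fun_mul d3 d4,
      fderiv_fun_add (d4.fun_mul d6) (d2.const_mul 2), fderiv_fun_mul d4 d6, fderiv_const_mul d2]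
    simp only [add_apply, sub_apply, smul_apply, smul_eq_mul, hβx y hy x hx, hβξ y hy x hx,
      hDx y hy x hx, fderiv_fun_const, Pi.zero_apply, zero_apply]
    have h1 := hB y hy x hx
    rw [hωβ y hy x hx] at h1 ⊢
    linear_combination (-β y) * h1
  obtain ⟨κ₁, hκ₁⟩ := h.hess_rate hy hdim
  obtain ⟨κ₂, hκ₂⟩ := h.hess_expNegSpeed hy hdim
  have sm : ContDiffOn ℝ ∞ (fun y => expNeg w y ^ 2 + β y * f y) U :=
    (sω.pow 2).add (hβ.mul h.smooth_f)
  -- Differentiate (ω² + βf) dl = Y dχ. On H the left factor is constant, because 2ω dω = 2ωβ dχ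
  -- cancels β df = -2ωβ dχ, and dY = 2β dχ; what is left is -2β dχ ⊗ dχ.
  have key := h.hess_of_smul_eq hdim sl sχ sm sY hlY hy
    (S := fun x z => fderiv ℝ w y x * fderiv ℝ (rate ξ w p) y z
      + fderiv ℝ w y z * fderiv ℝ (rate ξ w p) y x)
    (T := fun x z => fderiv ℝ w y x * fderiv ℝ (expNegSpeed w p) y z
      + fderiv ℝ w y z * fderiv ℝ (expNegSpeed w p) y x)
    (fun x z hx hz => by linear_combination hκ₁ x z hx hz)
    (fun x z hx hz => by linear_combination hκ₂ x z hx hz)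
    ((-(2 * β y)) • fderiv ℝ (expNegSpeed w p) y)
    (fun x z hx hz => by
      have d1 := h.diffAt sω hy
      have d4 := h.diffAt hβ hy
      have d5 := h.diffAt h.smooth_f hy
      have e1 : fderiv ℝ (fun y => expNeg w y ^ 2 + β y * f y) y x = 0 := by
        rw [fderiv_fun_add (d1.fun_pow 2) (d4.fun_mul d5), fderiv_fun_pow 2 d1,
          fderiv_fun_mul d4 d5]
        simp [hβx y hy x hx, h.fderiv_f hy hdim hx, hωβ y hy x hx]
        ring
      rw [e1, hYx x hx]
      simp only [smul_apply, smul_eq_mul]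
      linear_combination (-fderiv ℝ w y x) * hlY y hy z hz - fderiv ℝ w y z * hlY y hy x hx)
      hz hz
  simp only [smul_apply, smul_eq_mul] at key
  have h0 : β y * (fderiv ℝ (expNegSpeed w p) y z * fderiv ℝ (expNegSpeed w p) y z) = 0 := by
    linear_combination -(1 / 2) * key
  exact (mul_eq_zero.1 h0).resolve_right (mul_ne_zero hz0 hz0)

/-- The potential function of a vertical almost Riemann soliton is horizontally constant. -/
theorem fderiv_f_eq_zero {y : E} (hy : y ∈ U) {x : E} (hx : η y x = 0) : fderiv ℝ f y x = 0 := by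
  rw [h.fderiv_f hy hdim hx]
  by_contra hcon
  have hne : fderiv ℝ (expNegSpeed w p) y x ≠ 0 := fun h0 => hcon (by rw [h0, mul_zero])
  have sω := h.smooth_expNeg
  have sχ := h.smooth_expNegSpeed
  -- The horizontal projection of x gives an open set on which dχ(X) ≠ 0; there β = dω(X)/dχ(X) is
  -- smooth, and dω ∧ dχ = 0 makes it the ratio on all of H.
  let X : E → E := fun z => x - η z x • ξ z
  have sX : ContDiffOn ℝ ∞ X U := contDiffOn_const.sub
    ((h.smooth_η.clm_apply contDiffOn_const).smul h.smooth_ξ)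
  have hX : ∀ z ∈ U, η z (X z) = 0 := fun z hz => by simp [X, h.η_ξ z hz]
  let q : E → ℝ := fun z => fderiv ℝ (expNegSpeed w p) z (X z)
  have sq : ContDiffOn ℝ ∞ q U := (h.smooth_fderiv sχ).clm_apply sX
  let V : Set E := U ∩ q ⁻¹' {0}ᶜ
  have hV : IsOpen V := sq.continuousOn.isOpen_inter_preimage h.isOpen isOpen_compl_singleton
  have hyV : y ∈ V := ⟨hy, by simp [q, X, hx, hne]⟩
  have hVU : V ⊆ U := Set.inter_subset_left
  have hV' := h.restrict hV hVU
  let β : E → ℝ := fun z => fderiv ℝ (expNeg w) z (X z) / q z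
  have sβ : ContDiffOn ℝ ∞ β V :=
    (((h.smooth_fderiv sω).clm_apply sX).mono hVU).div (sq.mono hVU) fun z hz => hz.2
  have hωβ : ∀ z ∈ V, ∀ x, η z x = 0 →
      fderiv ℝ (expNeg w) z x = β z * fderiv ℝ (expNegSpeed w p) z x := by
    intro z hz x' hx'
    have hq : q z ≠ 0 := hz.2
    have h1 := h.fderiv_expNeg_wedge hz.1 hdim hx' (hX z hz.1)
    change _ * q z = _ at h1
    rw [div_mul_eq_mul_div, eq_div_iff hq, h1]
  have hβ0 := hV'.ratio_eq_zero hdim sβ (fun z hz => ⟨X z, hX z hz.1, hz.2⟩) hωβ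
  exact hV'.false_of_expNeg_const hdim
    (fun z hz x' hx' => by rw [hωβ z hz x' hx', hβ0 z hz, zero_mul]) hyV hx hne

end VerticalSoliton

end Soliton

end AccR

namespace AccR

/-! ### Cosymplectic structures and their contact conformal transforms in coordinates. -/

section Cosymplectic

variable {E : Type*} [NormedAddCommGroup E] [NormedSpace ℝ E]

/-- A cosymplectic almost contact B-metric structure on an open subset of a vector space. -/
structure CosymplecticOn (g : E → E →L[ℝ] E →L[ℝ] ℝ) (Φ : E → E →L[ℝ] E) (ξ : E → E)
    (η : E → E →L[ℝ] ℝ) (U : Set E) : Prop extends IsMetricOn g U where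
  smooth_Φ : ContDiffOn ℝ ∞ Φ U
  smooth_ξ : ContDiffOn ℝ ∞ ξ U
  smooth_η : ContDiffOn ℝ ∞ η U
  Φ_ξ : ∀ y ∈ U, Φ y (ξ y) = 0
  Φ_Φ : ∀ y ∈ U, ∀ a, Φ y (Φ y a) = -a + η y a • ξ y
  η_Φ : ∀ y ∈ U, ∀ a, η y (Φ y a) = 0
  η_ξ : ∀ y ∈ U, η y (ξ y) = 1
  g_Φ_Φ : ∀ y ∈ U, ∀ a b, g y (Φ y a) (Φ y b) = -g y a b + η y a * η y b
  parallel : ∀ y ∈ U, ∀ a b, covDerivEnd g Φ y a b = 0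

/-- The metric of the contact conformal transform. -/
def IsTransformOn (g : E → E →L[ℝ] E →L[ℝ] ℝ) (Φ : E → E →L[ℝ] E) (η : E → E →L[ℝ] ℝ)
    (u v w : E → ℝ) (G : E → E →L[ℝ] E →L[ℝ] ℝ) (U : Set E) : Prop :=
  ∀ y ∈ U, ∀ a b, G y a b = Real.exp (2 * u y) * Real.cos (2 * v y) * g y a b
    + Real.exp (2 * u y) * Real.sin (2 * v y) * g y a (Φ y b)
    + (Real.exp (2 * w y) - Real.exp (2 * u y) * Real.cos (2 * v y)) * (η y a * η y b)

namespace CosymplecticOn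

variable {g : E → E →L[ℝ] E →L[ℝ] ℝ} {Φ : E → E →L[ℝ] E} {ξ : E → E}
    {η : E → E →L[ℝ] ℝ} {U : Set E} (h : CosymplecticOn g Φ ξ η U) {y : E} (hy : y ∈ U)
include h

theorem diffAt {F : Type*} [NormedAddCommGroup F] [NormedSpace ℝ F] {s : E → F}
    (hs : ContDiffOn ℝ ∞ s U) {y : E} (hy : y ∈ U) : DifferentiableAt ℝ s y :=
  differentiableAt_of_contDiffOn h.isOpen hs hy

include hy

theorem g_ξ (a : E) : g y (ξ y) a = η y a := by
  have h1 := h.g_Φ_Φ y hy a (ξ y)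
  rw [h.Φ_ξ y hy, h.η_ξ y hy, map_zero] at h1
  rw [h.symm y hy]
  linarith

theorem g_Φ_comm (a b : E) : g y (Φ y a) b = g y a (Φ y b) := by
  have h1 := h.g_Φ_Φ y hy a (Φ y b)
  rw [h.Φ_Φ y hy, h.η_Φ y hy, map_add, map_neg, map_smul, h.symm y hy _ (ξ y), h.g_ξ hy,
    h.η_Φ y hy] at h1
  simp only [smul_eq_mul, mul_zero] at h1
  linarith

/-- This is ∇ξ = 0. Differentiating φξ = 0 puts ∇ξ in the kernel of φ, g(ξ, ξ) = 1 kills its η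
component, and φ² = -id + η ⊗ ξ finishes. -/
theorem fderiv_ξ (a : E) : fderiv ℝ ξ y a = -christoffelL g y a (ξ y) := by
  have dg := h.diffAt h.smooth hy
  have dξ := h.diffAt h.smooth_ξ hy
  have dΦ := h.diffAt h.smooth_Φ hy
  have h1 := h.parallel y hy a (ξ y)
  rw [covDerivEnd, h.Φ_ξ y hy, ← christoffelL_apply, ← christoffelL_apply, map_zero,
    add_zero] at h1
  have h2 : fderiv ℝ Φ y a (ξ y) + Φ y (fderiv ℝ ξ y a) = 0 := by
    have hl : fderiv ℝ (fun z => Φ z (ξ z)) y a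
        = fderiv ℝ Φ y a (ξ y) + Φ y (fderiv ℝ ξ y a) := by
      rw [fderiv_clm_apply dΦ dξ]
      simp [add_comm]
    rw [← hl, fderiv_eq_of_eqOn h.isOpen (fun z hz => h.Φ_ξ z hz) hy]
    simp
  have h3 : η y (fderiv ℝ ξ y a + christoffelL g y a (ξ y)) = 0 := by
    have hl : fderiv ℝ (fun z => g z (ξ z) (ξ z)) y a = fderiv ℝ g y a (ξ y) (ξ y)
        + g y (fderiv ℝ ξ y a) (ξ y) + g y (ξ y) (fderiv ℝ ξ y a) := by
      rw [fderiv_clm_apply (dg.clm_apply dξ) dξ, fderiv_clm_apply dg dξ]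
      simp
      ring
    rw [fderiv_eq_of_eqOn h.isOpen (fun z hz => (h.g_ξ hz (ξ z)).trans (h.η_ξ z hz)) hy,
      h.fderiv_metric hy, h.symm y hy _ (ξ y), h.symm y hy _ (ξ y), h.g_ξ hy, h.g_ξ hy] at hl
    simp only [fderiv_fun_const, Pi.zero_apply, zero_apply] at hl
    rw [map_add]
    linarith
  have h4 : Φ y (fderiv ℝ ξ y a + christoffelL g y a (ξ y)) = 0 := by
    rw [map_add, eq_neg_of_add_eq_zero_right h2, ← sub_eq_zero.1 h1]
    simp
  have h5 := h.Φ_Φ y hy (fderiv ℝ ξ y a + christoffelL g y a (ξ y))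
  rw [h4, h3, map_zero, zero_smul, add_zero] at h5
  exact eq_neg_of_add_eq_zero_left (neg_eq_zero.1 h5.symm)

theorem fderiv_η (a b : E) : fderiv ℝ η y a b = η y (christoffelL g y a b) := by
  have dg := h.diffAt h.smooth hy
  have dξ := h.diffAt h.smooth_ξ hy
  have dη := h.diffAt h.smooth_η hy
  have hl : fderiv ℝ (fun z => g z (ξ z) b) y a
      = fderiv ℝ g y a (ξ y) b + g y (fderiv ℝ ξ y a) b := by
    rw [fderiv_clm_apply (dg.clm_apply dξ) (differentiableAt_const b), fderiv_clm_apply dg dξ]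
    simp [add_comm]
  rw [← fderiv_apply₁ dη, ← fderiv_eq_of_eqOn h.isOpen (fun z hz => h.g_ξ hz b) hy, hl,
    h.fderiv_metric hy, h.fderiv_ξ hy, ← h.g_ξ hy]
  simp

theorem closed_η (a b : E) : fderiv ℝ η y a b = fderiv ℝ η y b a := by
  rw [h.fderiv_η hy, h.fderiv_η hy, h.christoffelL_comm hy]

theorem lieDeriv_g (a b : E) :
    fderiv ℝ g y (ξ y) a b + g y (fderiv ℝ ξ y a) b + g y a (fderiv ℝ ξ y b) = 0 := by
  rw [h.fderiv_metric hy, h.fderiv_ξ hy, h.fderiv_ξ hy, h.christoffelL_comm hy (ξ y) a,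
    h.christoffelL_comm hy (ξ y) b]
  simp

theorem lieDeriv_η (a : E) : fderiv ℝ η y (ξ y) a + η y (fderiv ℝ ξ y a) = 0 := by
  rw [h.fderiv_η hy, h.fderiv_ξ hy, h.christoffelL_comm hy (ξ y) a]
  simp

/-- Both φ and ξ are parallel, so the flow of ξ preserves g(·, φ·). -/
theorem lieDeriv_gΦ (a b : E) :
    fderiv ℝ (fun z => g z a (Φ z b)) y (ξ y) + g y (fderiv ℝ ξ y a) (Φ y b)
      + g y a (Φ y (fderiv ℝ ξ y b)) = 0 := by
  have dg := h.diffAt h.smooth hy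
  have dΦ := h.diffAt h.smooth_Φ hy
  have h1 := h.parallel y hy (ξ y) b
  rw [covDerivEnd, ← christoffelL_apply, ← christoffelL_apply] at h1
  rw [fderiv_clm_apply (dg.clm_apply (differentiableAt_const a))
    (dΦ.clm_apply (differentiableAt_const b))]
  have h2 : g y a (fderiv ℝ Φ y (ξ y) b) = -g y a (christoffelL g y (ξ y) (Φ y b))
      + g y a (Φ y (christoffelL g y (ξ y) b)) := by
    have := congrArg (g y a) h1
    simp only [map_add, map_sub, map_zero] at this
    linarith
  simp only [add_apply, ContinuousLinearMap.comp_apply, ContinuousLinearMap.flip_apply,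
    fderiv_apply₁ dΦ, fderiv_apply₁ dg, h2]
  rw [h.fderiv_metric hy, h.fderiv_ξ hy, h.fderiv_ξ hy, h.christoffelL_comm hy (ξ y) a,
    h.christoffelL_comm hy (ξ y) b]
  simp
  ring

variable {u v w : E → ℝ} (hu : ContDiffOn ℝ ∞ u U) (hv : ContDiffOn ℝ ∞ v U)
  (hw : ContDiffOn ℝ ∞ w U) {G : E → E →L[ℝ] E →L[ℝ] ℝ} (hG : IsTransformOn g Φ η u v w G U)
include hG

theorem transform_ξ (a : E) : G y (ξ y) a = Real.exp (2 * w y) * η y a := by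
  rw [hG y hy, h.g_ξ hy, h.g_ξ hy, h.η_Φ y hy, h.η_ξ y hy]
  ring

theorem transform_symm (a b : E) : G y a b = G y b a := by
  rw [hG y hy, hG y hy, h.symm y hy a b, ← h.g_Φ_comm hy, h.symm y hy (Φ y a) b]
  ring

theorem transform_Φ (a b : E) : G y a (Φ y b)
    = Real.exp (2 * u y) * Real.cos (2 * v y) * g y a (Φ y b)
      - Real.exp (2 * u y) * Real.sin (2 * v y) * (g y a b - η y a * η y b) := by
  rw [hG y hy, h.Φ_Φ y hy, h.η_Φ y hy, map_add, map_neg, map_smul, h.symm y hy a (ξ y),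
    h.g_ξ hy, smul_eq_mul]
  ring

theorem transform_nondeg (a : E) (ha : ∀ b, G y a b = 0) : a = 0 := by
  set A := Real.exp (2 * u y) * Real.cos (2 * v y) with hA
  set B := Real.exp (2 * u y) * Real.sin (2 * v y) with hB
  have hAB : A ^ 2 + B ^ 2 ≠ 0 := by
    have : A ^ 2 + B ^ 2 = Real.exp (2 * u y) ^ 2 := by
      rw [hA, hB]
      linear_combination Real.exp (2 * u y) ^ 2 * Real.sin_sq_add_cos_sq (2 * v y)
    rw [this]
    positivity
  have h1 : η y a = 0 := by
    have := ha (ξ y)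
    rw [h.transform_symm hy hG, h.transform_ξ hy hG] at this
    exact (mul_eq_zero.1 this).resolve_left (Real.exp_ne_zero _)
  have h2 : A • a + B • Φ y a = 0 := by
    apply h.eq_of_forall hy
    intro b
    have := ha b
    rw [hG y hy, h1, ← h.g_Φ_comm hy] at this
    simp only [map_add, map_smul, add_apply, smul_apply, smul_eq_mul, map_zero, zero_apply]
    linarith
  have h3 := congrArg (Φ y) h2
  simp only [map_add, map_smul, h.Φ_Φ y hy, h1, zero_smul, add_zero, map_zero, smul_neg] at h3
  -- On H, φ acts as a complex structure, so A + Bφ is inverted by multiplying with A - Bφ.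
  have h4 : (A ^ 2 + B ^ 2) • a = 0 := by
    have : (A ^ 2 + B ^ 2) • a = A • (A • a + B • Φ y a) - B • (A • Φ y a + -(B • a)) := by
      module
    rw [this, h2, h3]
    simp
  exact (smul_eq_zero.1 h4).resolve_left hAB

omit hy
include hu hv hw

theorem transform_isMetricOn [FiniteDimensional ℝ E] : IsMetricOn G U where
  isOpen := h.isOpen
  smooth := by
    have sA : ContDiffOn ℝ ∞ (fun y => Real.exp (2 * u y) * Real.cos (2 * v y)) U :=
      (contDiffOn_const.mul hu).exp.mul (contDiffOn_const.mul hv).cos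
    have sB : ContDiffOn ℝ ∞ (fun y => Real.exp (2 * u y) * Real.sin (2 * v y)) U :=
      (contDiffOn_const.mul hu).exp.mul (contDiffOn_const.mul hv).sin
    have sC : ContDiffOn ℝ ∞ (fun y => Real.exp (2 * w y)) U := (contDiffOn_const.mul hw).exp
    have sgΦ : ContDiffOn ℝ ∞ (fun y =>
        ((ContinuousLinearMap.compL ℝ E E ℝ).flip (Φ y)) ∘L (g y)) U :=
      ContDiffOn.clm_comp (contDiffOn_const.clm_apply h.smooth_Φ) h.smooth
    refine (((sA.smul h.smooth).add (sB.smul sgΦ)).add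
      ((sC.sub sA).smul (contDiffOn_tmul h.smooth_η h.smooth_η))).congr fun y hy => ?_
    ext a b
    rw [hG y hy]
    simp
  symm := fun y hy => h.transform_symm hy hG
  inv := fun y hy => isInvertible_of_nondeg _ (h.transform_nondeg hy hG)

include hy

/-- The tensors g, g(·, φ·) and η ⊗ η are invariant under ξ, so only the coefficients are
differentiated; varying the angle 2v produces the G(·, φ·) term through `transform_Φ`. -/
theorem lieDeriv_transform [FiniteDimensional ℝ E] (a b : E) :
    lieDeriv ξ G y a b = 2 * dir ξ u y * G y a b + 2 * dir ξ v y * G y a (Φ y b)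
      + 2 * (dir ξ w y - dir ξ u y) * Real.exp (2 * w y) * (η y a * η y b) := by
  have hm := h.transform_isMetricOn hu hv hw hG
  have du := h.diffAt hu hy
  have dv := h.diffAt hv hy
  have dw := h.diffAt hw hy
  have dη := h.diffAt h.smooth_η hy
  have dG := h.diffAt hm.smooth hy
  have dg := h.diffAt h.smooth hy
  have dΦ := h.diffAt h.smooth_Φ hy
  have dgab : DifferentiableAt ℝ (fun z => g z a b) y :=
    (dg.clm_apply (differentiableAt_const a)).clm_apply (differentiableAt_const b)
  have dgΦ : DifferentiableAt ℝ (fun z => g z a (Φ z b)) y :=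
    (dg.clm_apply (differentiableAt_const a)).clm_apply (dΦ.clm_apply (differentiableAt_const b))
  have dηa : ∀ a, DifferentiableAt ℝ (fun z => η z a) y := fun a =>
    dη.clm_apply (differentiableAt_const a)
  have deu := (du.const_mul 2).exp
  have dew := (dw.const_mul 2).exp
  have dc := (dv.const_mul 2).cos
  have ds := (dv.const_mul 2).sin
  have hd : fderiv ℝ G y (ξ y) a b
      = (Real.exp (2 * u y) * (2 * dir ξ u y) * Real.cos (2 * v y)
          - Real.exp (2 * u y) * (Real.sin (2 * v y) * (2 * dir ξ v y))) * g y a b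
        + Real.exp (2 * u y) * Real.cos (2 * v y) * fderiv ℝ g y (ξ y) a b
        + (Real.exp (2 * u y) * (2 * dir ξ u y) * Real.sin (2 * v y)
          + Real.exp (2 * u y) * (Real.cos (2 * v y) * (2 * dir ξ v y))) * g y a (Φ y b)
        + Real.exp (2 * u y) * Real.sin (2 * v y) * fderiv ℝ (fun z => g z a (Φ z b)) y (ξ y)
        + (Real.exp (2 * w y) * (2 * dir ξ w y)
            - (Real.exp (2 * u y) * (2 * dir ξ u y) * Real.cos (2 * v y)
          - Real.exp (2 * u y) * (Real.sin (2 * v y) * (2 * dir ξ v y)))) * (η y a * η y b)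
        + (Real.exp (2 * w y) - Real.exp (2 * u y) * Real.cos (2 * v y))
          * (fderiv ℝ η y (ξ y) a * η y b + η y a * fderiv ℝ η y (ξ y) b) := by
    rw [← fderiv_apply₂ dG, fderiv_eq_of_eqOn h.isOpen (fun z hz => hG z hz a b) hy,
      fderiv_fun_add (((deu.fun_mul dc).fun_mul dgab).fun_add ((deu.fun_mul ds).fun_mul dgΦ))
        ((dew.fun_sub (deu.fun_mul dc)).fun_mul ((dηa a).fun_mul (dηa b))),
      fderiv_fun_add ((deu.fun_mul dc).fun_mul dgab) ((deu.fun_mul ds).fun_mul dgΦ),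
      fderiv_fun_mul (deu.fun_mul dc) dgab, fderiv_fun_mul (deu.fun_mul ds) dgΦ,
      fderiv_fun_mul (dew.fun_sub (deu.fun_mul dc)) ((dηa a).fun_mul (dηa b)),
      fderiv_fun_mul (dηa a) (dηa b), fderiv_fun_sub dew (deu.fun_mul dc),
      fderiv_fun_mul deu dc, fderiv_fun_mul deu ds, fderiv_exp (du.const_mul 2),
      fderiv_exp (dw.const_mul 2), fderiv_cos (dv.const_mul 2), fderiv_sin (dv.const_mul 2),
      fderiv_const_mul du, fderiv_const_mul dv, fderiv_const_mul dw]
    simp only [add_apply, sub_apply, smul_apply, smul_eq_mul, fderiv_apply₁ dη, fderiv_apply₂ dg,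
      dir]
    ring
  have h1 := h.lieDeriv_g hy a b
  have h2 := h.lieDeriv_gΦ hy a b
  have h3 := h.lieDeriv_η hy a
  have h4 := h.lieDeriv_η hy b
  rw [lieDeriv, hd, h.transform_Φ hy hG, hG y hy, hG y hy, hG y hy]
  linear_combination Real.exp (2 * u y) * Real.cos (2 * v y) * h1
    + Real.exp (2 * u y) * Real.sin (2 * v y) * h2
    + (Real.exp (2 * w y) - Real.exp (2 * u y) * Real.cos (2 * v y)) * (η y b * h3 + η y a * h4)

theorem lieDeriv_transform_smul [FiniteDimensional ℝ E] {f : E → ℝ} (hf : ContDiffOn ℝ ∞ f U)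
    (a b : E) : lieDeriv (fun z => f z • ξ z) G y a b
      = 2 * dir ξ u y * f y * G y a b + 2 * dir ξ v y * f y * G y a (Φ y b)
      + Real.exp (2 * w y) * (fderiv ℝ f y a * η y b + η y a * fderiv ℝ f y b
        + 2 * f y * (dir ξ w y - dir ξ u y) * (η y a * η y b)) := by
  have h1 := h.lieDeriv_transform hy hu hv hw hG a b
  rw [lieDeriv] at h1 ⊢
  rw [fderiv_fun_smul (h.diffAt hf hy) (h.diffAt h.smooth_ξ hy)]
  simp only [add_apply, smul_apply, map_add, map_smul, smul_eq_mul,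
    ContinuousLinearMap.smulRight_apply, h.transform_ξ hy hG,
    h.transform_symm hy hG a (ξ y)]
  linear_combination f y * h1

end CosymplecticOn

end Cosymplectic

/-- The Ricci tensor of a metric whose curvature tensor is a Kulkarni-Nomizu product with the
metric. -/
theorem ricci_of_kulkarniNomizu {m : ℕ} {U : Set (EuclideanSpace ℝ (Fin m))}
    {G : EuclideanSpace ℝ (Fin m) →
      EuclideanSpace ℝ (Fin m) →L[ℝ] EuclideanSpace ℝ (Fin m) →L[ℝ] ℝ}
    (h : IsMetricOn G U) {y : EuclideanSpace ℝ (Fin m)} (hy : y ∈ U)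
    (B : EuclideanSpace ℝ (Fin m) →L[ℝ] EuclideanSpace ℝ (Fin m) →L[ℝ] ℝ)
    (hR : ∀ a b c d, curv G y a b c d
      = kulkarniNomizu (fun a b => G y a b) (fun a b => B a b) a b c d)
    (b c : EuclideanSpace ℝ (Fin m)) :
    ricci G y b c = (∑ i, (G y).inverse (B (EuclideanSpace.single i 1)) i) * G y b c
      + (m - 2) * B b c := by
  have hop : ∀ a, curvOp G y a b c = G y b c • (G y).inverse (B a)
      - G y a c • (G y).inverse (B b) + B b c • a - B a c • b := by
    intro a
    apply h.eq_of_forall hy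
    intro d
    have := hR a b c d
    rw [curv] at this
    rw [this]
    simp only [kulkarniNomizu, map_add, map_sub, map_smul, add_apply, sub_apply, smul_apply,
      smul_eq_mul, h.apply_inverse hy]
  have htr : ∀ (ν : EuclideanSpace ℝ (Fin m) →L[ℝ] ℝ) (a : EuclideanSpace ℝ (Fin m)),
      ∑ i, ν (EuclideanSpace.single i 1) * a i = ν a := by
    intro ν a
    conv_rhs => rw [← (EuclideanSpace.basisFun (Fin m) ℝ).sum_repr a]
    simp [mul_comm]
  have e1 := htr ((G y).flip c) ((G y).inverse (B b))
  have e2 := htr (B.flip c) b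
  simp only [ContinuousLinearMap.flip_apply] at e1 e2
  rw [h.apply_inverse hy] at e1
  simp only [ricci, hop, PiLp.add_apply, PiLp.sub_apply, PiLp.smul_apply, smul_eq_mul,
    Finset.sum_add_distrib, Finset.sum_sub_distrib, ← Finset.mul_sum, e1, e2]
  simp
  ring

end AccR

namespace AccR

/-! ### The Ricci tensor of the transformed soliton. -/

section TransformSoliton

variable {n : ℕ}

/-- A contact conformal transform `G` of a cosymplectic structure on an open subset of the model
space, for which `f ξ` is the potential of an almost Riemann soliton. -/
structure TransformSoliton (g : Model n → Model n →L[ℝ] Model n →L[ℝ] ℝ)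
    (Φ : Model n → Model n →L[ℝ] Model n) (ξ : Model n → Model n)
    (η : Model n → Model n →L[ℝ] ℝ) (u v w f σ : Model n → ℝ)
    (G : Model n → Model n →L[ℝ] Model n →L[ℝ] ℝ) (U : Set (Model n)) : Prop
    extends CosymplecticOn g Φ ξ η U where
  smooth_u : ContDiffOn ℝ ∞ u U
  smooth_v : ContDiffOn ℝ ∞ v U
  smooth_w : ContDiffOn ℝ ∞ w U
  smooth_f : ContDiffOn ℝ ∞ f U
  smooth_σ : ContDiffOn ℝ ∞ σ U
  transform : IsTransformOn g Φ η u v w G U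
  soliton : ∀ y ∈ U, ∀ a b c d, 2 * curv G y a b c d
    + σ y * kulkarniNomizu (fun a b => G y a b) (fun a b => G y a b) a b c d
    + kulkarniNomizu (fun a b => G y a b)
        (fun a b => lieDeriv (fun z => f z • ξ z) G y a b) a b c d = 0

namespace TransformSoliton

variable {g : Model n → Model n →L[ℝ] Model n →L[ℝ] ℝ}
  {Φ : Model n → Model n →L[ℝ] Model n} {ξ : Model n → Model n}
  {η : Model n → Model n →L[ℝ] ℝ} {u v w f σ : Model n → ℝ}
  {G : Model n → Model n →L[ℝ] Model n →L[ℝ] ℝ} {U : Set (Model n)}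
  (h : TransformSoliton g Φ ξ η u v w f σ G U) {y : Model n} (hy : y ∈ U)
include h

theorem isMetricOn : IsMetricOn G U :=
  h.transform_isMetricOn h.smooth_u h.smooth_v h.smooth_w h.transform

include hy

theorem metric_ξ (a : Model n) : G y (ξ y) a = Real.exp (2 * w y) * η y a :=
  h.transform_ξ hy h.transform a

theorem metric_ξ' (a : Model n) : G y a (ξ y) = Real.exp (2 * w y) * η y a := by
  rw [h.isMetricOn.symm y hy, h.metric_ξ hy]

theorem exists_horizontal (hn : 1 ≤ n) : ∃ x z, η y x = 0 ∧ η y z = 0 ∧ G y x z ≠ 0 := by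
  obtain ⟨z, hz0, hz, -⟩ := VerticalSoliton.exists_ne_zero_of_ker (E := Model n)
    (by rw [finrank_euclideanSpace_fin]; omega) (η y) (η y)
  by_contra! hcon
  apply hz0
  apply h.transform_nondeg hy h.transform
  intro b
  have h1 := hcon (b - η y b • ξ y) z (by simp [h.η_ξ y hy]) hz
  simp only [map_sub, map_smul, sub_apply, smul_apply, h.metric_ξ hy, hz, smul_eq_mul, mul_zero,
    sub_zero] at h1
  rw [h.isMetricOn.symm y hy, h1]

/-- The tensor `B` with curvature `G ∧ B`. -/
theorem curv_eq (a b c d : Model n) : curv G y a b c d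
    = kulkarniNomizu (fun a b => G y a b) (fun a b =>
      -(1 / 2) * (σ y + 2 * dir ξ u y * f y) * G y a b - dir ξ v y * f y * G y a (Φ y b)
      - (1 / 2) * Real.exp (2 * w y) * (fderiv ℝ f y a * η y b + η y a * fderiv ℝ f y b
        + 2 * f y * (dir ξ w y - dir ξ u y) * (η y a * η y b))) a b c d := by
  have h1 := h.soliton y hy a b c d
  have hL := fun a b => h.lieDeriv_transform_smul hy h.smooth_u h.smooth_v h.smooth_w h.transform
    h.smooth_f a b
  simp only [hL] at h1
  simp only [kulkarniNomizu] at h1 ⊢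
  linear_combination (1 / 2) * h1

/-- The Ricci tensor of the transformed metric. -/
theorem exists_ricci_eq : ∃ s : ℝ, ∀ b c, ricci G y b c = s * G y b c
    - (2 * n - 1) * (dir ξ v y * f y * G y b (Φ y c)
      + (1 / 2) * Real.exp (2 * w y) * (fderiv ℝ f y b * η y c + η y b * fderiv ℝ f y c
        + 2 * f y * (dir ξ w y - dir ξ u y) * (η y b * η y c))) := by
  let B : Model n →L[ℝ] Model n →L[ℝ] ℝ := (-(1 / 2) * (σ y + 2 * dir ξ u y * f y)) • G y
    - (dir ξ v y * f y) • (ContinuousLinearMap.precomp ℝ (Φ y)) ∘L (G y)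
    - ((1 / 2) * Real.exp (2 * w y)) • ((fderiv ℝ f y).smulRight (η y)
      + (η y).smulRight (fderiv ℝ f y)
      + (2 * f y * (dir ξ w y - dir ξ u y)) • (η y).smulRight (η y))
  have hB : ∀ a b, B a b = -(1 / 2) * (σ y + 2 * dir ξ u y * f y) * G y a b
      - dir ξ v y * f y * G y a (Φ y b)
      - (1 / 2) * Real.exp (2 * w y) * (fderiv ℝ f y a * η y b + η y a * fderiv ℝ f y b
        + 2 * f y * (dir ξ w y - dir ξ u y) * (η y a * η y b)) := fun a b => rfl
  have hr := ricci_of_kulkarniNomizu h.isMetricOn hy B (fun a b c d => by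
    simp only [hB]; exact h.curv_eq hy a b c d)
  refine ⟨(∑ i, (G y).inverse (B (EuclideanSpace.single i 1)) i)
    + (2 * n - 1) * (-(1 / 2) * (σ y + 2 * dir ξ u y * f y)), fun b c => ?_⟩
  rw [hr, hB]
  push_cast
  ring

/-- The Ricci tensor of the transformed metric when `v` and `f` are constant in the vertical and
in the horizontal directions respectively. -/
theorem ricci_eq (hv : dir ξ v y = 0) (hf : ∀ x, η y x = 0 → fderiv ℝ f y x = 0)
    (b c : Model n) : ricci G y b c
      = (-(2 * n * (σ y + 2 * dir ξ u y * f y))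
          - (dir ξ f y + f y * (dir ξ w y - dir ξ u y))) * G y b c
        - (2 * n - 1) * (dir ξ f y + f y * (dir ξ w y - dir ξ u y))
          * (Real.exp (2 * w y) * (η y b * η y c)) := by
  have hdf : ∀ a, fderiv ℝ f y a = dir ξ f y * η y a := by
    intro a
    have := hf (a - η y a • ξ y) (by simp [h.η_ξ y hy])
    rw [map_sub, map_smul, smul_eq_mul, sub_eq_zero] at this
    rw [this, dir, mul_comm]
  set s : ℝ := -(1 / 2) * (σ y + 2 * dir ξ u y * f y) with hs
  set t : ℝ := -(dir ξ f y + f y * (dir ξ w y - dir ξ u y)) with ht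
  let B : Model n →L[ℝ] Model n →L[ℝ] ℝ := s • G y
    + (t * Real.exp (2 * w y)) • (η y).smulRight (η y)
  have hB : ∀ a b, B a b = s * G y a b + t * Real.exp (2 * w y) * (η y a * η y b) :=
    fun a b => rfl
  have hr := ricci_of_kulkarniNomizu h.isMetricOn hy B (fun a b c d => by
    rw [h.curv_eq hy]
    simp only [hB, hdf, hv, hs, ht, kulkarniNomizu]
    ring)
  have hinv : ∀ a, (G y).inverse (B a) = s • a + (t * η y a) • ξ y := by
    intro a
    apply h.isMetricOn.eq_of_forall hy
    intro d
    rw [h.isMetricOn.apply_inverse hy, hB]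
    simp only [map_add, map_smul, add_apply, smul_apply, smul_eq_mul, h.metric_ξ hy]
    ring
  have htr : ∑ i, η y (EuclideanSpace.single i 1) * ξ y i = 1 := by
    have hν : ∀ ν : Model n →L[ℝ] ℝ,
        ∑ i, ν (EuclideanSpace.single i 1) * ξ y i = ν (ξ y) := by
      intro ν
      conv_rhs => rw [← (EuclideanSpace.basisFun (Fin (2 * n + 1)) ℝ).sum_repr (ξ y)]
      simp [mul_comm]
    rw [hν, h.η_ξ y hy]
  -- With (2n - 1)s from B itself, the coefficient of G in the Ricci tensor becomes 4ns + t.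
  have hsum : ∑ i, (G y).inverse (B (EuclideanSpace.single i 1)) i = (2 * n + 1) * s + t := by
    simp only [hinv, PiLp.add_apply, PiLp.smul_apply, smul_eq_mul, Finset.sum_add_distrib,
      mul_assoc t, ← Finset.mul_sum, htr]
    simp
    ring
  rw [hr, hsum, hB, hs, ht]
  push_cast
  ring

/-- If the transformed metric is almost `η`-Einstein at a point where the potential does not vanish,
then `v` is constant in the vertical direction there. -/
theorem dir_v_eq_zero (hn : 1 ≤ n) (hf : f y ≠ 0) {s t : ℝ}
    (hρ : ∀ b c, ricci G y b c = s * G y b c + t * (η y b * η y c)) : dir ξ v y = 0 := by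
  obtain ⟨r, hr⟩ := h.exists_ricci_eq hy
  obtain ⟨x, z, hx, hz, hG⟩ := h.exists_horizontal hy hn
  have h1 := hr x z
  have h2 := hr x (Φ y z)
  have hzz : G y x (Φ y (Φ y z)) = -G y x z := by
    rw [h.Φ_Φ y hy, hz, zero_smul, add_zero, map_neg]
  rw [hρ] at h1 h2
  simp only [hx, hz, h.η_Φ y hy, hzz] at h1 h2
  have hn' : (1 : ℝ) ≤ n := by exact_mod_cast hn
  set K : ℝ := (2 * n - 1) * (dir ξ v y * f y) with hK
  -- The Ricci identity at (x, z) and at (x, φz), with φ² = -1 on H, is a linear system in G(x, z)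
  -- and G(x, φz) whose determinant is a sum of two squares.
  have h3 : (K ^ 2 + (r - s) ^ 2) * G y x z = 0 := by
    rw [hK]
    linear_combination -(r - s) * h1 - (2 * n - 1) * (dir ξ v y * f y) * h2
  have h4 := (mul_eq_zero.1 h3).resolve_right hG
  have h5 : K = 0 := by nlinarith [sq_nonneg K, sq_nonneg (r - s)]
  rw [hK] at h5
  have h6 := (mul_eq_zero.1 h5).resolve_left (by linarith)
  exact (mul_eq_zero.1 h6).resolve_right hf

/-- The potential function is horizontally constant where the Ricci tensor has no mixed part. -/
theorem fderiv_f_eq_zero_of_ricci (hn : 1 ≤ n)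
    (hρ : ∀ x, η y x = 0 → ricci G y x (ξ y) = 0) {x : Model n} (hx : η y x = 0) :
    fderiv ℝ f y x = 0 := by
  obtain ⟨r, hr⟩ := h.exists_ricci_eq hy
  have h1 := hr x (ξ y)
  rw [hρ x hx, h.Φ_ξ y hy, h.metric_ξ' hy, hx, h.η_ξ y hy] at h1
  have hn' : (1 : ℝ) ≤ n := by exact_mod_cast hn
  have h2 : ((2 * n - 1) * Real.exp (2 * w y)) * fderiv ℝ f y x = 0 := by
    simp only [map_zero] at h1
    linear_combination 2 * h1
  exact (mul_eq_zero.1 h2).resolve_left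
    (mul_ne_zero (by linarith) (Real.exp_ne_zero _))

omit hy in
theorem verticalSoliton (hv : ∀ y ∈ U, dir ξ v y = 0) :
    VerticalSoliton G ξ η w (dir ξ u) f σ U where
  toIsMetricOn := h.isMetricOn
  smooth_ξ := h.smooth_ξ
  smooth_η := h.smooth_η
  smooth_w := h.smooth_w
  smooth_p := contDiffOn_dir h.isOpen h.smooth_ξ h.smooth_u
  smooth_f := h.smooth_f
  smooth_σ := h.smooth_σ
  metric_ξ := fun _ hy => h.metric_ξ hy
  η_ξ := h.η_ξ
  closed_η := fun _ hy => h.closed_η hy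
  lie_ξ := fun y hy a b => by
    rw [h.lieDeriv_transform hy h.smooth_u h.smooth_v h.smooth_w h.transform, hv y hy]
    ring
  curv_eq := fun y hy a b c d => by
    rw [h.curv_eq hy]
    simp only [hv y hy, zero_mul, sub_zero]

/-- The potential function of the soliton is horizontally constant. -/
theorem fderiv_f_eq_zero (hn : 2 ≤ n) (hv : ∀ y ∈ U, dir ξ v y = 0) {x : Model n}
    (hx : η y x = 0) : fderiv ℝ f y x = 0 :=
  (h.verticalSoliton hv).fderiv_f_eq_zero (by rw [finrank_euclideanSpace_fin]; omega) hy hx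

/-- Where the transformed metric is almost Einstein, the speed of the potential is zero. -/
theorem speed_eq_zero (hn : 1 ≤ n) (hv : dir ξ v y = 0)
    (hf : ∀ x, η y x = 0 → fderiv ℝ f y x = 0) {s : ℝ}
    (hρ : ∀ b c, ricci G y b c = s * G y b c) :
    dir ξ f y + f y * (dir ξ w y - dir ξ u y) = 0 := by
  obtain ⟨x, z, hx, hz, hG⟩ := h.exists_horizontal hy hn
  -- A horizontal pair with G(x, z) ≠ 0 identifies s with the coefficient of G; the value at (ξ, ξ)
  -- then leaves only the η ⊗ η coefficient.
  have h1 := h.ricci_eq hy hv hf x z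
  have h2 := h.ricci_eq hy hv hf (ξ y) (ξ y)
  rw [hρ, hx, zero_mul, mul_zero, mul_zero, sub_zero] at h1
  rw [hρ, ← mul_right_cancel₀ hG h1, h.η_ξ y hy] at h2
  have hn' : (1 : ℝ) ≤ n := by exact_mod_cast hn
  have h3 : ((2 * n - 1) * Real.exp (2 * w y))
      * (dir ξ f y + f y * (dir ξ w y - dir ξ u y)) = 0 := by linear_combination h2
  exact (mul_eq_zero.1 h3).resolve_left (mul_ne_zero (by linarith) (Real.exp_ne_zero _))

end TransformSoliton

end TransformSoliton

end AccR

namespace AccR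

/-! ### Differentials of charts and tensor fields read in charts. -/

section Charts

variable {n : ℕ} {M : Type*} [TopologicalSpace M] [ChartedSpace (Model n) M]

/-- The derivative of the function `f` on `M` along the vector field `X`. -/
noncomputable def mdir (X : ∀ p : M, Tan n p) (f : M → ℝ) (p : M) : ℝ :=
  (mfderiv 𝓘(ℝ, Model n) 𝓘(ℝ, ℝ) f p : Tan n p → ℝ) (X p)

variable [IsManifold 𝓘(ℝ, Model n) ∞ M]
  {e : OpenPartialHomeomorph M (Model n)} (he : e ∈ atlas (Model n) M)
  {y : Model n} (hy : y ∈ e.target)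

include he

theorem mdifferentiable_of_mem_atlas' :
    e.MDifferentiable 𝓘(ℝ, Model n) 𝓘(ℝ, Model n) := by
  have : IsManifold 𝓘(ℝ, Model n) 1 M := IsManifold.of_le (n := ∞) (by simp)
  exact mdifferentiable_of_mem_atlas he

theorem contMDiffOn_chartSymm :
    ContMDiffOn 𝓘(ℝ, Model n) 𝓘(ℝ, Model n) ∞ e.symm e.target :=
  contMDiffOn_symm_of_mem_maximalAtlas (IsManifold.subset_maximalAtlas he)

theorem contDiffOn_comp_chartSymm {f : M → ℝ} (hf : ContMDiff 𝓘(ℝ, Model n) 𝓘(ℝ, ℝ) ∞ f) :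
    ContDiffOn ℝ ∞ (f ∘ e.symm) e.target :=
  (hf.comp_contMDiffOn (contMDiffOn_chartSymm he)).contDiffOn

include hy

theorem dChart_dChartSymm (a : Model n) : dChart e (e.symm y) (dChartSymm e y a) = a :=
  congrArg (fun L : Model n →L[ℝ] Model n => L a)
    ((mdifferentiable_of_mem_atlas' he).comp_symm_deriv hy)

theorem dChartSymm_dChart (x : Tan n (e.symm y)) :
    dChartSymm e y (dChart e (e.symm y) x) = x := by
  apply ((mdifferentiable_of_mem_atlas' he).mfderiv_bijective (e.map_target hy)).1
  exact dChart_dChartSymm he hy _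

theorem dChartSymm_inverse : (dChartSymm e y).inverse = dChart e (e.symm y) := by
  apply ContinuousLinearMap.inverse_eq
  · ext1 a
    exact dChartSymm_dChart he hy a
  · ext1 a
    exact dChart_dChartSymm he hy a

theorem dChartSymm_isInvertible : (dChartSymm e y).IsInvertible := by
  refine ⟨ContinuousLinearEquiv.equivOfInverse (dChartSymm e y) (dChart e (e.symm y))
    (dChart_dChartSymm he hy) (dChartSymm_dChart he hy), ?_⟩
  ext1 a
  rfl

theorem dChartSymm_vecInChart (X : ∀ p : M, Tan n p) :
    dChartSymm e y (vecInChart e X y) = X (e.symm y) := by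
  have : vecInChart e X y = (dChartSymm e y).inverse (X (e.symm y)) := rfl
  rw [this, dChartSymm_inverse he hy, dChartSymm_dChart he hy]

theorem dChartSymm_endInChart (φ : ∀ p : M, Tan n p →L[ℝ] Tan n p) (a : Model n) :
    dChartSymm e y (endInChart e φ y a) = φ (e.symm y) (dChartSymm e y a) := by
  have : endInChart e φ y a = (dChartSymm e y).inverse (φ (e.symm y) (dChartSymm e y a)) := rfl
  rw [this, dChartSymm_inverse he hy, dChartSymm_dChart he hy]

theorem dChartSymm_injective {a b : Model n} (h : dChartSymm e y a = dChartSymm e y b) :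
    a = b := by
  rw [← dChart_dChartSymm he hy a, h, dChart_dChartSymm he hy b]

theorem vecInChart_smul (f : M → ℝ) (X : ∀ p : M, Tan n p) :
    vecInChart e (fun p => f p • X p) y = f (e.symm y) • vecInChart e X y := by
  apply dChartSymm_injective he hy
  rw [map_smul, dChartSymm_vecInChart he hy, dChartSymm_vecInChart he hy]

theorem dir_vecInChart {f : M → ℝ} (hf : ContMDiff 𝓘(ℝ, Model n) 𝓘(ℝ, ℝ) ∞ f)
    (X : ∀ p : M, Tan n p) :
    dir (vecInChart e X) (f ∘ e.symm) y = mdir X f (e.symm y) := by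
  rw [dir, ← mfderiv_eq_fderiv, mfderiv_comp y (hf.mdifferentiable (by simp) _)
    ((mdifferentiable_of_mem_atlas' he).mdifferentiableAt_symm hy)]
  exact congrArg _ (dChartSymm_vecInChart he hy X)

omit hy in
theorem contDiffOn_vecInChart {X : ∀ p : M, Tan n p}
    (hX : ContMDiff 𝓘(ℝ, Model n) 𝓘(ℝ, Model n).tangent ∞
      (fun p => (⟨p, X p⟩ : TangentBundle 𝓘(ℝ, Model n) M))) :
    ContDiffOn ℝ ∞ (vecInChart e X) e.target := by
  intro y hy
  refine ContDiffAt.contDiffWithinAt ?_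
  have h1 := ContMDiffAt.mpullback_vectorField_preimage (hX (e.symm y))
    ((contMDiffOn_chartSymm he).contMDiffAt (e.open_target.mem_nhds hy))
    (dChartSymm_isInvertible he hy) (by simp)
  exact contMDiffAt_vectorSpace_iff_contDiffAt.1 h1

end Charts

end AccR

namespace AccR

theorem lieDeriv_congr {E : Type*} [NormedAddCommGroup E] [NormedSpace ℝ E] {U : Set E}
    (hU : IsOpen U) {V W : E → E} (h : ∀ y ∈ U, V y = W y) (G : E → E →L[ℝ] E →L[ℝ] ℝ) {y : E}
    (hy : y ∈ U) (a b : E) : lieDeriv V G y a b = lieDeriv W G y a b := by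
  rw [lieDeriv, lieDeriv, h y hy, fderiv_eq_of_eqOn hU h hy]

/-! ### The manifold structure and the soliton equation in a chart. -/

namespace AccRData

variable {n : ℕ} {M : Type*} [TopologicalSpace M] [ChartedSpace (Model n) M]
  [IsManifold 𝓘(ℝ, Model n) ∞ M] {S : AccRData n M}
  {e : OpenPartialHomeomorph M (Model n)} (he : e ∈ atlas (Model n) M)

include he

theorem nondeg_bilinInChart (hS : S.IsAccR) {y : Model n} (hy : y ∈ e.target) (a : Model n)
    (ha : ∀ b, bilinInChart e S.g y a b = 0) : a = 0 := by
  apply dChartSymm_injective he hy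
  rw [map_zero]
  apply hS.nondeg_g
  intro x
  rw [← dChartSymm_dChart he hy x]
  exact ha _

theorem cosymplecticOn (hS : S.IsAccR) (hS0 : S.IsF0) :
    CosymplecticOn (bilinInChart e S.g) (endInChart e S.φ) (vecInChart e S.ξ)
      (formInChart e S.η) e.target where
  isOpen := e.open_target
  smooth := hS.smooth_g e he
  symm := fun y _ a b => hS.symm_g _ _ _
  inv := fun y hy => isInvertible_of_nondeg _ (nondeg_bilinInChart he hS hy)
  smooth_Φ := hS.smooth_φ e he
  smooth_ξ := contDiffOn_vecInChart he hS.smooth_ξ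
  smooth_η := hS.smooth_η e he
  Φ_ξ := fun y hy => by
    apply dChartSymm_injective he hy
    rw [dChartSymm_endInChart he hy, dChartSymm_vecInChart he hy, hS.φ_ξ, map_zero]
  Φ_Φ := fun y hy a => by
    apply dChartSymm_injective he hy
    rw [dChartSymm_endInChart he hy, dChartSymm_endInChart he hy, hS.φ_φ, map_add, map_neg,
      map_smul, dChartSymm_vecInChart he hy]
    rfl
  η_Φ := fun y hy a => by
    change S.η _ (dChartSymm e y (endInChart e S.φ y a)) = 0
    rw [dChartSymm_endInChart he hy, hS.η_φ]
  η_ξ := fun y hy => by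
    change S.η _ (dChartSymm e y (vecInChart e S.ξ y)) = 1
    rw [dChartSymm_vecInChart he hy, hS.η_ξ]
  g_Φ_Φ := fun y hy a b => by
    change S.g _ (dChartSymm e y (endInChart e S.φ y a)) (dChartSymm e y (endInChart e S.φ y b)) = _
    rw [dChartSymm_endInChart he hy, dChartSymm_endInChart he hy, hS.g_φ_φ]
    rfl
  parallel := fun y hy a b => by
    apply nondeg_bilinInChart he hS hy
    intro c
    have h1 := hS0 e he (e.symm y) (e.map_target hy) (dChartSymm e y a) (dChartSymm e y b)
      (dChartSymm e y c)
    rw [fundamentalIn, dChart_dChartSymm he hy, dChart_dChartSymm he hy,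
      dChart_dChartSymm he hy, e.right_inv hy] at h1
    exact h1

/-- The η ⊗ η inside g̃ cancels the term -e^{2u} sin 2v η ⊗ η of the transform. -/
theorem isTransformOn (u v w : M → ℝ) : IsTransformOn (bilinInChart e S.g) (endInChart e S.φ)
    (formInChart e S.η) (u ∘ e.symm) (v ∘ e.symm) (w ∘ e.symm)
    (bilinInChart e (S.gTransform u v w).g) e.target := by
  intro y hy a b
  have h1 : bilinInChart e S.g y a (endInChart e S.φ y b)
      = S.g (e.symm y) (dChartSymm e y a) (S.φ (e.symm y) (dChartSymm e y b)) := by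
    rw [← dChartSymm_endInChart he hy]
    rfl
  have h2 := S.gTransform_g_apply u v w (e.symm y) (dChartSymm e y a) (dChartSymm e y b)
  rw [gTilde] at h2
  rw [h1]
  change (S.gTransform u v w).g (e.symm y) (dChartSymm e y a) (dChartSymm e y b)
    = Real.exp (2 * u (e.symm y)) * Real.cos (2 * v (e.symm y))
        * S.g (e.symm y) (dChartSymm e y a) (dChartSymm e y b)
      + Real.exp (2 * u (e.symm y)) * Real.sin (2 * v (e.symm y))
        * S.g (e.symm y) (dChartSymm e y a) (S.φ (e.symm y) (dChartSymm e y b))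
      + (Real.exp (2 * w (e.symm y)) - Real.exp (2 * u (e.symm y)) * Real.cos (2 * v (e.symm y)))
        * (S.η (e.symm y) (dChartSymm e y a) * S.η (e.symm y) (dChartSymm e y b))
  rw [h2]
  ring

theorem vecInChart_potential (u v w k : M → ℝ) {y : Model n} (hy : y ∈ e.target) :
    vecInChart e (fun p => k p • (S.gTransform u v w).ξ p) y
      = ((fun p => k p * Real.exp (-w p)) ∘ e.symm) y • vecInChart e S.ξ y := by
  rw [vecInChart_smul he hy]
  change _ • vecInChart e (fun p => Real.exp (-w p) • S.ξ p) y = _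
  rw [vecInChart_smul he hy, smul_smul]
  rfl

theorem soliton_inChart {S : AccRData n M} {X : ∀ p : M, Tan n p} {σ : M → ℝ}
    (h : S.IsAlmostRiemannSoliton X σ) {y : Model n} (hy : y ∈ e.target) (a b c d : Model n) :
    2 * curv (bilinInChart e S.g) y a b c d
      + σ (e.symm y) * kulkarniNomizu (fun a b => bilinInChart e S.g y a b)
          (fun a b => bilinInChart e S.g y a b) a b c d
      + kulkarniNomizu (fun a b => bilinInChart e S.g y a b)
          (fun a b => lieDeriv (vecInChart e X) (bilinInChart e S.g) y a b) a b c d = 0 := by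
  have h1 := h.2 e he (e.symm y) (e.map_target hy) (dChartSymm e y a) (dChartSymm e y b)
    (dChartSymm e y c) (dChartSymm e y d)
  simp only [curvIn, lieDerivIn, kulkarniNomizu, dChart_dChartSymm he hy, e.right_inv hy] at h1
  exact h1

theorem transformSoliton (hS : S.IsAccR) (hS0 : S.IsF0) {u v w k σ : M → ℝ}
    (hu : ContMDiff 𝓘(ℝ, Model n) 𝓘(ℝ, ℝ) ∞ u) (hv : ContMDiff 𝓘(ℝ, Model n) 𝓘(ℝ, ℝ) ∞ v)
    (hw : ContMDiff 𝓘(ℝ, Model n) 𝓘(ℝ, ℝ) ∞ w)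
    (hf : ContMDiff 𝓘(ℝ, Model n) 𝓘(ℝ, ℝ) ∞ (fun p => k p * Real.exp (-w p)))
    (hsol : (S.gTransform u v w).IsAlmostRiemannSoliton
      (fun p => k p • (S.gTransform u v w).ξ p) σ) :
    TransformSoliton (bilinInChart e S.g) (endInChart e S.φ) (vecInChart e S.ξ)
      (formInChart e S.η) (u ∘ e.symm) (v ∘ e.symm) (w ∘ e.symm)
      ((fun p => k p * Real.exp (-w p)) ∘ e.symm) (σ ∘ e.symm)
      (bilinInChart e (S.gTransform u v w).g) e.target where
  toCosymplecticOn := cosymplecticOn he hS hS0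
  smooth_u := contDiffOn_comp_chartSymm he hu
  smooth_v := contDiffOn_comp_chartSymm he hv
  smooth_w := contDiffOn_comp_chartSymm he hw
  smooth_f := contDiffOn_comp_chartSymm he hf
  smooth_σ := contDiffOn_comp_chartSymm he hsol.1
  transform := isTransformOn he u v w
  soliton := fun y hy a b c d => by
    have h1 := soliton_inChart he hsol hy a b c d
    simp only [lieDeriv_congr e.open_target (fun y hy => vecInChart_potential he u v w k hy) _ hy]
      at h1
    exact h1

omit he in
theorem ricciEq_iff (S : AccRData n M) (a b c : M → ℝ) : S.RicciEq a b c ↔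
    ∀ e ∈ atlas (Model n) M, ∀ y ∈ e.target, ∀ x z, ricci (bilinInChart e S.g) y x z
      = a (e.symm y) * bilinInChart e S.g y x z
        + b (e.symm y) * S.gTilde (e.symm y) (dChartSymm e y x) (dChartSymm e y z)
        + c (e.symm y) * (formInChart e S.η y x * formInChart e S.η y z) := by
  constructor
  · intro h e he y hy x z
    have h1 := h e he (e.symm y) (e.map_target hy) (dChartSymm e y x) (dChartSymm e y z)
    rw [ricciIn, dChart_dChartSymm he hy, dChart_dChartSymm he hy, e.right_inv hy] at h1
    exact h1
  · intro h e he p hp x z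
    obtain ⟨y, hy, rfl⟩ : ∃ y ∈ e.target, e.symm y = p :=
      ⟨e p, e.map_source hp, e.left_inv hp⟩
    have h1 := h e he y hy (dChart e (e.symm y) x) (dChart e (e.symm y) z)
    rw [ricciIn, e.right_inv hy, h1, dChartSymm_dChart he hy, dChartSymm_dChart he hy]
    simp only [bilinInChart, formInChart, ContinuousLinearMap.comp_apply,
      ContinuousLinearMap.precomp_apply, dChartSymm_dChart he hy]

end AccRData

end AccR

namespace AccR

/-! ### Derivatives along vector fields and integral curves; the speed of the potential. -/

section Directional

variable {n : ℕ} {M : Type*} [TopologicalSpace M] [ChartedSpace (Model n) M]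

theorem mdir_smul (c : M → ℝ) (X : ∀ p : M, Tan n p) (f : M → ℝ) (p : M) :
    mdir (fun p => c p • X p) f p = c p * mdir X f p := by
  simp only [mdir, map_smul]
  rfl

theorem contMDiff_mdir [IsManifold 𝓘(ℝ, Model n) ∞ M] {X : ∀ p : M, Tan n p}
    (hX : ContMDiff 𝓘(ℝ, Model n) 𝓘(ℝ, Model n).tangent ∞
      (fun p => (⟨p, X p⟩ : TangentBundle 𝓘(ℝ, Model n) M)))
    {f : M → ℝ} (hf : ContMDiff 𝓘(ℝ, Model n) 𝓘(ℝ, ℝ) ∞ f) :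
    ContMDiff 𝓘(ℝ, Model n) 𝓘(ℝ, ℝ) ∞ (mdir X f) := by
  intro p
  let e := chartAt (Model n) p
  have he : e ∈ atlas (Model n) M := chart_mem_atlas _ p
  have hp : e.source ∈ nhds p := chart_source_mem_nhds _ p
  have h1 : ContMDiffOn 𝓘(ℝ, Model n) 𝓘(ℝ, ℝ) ∞ (dir (vecInChart e X) (f ∘ e.symm) ∘ e)
      e.source :=
    (contDiffOn_dir e.open_target (contDiffOn_vecInChart he hX)
      (contDiffOn_comp_chartSymm he hf)).contMDiffOn.comp
      (contMDiffOn_of_mem_maximalAtlas (IsManifold.subset_maximalAtlas he)) e.mapsTo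
  refine (h1.contMDiffAt hp).congr_of_eventuallyEq ?_
  filter_upwards [hp] with q hq
  have h2 := dir_vecInChart he (e.map_source hq) hf X
  rw [Function.comp_apply, h2, e.left_inv hq]

theorem hasDerivAt_comp_integralCurve {X : ∀ p : M, Tan n p} {γ : ℝ → M} {t : ℝ}
    (hγ : IsMIntegralCurveAt (I := 𝓘(ℝ, Model n)) γ X t) {f : M → ℝ}
    (hf : ContMDiff 𝓘(ℝ, Model n) 𝓘(ℝ, ℝ) ∞ f) :
    HasDerivAt (fun s => f (γ s)) (mdir X f (γ t)) t := by
  have h1 := (hf.mdifferentiable (by simp) (γ t)).hasMFDerivAt.comp t hγ.hasMFDerivAt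
  let L : Model n →L[ℝ] ℝ := mfderiv 𝓘(ℝ, Model n) 𝓘(ℝ, ℝ) f (γ t)
  let x : Model n := X (γ t)
  have h2 : HasFDerivAt (fun s => f (γ s)) (L.comp ((1 : ℝ →L[ℝ] ℝ).smulRight x)) t :=
    hasMFDerivAt_iff_hasFDerivAt.1 h1
  have h3 : (L.comp ((1 : ℝ →L[ℝ] ℝ).smulRight x)) 1 = L x := by simp
  exact h2.hasDerivAt.congr_deriv h3

/-- Both sides say that k e^{-u} has zero derivative along ξ. One direction needs a local integral
curve through each point, the other that a function with zero derivative on an interval is constant.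
-/
theorem AccRData.eqConstMulExpOnVertical_iff [IsManifold 𝓘(ℝ, Model n) ∞ M] (S : AccRData n M)
    (hξ : ContMDiff 𝓘(ℝ, Model n) 𝓘(ℝ, Model n).tangent ∞
      (fun p => (⟨p, S.ξ p⟩ : TangentBundle 𝓘(ℝ, Model n) M)))
    {k u : M → ℝ} (hk : ContMDiff 𝓘(ℝ, Model n) 𝓘(ℝ, ℝ) ∞ k)
    (hu : ContMDiff 𝓘(ℝ, Model n) 𝓘(ℝ, ℝ) ∞ u) :
    S.EqConstMulExpOnVertical k u ↔ ∀ p, mdir S.ξ k p = k p * mdir S.ξ u p := by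
  constructor
  · intro h p
    have : IsManifold 𝓘(ℝ, Model n) 1 M := IsManifold.of_le (n := ∞) (by simp)
    obtain ⟨γ, hγ0, hγ⟩ := exists_isMIntegralCurveAt_of_contMDiffAt_boundaryless
      (t₀ := 0) ((hξ p).of_le (by simp))
    obtain ⟨ε, hε, hγε⟩ := isMIntegralCurveAt_iff'.1 hγ
    rw [Real.ball_eq_Ioo] at hγε
    obtain ⟨μ, hμ⟩ := h γ _ _ hγε
    have h0 : (0 : ℝ) ∈ Set.Ioo (0 - ε) (0 + ε) := by simp [hε]
    have hdk := hasDerivAt_comp_integralCurve hγ hk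
    have hdu := ((hasDerivAt_comp_integralCurve hγ hu).exp).const_mul μ
    have heq : (fun s => k (γ s)) =ᶠ[nhds 0] fun s => μ * Real.exp (u (γ s)) := by
      filter_upwards [isOpen_Ioo.mem_nhds h0] with s hs using hμ s hs
    have h1 := hdk.unique (hdu.congr_of_eventuallyEq heq)
    rw [← mul_assoc, ← hμ 0 h0, hγ0] at h1
    exact h1
  · intro h γ a b hγ
    rcases (Set.Ioo a b).eq_empty_or_nonempty with hemp | ⟨t₀, ht₀⟩
    · exact ⟨0, fun t ht => by simp [hemp] at ht⟩
    have hd : ∀ t ∈ Set.Ioo a b,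
        HasDerivAt (fun s => k (γ s) * Real.exp (-u (γ s))) 0 t := by
      intro t ht
      have hγt := hγ.isMIntegralCurveAt (isOpen_Ioo.mem_nhds ht)
      refine ((hasDerivAt_comp_integralCurve hγt hk).fun_mul
        (hasDerivAt_comp_integralCurve hγt hu).fun_neg.exp).congr_deriv ?_
      rw [h]
      ring
    refine ⟨k (γ t₀) * Real.exp (-u (γ t₀)), fun t ht => ?_⟩
    have h2 := isOpen_Ioo.is_const_of_deriv_eq_zero isPreconnected_Ioo
      (fun s hs => (hd s hs).differentiableAt.differentiableWithinAt)
      (fun s hs => (hd s hs).deriv) ht ht₀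
    rw [← h2, mul_assoc, ← Real.exp_add]
    simp

end Directional

namespace AccRData

variable {n : ℕ} {M : Type*} [TopologicalSpace M] [ChartedSpace (Model n) M] {S : AccRData n M}
  {u v w k σ : M → ℝ}

theorem mdir_gTransform_ξ (f : M → ℝ) (p : M) :
    mdir (S.gTransform u v w).ξ f p = Real.exp (-w p) * mdir S.ξ f p :=
  mdir_smul (fun p => Real.exp (-w p)) S.ξ f p

theorem isVerticalConstant_gTransform_iff :
    (S.gTransform u v w).IsVerticalConstant v ↔ ∀ p, mdir S.ξ v p = 0 := by
  refine forall_congr' fun p => ?_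
  change mdir (S.gTransform u v w).ξ v p = 0 ↔ _
  rw [mdir_gTransform_ξ]
  simp [Real.exp_ne_zero]

/-- The speed of the potential of the soliton. -/
noncomputable def speed (S : AccRData n M) (u w k : M → ℝ) (p : M) : ℝ :=
  Real.exp (-w p) * (mdir S.ξ k p - k p * mdir S.ξ u p)

variable [IsManifold 𝓘(ℝ, Model n) ∞ M]

theorem contMDiff_gTransform_ξ (hS : S.IsAccR) (hw : ContMDiff 𝓘(ℝ, Model n) 𝓘(ℝ, ℝ) ∞ w) :
    ContMDiff 𝓘(ℝ, Model n) 𝓘(ℝ, Model n).tangent ∞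
      (fun p => (⟨p, (S.gTransform u v w).ξ p⟩ : TangentBundle 𝓘(ℝ, Model n) M)) :=
  ContMDiff.smul_section (Real.contDiff_exp.comp_contMDiff hw.neg) hS.smooth_ξ

theorem eqConstMulExpOnVertical_gTransform_iff (hS : S.IsAccR)
    (hu : ContMDiff 𝓘(ℝ, Model n) 𝓘(ℝ, ℝ) ∞ u) (hw : ContMDiff 𝓘(ℝ, Model n) 𝓘(ℝ, ℝ) ∞ w)
    (hk : ContMDiff 𝓘(ℝ, Model n) 𝓘(ℝ, ℝ) ∞ k) :
    (S.gTransform u v w).EqConstMulExpOnVertical k u ↔ ∀ p, S.speed u w k p = 0 := by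
  rw [eqConstMulExpOnVertical_iff _ (contMDiff_gTransform_ξ hS hw) hk hu]
  refine forall_congr' fun p => ?_
  rw [mdir_gTransform_ξ, mdir_gTransform_ξ, speed, mul_sub, sub_eq_zero]
  rw [mul_left_comm]

theorem dir_potential_eq_speed {e : OpenPartialHomeomorph M (Model n)}
    (he : e ∈ atlas (Model n) M) {y : Model n} (hy : y ∈ e.target)
    (hu : ContMDiff 𝓘(ℝ, Model n) 𝓘(ℝ, ℝ) ∞ u) (hw : ContMDiff 𝓘(ℝ, Model n) 𝓘(ℝ, ℝ) ∞ w)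
    (hk : ContMDiff 𝓘(ℝ, Model n) 𝓘(ℝ, ℝ) ∞ k) :
    dir (vecInChart e S.ξ) ((fun p => k p * Real.exp (-w p)) ∘ e.symm) y
      + ((fun p => k p * Real.exp (-w p)) ∘ e.symm) y
        * (dir (vecInChart e S.ξ) (w ∘ e.symm) y - dir (vecInChart e S.ξ) (u ∘ e.symm) y)
      = S.speed u w k (e.symm y) := by
  have hdk := differentiableAt_of_contDiffOn e.open_target (contDiffOn_comp_chartSymm he hk) hy
  have hdw := differentiableAt_of_contDiffOn e.open_target (contDiffOn_comp_chartSymm he hw) hy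
  have h1 : dir (vecInChart e S.ξ) ((fun p => k p * Real.exp (-w p)) ∘ e.symm) y
      = Real.exp (-w (e.symm y)) * (dir (vecInChart e S.ξ) (k ∘ e.symm) y
        - k (e.symm y) * dir (vecInChart e S.ξ) (w ∘ e.symm) y) := by
    have h2 := (hdk.hasFDerivAt.mul hdw.hasFDerivAt.neg.exp).fderiv
    have h3 : ((fun p => k p * Real.exp (-w p)) ∘ e.symm)
      = (k ∘ e.symm) * fun z => Real.exp ((-(w ∘ e.symm)) z) := rfl
    rw [dir, h3, h2]
    simp [dir]
    ring
  rw [h1, speed, dir_vecInChart he hy hk, dir_vecInChart he hy hu]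
  simp only [Function.comp_apply]
  ring

theorem contMDiff_speed (hS : S.IsAccR) (hu : ContMDiff 𝓘(ℝ, Model n) 𝓘(ℝ, ℝ) ∞ u)
    (hw : ContMDiff 𝓘(ℝ, Model n) 𝓘(ℝ, ℝ) ∞ w) (hk : ContMDiff 𝓘(ℝ, Model n) 𝓘(ℝ, ℝ) ∞ k) :
    ContMDiff 𝓘(ℝ, Model n) 𝓘(ℝ, ℝ) ∞ (S.speed u w k) :=
  (Real.contDiff_exp.comp_contMDiff hw.neg).mul
    ((contMDiff_mdir hS.smooth_ξ hk).sub (hk.mul (contMDiff_mdir hS.smooth_ξ hu)))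

end AccRData

end AccR

namespace AccR

/-! ### Global consequences and the theorem. -/

namespace AccRData

variable {n : ℕ} {M : Type*} [TopologicalSpace M] [ChartedSpace (Model n) M]
  [IsManifold 𝓘(ℝ, Model n) ∞ M] {S : AccRData n M} {u v w k σ : M → ℝ}

/-- On an almost Einstein-like transformed manifold the Ricci tensor has no mixed part. -/
theorem ricci_mixed_eq_zero (hS : S.IsAccR) {e : OpenPartialHomeomorph M (Model n)}
    (he : e ∈ atlas (Model n) M) {y : Model n} (hy : y ∈ e.target)
    (hT : ∀ x, bilinInChart e (S.gTransform u v w).g y x (vecInChart e S.ξ y)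
      = Real.exp (2 * w (e.symm y)) * formInChart e S.η y x)
    (h : (S.gTransform u v w).IsAlmostEinsteinLike) {x : Model n}
    (hx : formInChart e S.η y x = 0) :
    ricci (bilinInChart e (S.gTransform u v w).g) y x (vecInChart e S.ξ y) = 0 := by
  obtain ⟨a, b, c, -, -, -, hρ⟩ := h
  have hη : (S.gTransform u v w).η (e.symm y) (dChartSymm e y x) = 0 := by
    change Real.exp (w (e.symm y)) * formInChart e S.η y x = 0
    rw [hx, mul_zero]
  have hφ : (S.gTransform u v w).φ (e.symm y) (S.ξ (e.symm y)) = 0 := hS.φ_ξ _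
  have hη' : formInChart e (S.gTransform u v w).η y x = 0 := hη
  rw [(ricciEq_iff _ a b c).1 hρ e he y hy, hT, hx, gTilde, dChartSymm_vecInChart he hy, hη, hφ,
    hη', map_zero]
  ring

omit [IsManifold 𝓘(ℝ, Model n) ∞ M] in
theorem formInChart_gTransform_mul (e : OpenPartialHomeomorph M (Model n)) (y x z : Model n) :
    formInChart e (S.gTransform u v w).η y x * formInChart e (S.gTransform u v w).η y z
      = Real.exp (2 * w (e.symm y)) * (formInChart e S.η y x * formInChart e S.η y z) := by
  change Real.exp (w (e.symm y)) * formInChart e S.η y x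
    * (Real.exp (w (e.symm y)) * formInChart e S.η y z) = _
  have hw : Real.exp (2 * w (e.symm y)) = Real.exp (w (e.symm y)) * Real.exp (w (e.symm y)) := by
    rw [← Real.exp_add, ← two_mul]
  rw [hw]
  ring

omit [IsManifold 𝓘(ℝ, Model n) ∞ M] in
theorem exists_chartSymm_eq (p : M) :
    ∃ e ∈ atlas (Model n) M, ∃ y ∈ e.target, e.symm y = p :=
  ⟨_, chart_mem_atlas _ p, _, mem_chart_target _ p,
    (chartAt (Model n) p).left_inv (mem_chart_source _ p)⟩

/-- If `v` is a vertical constant, then the potential function is horizontally constant. -/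
theorem fderiv_potential_eq_zero (hn : 1 ≤ n) (hS : S.IsAccR) (hS0 : S.IsF0)
    (hu : ContMDiff 𝓘(ℝ, Model n) 𝓘(ℝ, ℝ) ∞ u) (hv : ContMDiff 𝓘(ℝ, Model n) 𝓘(ℝ, ℝ) ∞ v)
    (hw : ContMDiff 𝓘(ℝ, Model n) 𝓘(ℝ, ℝ) ∞ w)
    (hf : ContMDiff 𝓘(ℝ, Model n) 𝓘(ℝ, ℝ) ∞ (fun p => k p * Real.exp (-w p)))
    (hsol : (S.gTransform u v w).IsAlmostRiemannSoliton
      (fun p => k p • (S.gTransform u v w).ξ p) σ)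
    (h3 : n = 1 → (S.gTransform u v w).IsAlmostEinsteinLike)
    (hvert : ∀ p, mdir S.ξ v p = 0) {e : OpenPartialHomeomorph M (Model n)}
    (he : e ∈ atlas (Model n) M) {y : Model n} (hy : y ∈ e.target) {x : Model n}
    (hx : formInChart e S.η y x = 0) :
    fderiv ℝ ((fun p => k p * Real.exp (-w p)) ∘ e.symm) y x = 0 := by
  -- For n ≥ 2 the dimension is at least five and the Codazzi argument applies; in dimension three
  -- the Einstein-like assumption replaces it.
  have hT := transformSoliton he hS hS0 hu hv hw hf hsol
  rcases hn.lt_or_eq with h2 | h1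
  · exact hT.fderiv_f_eq_zero hy h2
      (fun z hz => (dir_vecInChart he hz hv S.ξ).trans (hvert _)) hx
  · exact hT.fderiv_f_eq_zero_of_ricci hy hn
      (fun z hz => ricci_mixed_eq_zero hS he hy (hT.metric_ξ' hy) (h3 h1.symm) hz) hx

/-- The Ricci tensor of the transformed metric when `v` is a vertical constant. -/
theorem ricciEq_of_verticalConstant (hn : 1 ≤ n) (hS : S.IsAccR) (hS0 : S.IsF0)
    (hu : ContMDiff 𝓘(ℝ, Model n) 𝓘(ℝ, ℝ) ∞ u) (hv : ContMDiff 𝓘(ℝ, Model n) 𝓘(ℝ, ℝ) ∞ v)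
    (hw : ContMDiff 𝓘(ℝ, Model n) 𝓘(ℝ, ℝ) ∞ w) (hk : ContMDiff 𝓘(ℝ, Model n) 𝓘(ℝ, ℝ) ∞ k)
    (hf : ContMDiff 𝓘(ℝ, Model n) 𝓘(ℝ, ℝ) ∞ (fun p => k p * Real.exp (-w p)))
    (hsol : (S.gTransform u v w).IsAlmostRiemannSoliton
      (fun p => k p • (S.gTransform u v w).ξ p) σ)
    (h3 : n = 1 → (S.gTransform u v w).IsAlmostEinsteinLike)
    (hvert : ∀ p, mdir S.ξ v p = 0) :
    (S.gTransform u v w).RicciEq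
      (fun p => -(2 * n * (σ p + 2 * mdir S.ξ u p * (k p * Real.exp (-w p)))) - S.speed u w k p)
      (fun _ => 0) (fun p => -((2 * n - 1) * S.speed u w k p)) := by
  rw [ricciEq_iff]
  intro e he y hy x z
  have hT := transformSoliton he hS hS0 hu hv hw hf hsol
  rw [hT.ricci_eq hy ((dir_vecInChart he hy hv S.ξ).trans (hvert _))
    (fun x hx => fderiv_potential_eq_zero hn hS hS0 hu hv hw hf hsol h3 hvert he hy hx),
    dir_potential_eq_speed he hy hu hw hk, dir_vecInChart he hy hu, formInChart_gTransform_mul]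
  simp only [Function.comp_apply]
  ring

/-- If the transformed manifold is almost `η`-Einstein, then `v` is a vertical constant. -/
theorem mdir_v_eq_zero_of_isAlmostEtaEinstein (hn : 1 ≤ n) (hS : S.IsAccR) (hS0 : S.IsF0)
    (hu : ContMDiff 𝓘(ℝ, Model n) 𝓘(ℝ, ℝ) ∞ u) (hv : ContMDiff 𝓘(ℝ, Model n) 𝓘(ℝ, ℝ) ∞ v)
    (hw : ContMDiff 𝓘(ℝ, Model n) 𝓘(ℝ, ℝ) ∞ w)
    (hf : ContMDiff 𝓘(ℝ, Model n) 𝓘(ℝ, ℝ) ∞ (fun p => k p * Real.exp (-w p)))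
    (hk0 : ∀ p, k p ≠ 0)
    (hsol : (S.gTransform u v w).IsAlmostRiemannSoliton
      (fun p => k p • (S.gTransform u v w).ξ p) σ)
    (h : (S.gTransform u v w).IsAlmostEtaEinstein) (p : M) : mdir S.ξ v p = 0 := by
  obtain ⟨a, c, -, -, hρ⟩ := h
  obtain ⟨e, he, y, hy, rfl⟩ := exists_chartSymm_eq (n := n) p
  have hT := transformSoliton he hS hS0 hu hv hw hf hsol
  have h1 := hT.dir_v_eq_zero hy hn (mul_ne_zero (hk0 _) (Real.exp_ne_zero _))
    (s := a (e.symm y)) (t := c (e.symm y) * Real.exp (2 * w (e.symm y)))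
    (fun x z => by
      rw [(ricciEq_iff _ a (fun _ => 0) c).1 hρ e he y hy, formInChart_gTransform_mul]
      ring)
  rwa [dir_vecInChart he hy hv] at h1

/-- If the transformed manifold is almost Einstein, then the speed of the potential is zero. -/
theorem speed_eq_zero_of_isAlmostEinstein (hn : 1 ≤ n) (hS : S.IsAccR) (hS0 : S.IsF0)
    (hu : ContMDiff 𝓘(ℝ, Model n) 𝓘(ℝ, ℝ) ∞ u) (hv : ContMDiff 𝓘(ℝ, Model n) 𝓘(ℝ, ℝ) ∞ v)
    (hw : ContMDiff 𝓘(ℝ, Model n) 𝓘(ℝ, ℝ) ∞ w) (hk : ContMDiff 𝓘(ℝ, Model n) 𝓘(ℝ, ℝ) ∞ k)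
    (hf : ContMDiff 𝓘(ℝ, Model n) 𝓘(ℝ, ℝ) ∞ (fun p => k p * Real.exp (-w p)))
    (hsol : (S.gTransform u v w).IsAlmostRiemannSoliton
      (fun p => k p • (S.gTransform u v w).ξ p) σ)
    (h3 : n = 1 → (S.gTransform u v w).IsAlmostEinsteinLike)
    (hvert : ∀ p, mdir S.ξ v p = 0)
    (h : (S.gTransform u v w).IsAlmostEinstein) (p : M) : S.speed u w k p = 0 := by
  obtain ⟨a, -, hρ⟩ := h
  obtain ⟨e, he, y, hy, rfl⟩ := exists_chartSymm_eq (n := n) p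
  have hT := transformSoliton he hS hS0 hu hv hw hf hsol
  rw [← dir_potential_eq_speed he hy hu hw hk]
  refine hT.speed_eq_zero hy hn ((dir_vecInChart he hy hv S.ξ).trans (hvert _))
    (fun x hx => fderiv_potential_eq_zero hn hS hS0 hu hv hw hf hsol h3 hvert he hy hx)
    (s := a (e.symm y)) (fun x z => ?_)
  rw [(ricciEq_iff _ a (fun _ => 0) (fun _ => 0)).1 hρ e he y hy]
  ring

end AccRData

end AccR

theorem mainTheorem4 {n : ℕ} (hn : 1 ≤ n)
    {M : Type*} [TopologicalSpace M] [ChartedSpace (AccR.Model n) M]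
    [IsManifold 𝓘(ℝ, AccR.Model n) ∞ M]
    (S : AccR.AccRData n M) (hS : S.IsAccR) (hS0 : S.IsF0)
    (u v w k σ : M → ℝ)
    (hu : ContMDiff 𝓘(ℝ, AccR.Model n) 𝓘(ℝ, ℝ) ∞ u)
    (hv : ContMDiff 𝓘(ℝ, AccR.Model n) 𝓘(ℝ, ℝ) ∞ v)
    (hw : ContMDiff 𝓘(ℝ, AccR.Model n) 𝓘(ℝ, ℝ) ∞ w)
    (hk : ContMDiff 𝓘(ℝ, AccR.Model n) 𝓘(ℝ, ℝ) ∞ k)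
    (hk0 : ∀ p : M, k p ≠ 0)
    (hsol : (S.gTransform u v w).IsAlmostRiemannSoliton
      (fun p => k p • (S.gTransform u v w).ξ p) σ)
    (h3 : n = 1 → (S.gTransform u v w).IsAlmostEinsteinLike) :
    ((S.gTransform u v w).IsAlmostEtaEinstein ↔
      (S.gTransform u v w).IsVerticalConstant v) ∧
    ((S.gTransform u v w).IsAlmostEinstein ↔
      (S.gTransform u v w).IsVerticalConstant v ∧
        (S.gTransform u v w).EqConstMulExpOnVertical k u) := by
  have hf : ContMDiff 𝓘(ℝ, AccR.Model n) 𝓘(ℝ, ℝ) ∞ (fun p => k p * Real.exp (-w p)) :=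
    hk.mul (Real.contDiff_exp.comp_contMDiff hw.neg)
  have hspeed := AccR.AccRData.contMDiff_speed hS hu hw hk
  have hρ := AccR.AccRData.ricciEq_of_verticalConstant hn hS hS0 hu hv hw hk hf hsol h3
  have ha : ContMDiff 𝓘(ℝ, AccR.Model n) 𝓘(ℝ, ℝ) ∞ (fun p =>
      -(2 * n * (σ p + 2 * AccR.mdir S.ξ u p * (k p * Real.exp (-w p)))) - S.speed u w k p) :=
    (contMDiff_const.mul (hsol.1.add ((contMDiff_const.mul
      (AccR.contMDiff_mdir hS.smooth_ξ hu)).mul hf))).neg.sub hspeed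
  have hη := fun h => AccR.AccRData.mdir_v_eq_zero_of_isAlmostEtaEinstein hn hS hS0 hu hv hw hf
    hk0 hsol h
  rw [AccR.AccRData.isVerticalConstant_gTransform_iff,
    AccR.AccRData.eqConstMulExpOnVertical_gTransform_iff hS hu hw hk]
  refine ⟨⟨hη, fun h => ⟨_, _, ha, (contMDiff_const.mul hspeed).neg, hρ h⟩⟩, fun h => ?_,
    fun ⟨h, h0⟩ => ⟨_, ha, ?_⟩⟩
  -- An Einstein metric is η-Einstein with c = 0, so the first equivalence already supplies dv(ξ) =
  -- 0.
  · have hvert := hη (by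
      obtain ⟨a, hsa, hra⟩ := h
      exact ⟨a, fun _ => 0, hsa, contMDiff_const, hra⟩)
    exact ⟨hvert, AccR.AccRData.speed_eq_zero_of_isAlmostEinstein hn hS hS0 hu hv hw hk hf hsol
      h3 hvert h⟩
  · have h1 := hρ h
    have hc : (fun p => -((2 * (n : ℝ) - 1) * S.speed u w k p)) = fun _ => 0 :=
      funext fun p => by rw [h0 p, mul_zero, neg_zero]
    rwa [hc] at h1
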